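/- **Setting.** A symmetry of $\mathbb C^n$ in one of the ten Altland–Zirnbauer classes consists of the operators listed below, where $T,P$ are antiunitary, $S$ is unitary, and $TP=PT$ whenever both $T$ and $P$ occur: - A: none; AIII: $S$ with $S^2=1$; AI: $T^2=1$; AII: $T^2=-1$; D: $P^2=1$; C: $P^2=-1$; - BDI: $T^2=1,\ P^2=1$; DIII: $T^2=-1,\ P^2=1$; CII: $T^2=-1,\ P^2=-1$; CI: $T^2=1,\ P^2=-1$ (in these four, $S:=TP$). Given such operators, let $\mathcal G$ be the set of invertible Hermitian $H\in M_n(\mathbb C)$ with $TH=HT$, $PH=-HP$, $SH=-HS$ for those of $T,P,S$ that occur. Call an orthonormal basis $b$ of $\mathbb C^n$ *adapted* if: in class D, $Pb_j=b_j$ for all $j$; in class BDI, $n$ is even, $Tb_j=b_j$ for all $j$, and $TPb_j=b_j$ for the first $n/2$ basis vectors, $TPb_j=-b_j$ for the others; in the other eight classes, every orthonormal basis is adapted. Let $M=(\langle b_j,Hb_k\rangle)_{j,k}$ be the matrix of $H$ in such a basis. The signature $\mathrm{Sig}$ is the number of positive minus the number of negative eigenvalues, with multiplicity. Define the index $$\mathrm{Ind}(H)=\begin{cases}\tfrac12\mathrm{Sig}(M)=\tfrac12\mathrm{Sig}(H)&\text{classes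 A, AI},\\ \tfrac14\mathrm{Sig}(M)=\tfrac14\mathrm{Sig}(H)&\text{class AII},\\ \mathrm{sign}\det(C),\ \ M=\begin{pmatrix}0&C\\ C^{\mathsf T}&0\end{pmatrix},\ C \text{ real}&\text{class BDI},\\ \mathrm{sign}\,\mathrm{Pf}(iM)&\text{class D},\\ 0&\text{classes AIII, DIII, CII, C, CI}.\end{cases}$$ **Theorem.** For each of the ten classes the following hold. 1. For every $n$ and all symmetry operators of the class on $\mathbb C^n$, if $\mathcal G\neq\emptyset$ then an adapted basis exists. 2. Fix $n$, symmetry operators of the class, and an adapted basis. For every $H\in\mathcal G$ the index lies in $\tfrac n2+\mathbb Z$ (A, AI), in $\tfrac n4+\mathbb Z$ (AII), in $\{\pm1\}\cong\mathbb Z_2$ (BDI, D), and is $0$ in the other classes. Two matrices $H_0,H_1\in\mathcal G$ can be joined by a continuous path inside $\mathcal G$ if and only if $\mathrm{Ind}(H_0)=\mathrm{Ind}(H_1)$. 3. The index is computable in $O(n^3)$ time: there are a program, depending only on the class, for a random access machine with exact real arithmetic (unit cost per arithmetic operation, comparison, memory access and branching) and a constant $K$ such that for all $n$, all symmetry operators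 of the class, every adapted basis and all $H\in\mathcal G$, the program, on input $n$ and the real and imaginary parts of the entries of $M$, halts after at most $K(n^3+1)$ steps with output $\mathrm{Ind}(H)$. -/

import Mathlib

noncomputable section

namespace AZ

/-! ### The ten symmetry classes -/

/-- The ten Cartan labels of the Altland-Zirnbauer classification. -/
inductive AZClass
  | A | AIII | AI | BDI | D | DIII | AII | CII | C | CI

/-- The Hilbert space `ℂⁿ`. -/
abbrev Hilb (n : ℕ) := EuclideanSpace ℂ (Fin n)

/-- Antiunitary operators on `ℂⁿ`. -/
abbrev AntiUnitary (n : ℕ) := Hilb n ≃ₛₗᵢ[starRingEnd ℂ] Hilb n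

/-- Unitary operators on `ℂⁿ`. -/
abbrev UnitaryOp (n : ℕ) := Hilb n ≃ₗᵢ[ℂ] Hilb n

/-- The symmetry operators on `ℂⁿ` that a class prescribes, with their squares: time reversal `T`,
particle-hole conjugation `P` (which commutes with `T`, and then `S = T ∘ P`), or a chiral symmetry
`S` alone. -/
inductive AZSymmetry (n : ℕ) : AZClass → Type
  | A : AZSymmetry n .A
  | AIII (S : UnitaryOp n) (hS : ∀ v, S (S v) = v) : AZSymmetry n .AIII
  | AI (T : AntiUnitary n) (hT : ∀ v, T (T v) = v) : AZSymmetry n .AI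
  | BDI (T P : AntiUnitary n) (hT : ∀ v, T (T v) = v) (hP : ∀ v, P (P v) = v)
      (hTP : ∀ v, T (P v) = P (T v)) : AZSymmetry n .BDI
  | D (P : AntiUnitary n) (hP : ∀ v, P (P v) = v) : AZSymmetry n .D
  | DIII (T P : AntiUnitary n) (hT : ∀ v, T (T v) = -v) (hP : ∀ v, P (P v) = v)
      (hTP : ∀ v, T (P v) = P (T v)) : AZSymmetry n .DIII
  | AII (T : AntiUnitary n) (hT : ∀ v, T (T v) = -v) : AZSymmetry n .AII
  | CII (T P : AntiUnitary n) (hT : ∀ v, T (T v) = -v) (hP : ∀ v, P (P v) = -v)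
      (hTP : ∀ v, T (P v) = P (T v)) : AZSymmetry n .CII
  | C (P : AntiUnitary n) (hP : ∀ v, P (P v) = -v) : AZSymmetry n .C
  | CI (T P : AntiUnitary n) (hT : ∀ v, T (T v) = v) (hP : ∀ v, P (P v) = -v)
      (hTP : ∀ v, T (P v) = P (T v)) : AZSymmetry n .CI

/-- `H` commutes with the antiunitary `T`. -/
def CommutesWith {n : ℕ} (H : Matrix (Fin n) (Fin n) ℂ) (T : AntiUnitary n) : Prop :=
  ∀ v, T (Matrix.toEuclideanLin H v) = Matrix.toEuclideanLin H (T v)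

/-- `H` anticommutes with the antiunitary `P`. -/
def AnticommutesWith {n : ℕ} (H : Matrix (Fin n) (Fin n) ℂ) (P : AntiUnitary n) : Prop :=
  ∀ v, P (Matrix.toEuclideanLin H v) = -Matrix.toEuclideanLin H (P v)

/-- `H` has the symmetries of the class. When `T` and `P` are both present, anticommutation with
`S = T ∘ P` follows. -/
def AZSymmetry.Respects {n : ℕ} {c : AZClass} (σ : AZSymmetry n c)
    (H : Matrix (Fin n) (Fin n) ℂ) : Prop :=
  match σ with
  | .A => True
  | .AIII S _ => ∀ v, S (Matrix.toEuclideanLin H v) = -Matrix.toEuclideanLin H (S v)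
  | .AI T _ => CommutesWith H T
  | .BDI T P _ _ _ => CommutesWith H T ∧ AnticommutesWith H P
  | .D P _ => AnticommutesWith H P
  | .DIII T P _ _ _ => CommutesWith H T ∧ AnticommutesWith H P
  | .AII T _ => CommutesWith H T
  | .CII T P _ _ _ => CommutesWith H T ∧ AnticommutesWith H P
  | .C P _ => AnticommutesWith H P
  | .CI T P _ _ _ => CommutesWith H T ∧ AnticommutesWith H P

/-- The invertible Hermitian matrices with the given symmetries. -/
def AZSymmetry.invertibles {n : ℕ} {c : AZClass} (σ : AZSymmetry n c) :
    Set (Matrix (Fin n) (Fin n) ℂ) :=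
  {H | H.IsHermitian ∧ IsUnit H ∧ σ.Respects H}

/-! ### Coordinates in which the symmetries take their standard form -/

/-- An orthonormal basis is adapted to the symmetry operators when, in its coordinates,
`P` is complex conjugation (class `D`), respectively `T` is complex conjugation and
`S = T ∘ P` is the block matrix `diag(I, -I)` with blocks of equal size (class `BDI`).
In the other classes there is no condition. -/
def AZSymmetry.Adapted {n : ℕ} {c : AZClass} (σ : AZSymmetry n c)
    (b : OrthonormalBasis (Fin n) ℂ (Hilb n)) : Prop :=
  match σ with
  | .D P _ => ∀ j, P (b j) = b j
  | .BDI T P _ _ _ => Even n ∧ (∀ j, T (b j) = b j) ∧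
      ∀ j : Fin n, T (P (b j)) = if (j : ℕ) < n / 2 then b j else -b j
  | _ => True

/-- The matrix of `H` in the orthonormal basis `b`. -/
def matrixIn {n : ℕ} (b : OrthonormalBasis (Fin n) ℂ (Hilb n)) (H : Matrix (Fin n) (Fin n) ℂ) :
    Matrix (Fin n) (Fin n) ℂ :=
  Matrix.of fun j k => inner ℂ (b j) (Matrix.toEuclideanLin H (b k))

/-! ### The indices -/

open Classical in
/-- The signature: the number of positive minus the number of negative eigenvalues, counted with
multiplicity (`0` by convention if the matrix is not Hermitian). -/
def signature {n : ℕ} (M : Matrix (Fin n) (Fin n) ℂ) : ℤ :=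
  if h : M.IsHermitian then
    ((Finset.univ.filter fun j => 0 < h.eigenvalues j).card : ℤ) -
      ((Finset.univ.filter fun j => h.eigenvalues j < 0).card : ℤ)
  else 0

open scoped Nat in
/-- The Pfaffian of an `n × n` skew-symmetric matrix: with `n = 2m`,
`1 / (2 ^ m m!) ∑ σ, sgn σ ∏ i < m, K (σ (2i)) (σ (2i+1))`; it is `0` for odd `n`. -/
def pfaffian {n : ℕ} (K : Matrix (Fin n) (Fin n) ℝ) : ℝ :=
  if Even n then
    (1 / ((2 : ℝ) ^ (n / 2) * ((n / 2)! : ℝ))) *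
      ∑ σ : Equiv.Perm (Fin n), ((Equiv.Perm.sign σ : ℤ) : ℝ) *
        ∏ i : Fin (n / 2), K (σ ⟨2 * i, by omega⟩) (σ ⟨2 * i + 1, by omega⟩)
  else 0

/-- The entrywise real part. It is applied only to matrices that are real. -/
def realMatrix {m n : ℕ} (M : Matrix (Fin m) (Fin n) ℂ) : Matrix (Fin m) (Fin n) ℝ :=
  M.map Complex.re

/-- The upper right block `C` of `[[0, C], [Cᵀ, 0]]`. -/
def upperRight {n : ℕ} (M : Matrix (Fin n) (Fin n) ℂ) : Matrix (Fin (n / 2)) (Fin (n / 2)) ℂ :=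
  Matrix.of fun j k => M ⟨j, by omega⟩ ⟨n / 2 + k, by omega⟩

/-- The index of a class, as a function of the matrix in adapted coordinates. -/
def index {n : ℕ} (c : AZClass) (M : Matrix (Fin n) (Fin n) ℂ) : ℝ :=
  match c with
  | .A => (signature M : ℝ) / 2
  | .AI => (signature M : ℝ) / 2
  | .AII => (signature M : ℝ) / 4
  | .BDI => Real.sign (realMatrix (upperRight M)).det
  | .D => Real.sign (pfaffian (realMatrix (Complex.I • M)))
  | _ => 0

/-- Where the index takes its values, for matrices of size `n`: a translate of `ℤ` in the classes
`A`, `AI` and `AII`, the group `{1, -1}` in the classes `BDI` and `D`, the zero group otherwise. -/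
def indexRange (c : AZClass) (n : ℕ) : Set ℝ :=
  match c with
  | .A => {x | ∃ k : ℤ, x = (n : ℝ) / 2 + k}
  | .AI => {x | ∃ k : ℤ, x = (n : ℝ) / 2 + k}
  | .AII => {x | ∃ k : ℤ, x = (n : ℝ) / 4 + k}
  | .BDI => {1, -1}
  | .D => {1, -1}
  | _ => {0}

/-! ### A real random access machine with a step count

A program has finitely many counters, which hold natural numbers, and finitely many
two-dimensional arrays of exact real numbers, whose cells are addressed through the counters.
Every arithmetic operation, memory access, comparison and branching costs one step. -/

/-- Expressions for addresses and loop bounds. -/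
inductive AddrExpr
  | const (k : ℕ)
  | var (x : ℕ)
  | add (e f : AddrExpr)
  | sub (e f : AddrExpr)

/-- Real-valued expressions; `cell a i j` reads the entry `(i, j)` of the array `a`. -/
inductive RealExpr
  | const (k : ℤ)
  | cell (a : ℕ) (i j : AddrExpr)
  | neg (e : RealExpr)
  | add (e f : RealExpr)
  | sub (e f : RealExpr)
  | mul (e f : RealExpr)
  | div (e f : RealExpr)

/-- Tests. -/
inductive Test
  | addrEq (e f : AddrExpr)
  | addrLt (e f : AddrExpr)
  | realEq (e f : RealExpr)
  | realLt (e f : RealExpr)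

/-- Programs. -/
inductive Program
  | skip
  | setCounter (x : ℕ) (e : AddrExpr)
  | setCell (a : ℕ) (i j : AddrExpr) (e : RealExpr)
  | seq (p q : Program)
  | ite (t : Test) (p q : Program)
  | while (t : Test) (p : Program)

/-- The contents of the memory. -/
structure Store where
  counter : ℕ → ℕ
  cell : ℕ → ℕ → ℕ → ℝ

def AddrExpr.eval (s : Store) : AddrExpr → ℕ
  | .const k => k
  | .var x => s.counter x
  | .add e f => e.eval s + f.eval s
  | .sub e f => e.eval s - f.eval s

/-- The number of steps needed to evaluate an expression. -/
def AddrExpr.cost : AddrExpr → ℕ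
  | .const _ => 1
  | .var _ => 1
  | .add e f => e.cost + f.cost + 1
  | .sub e f => e.cost + f.cost + 1

def RealExpr.eval (s : Store) : RealExpr → ℝ
  | .const k => (k : ℝ)
  | .cell a i j => s.cell a (i.eval s) (j.eval s)
  | .neg e => -e.eval s
  | .add e f => e.eval s + f.eval s
  | .sub e f => e.eval s - f.eval s
  | .mul e f => e.eval s * f.eval s
  | .div e f => e.eval s / f.eval s

def RealExpr.cost : RealExpr → ℕ
  | .const _ => 1
  | .cell _ i j => i.cost + j.cost + 1
  | .neg e => e.cost + 1
  | .add e f => e.cost + f.cost + 1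
  | .sub e f => e.cost + f.cost + 1
  | .mul e f => e.cost + f.cost + 1
  | .div e f => e.cost + f.cost + 1

def Test.Holds (s : Store) : Test → Prop
  | .addrEq e f => e.eval s = f.eval s
  | .addrLt e f => e.eval s < f.eval s
  | .realEq e f => e.eval s = f.eval s
  | .realLt e f => e.eval s < f.eval s

def Test.cost : Test → ℕ
  | .addrEq e f => e.cost + f.cost + 1
  | .addrLt e f => e.cost + f.cost + 1
  | .realEq e f => e.cost + f.cost + 1
  | .realLt e f => e.cost + f.cost + 1

def Store.setCounter (s : Store) (x v : ℕ) : Store :=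
  { s with counter := fun y => if y = x then v else s.counter y }

def Store.setCell (s : Store) (a i j : ℕ) (v : ℝ) : Store :=
  { s with cell := fun a' i' j' => if a' = a ∧ i' = i ∧ j' = j then v else s.cell a' i' j' }

/-- `Runs p s t s'`: the program `p`, started on the store `s`, halts after exactly `t` steps and
leaves the store `s'`. -/
inductive Runs : Program → Store → ℕ → Store → Prop
  | skip (s : Store) : Runs .skip s 1 s
  | setCounter (x : ℕ) (e : AddrExpr) (s : Store) :
      Runs (.setCounter x e) s (e.cost + 1) (s.setCounter x (e.eval s))
  | setCell (a : ℕ) (i j : AddrExpr) (e : RealExpr) (s : Store) :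
      Runs (.setCell a i j e) s (i.cost + j.cost + e.cost + 1)
        (s.setCell a (i.eval s) (j.eval s) (e.eval s))
  | seq {p q : Program} {s s' s'' : Store} {t t' : ℕ} (hp : Runs p s t s') (hq : Runs q s' t' s'') :
      Runs (.seq p q) s (t + t') s''
  | iteTrue {b : Test} {p : Program} (q : Program) {s s' : Store} {t : ℕ} (hb : b.Holds s)
      (hp : Runs p s t s') : Runs (.ite b p q) s (b.cost + 1 + t) s'
  | iteFalse {b : Test} (p : Program) {q : Program} {s s' : Store} {t : ℕ} (hb : ¬ b.Holds s)
      (hq : Runs q s t s') : Runs (.ite b p q) s (b.cost + 1 + t) s'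
  | whileTrue {b : Test} {p : Program} {s s' s'' : Store} {t t' : ℕ} (hb : b.Holds s)
      (hp : Runs p s t s') (hw : Runs (.while b p) s' t' s'') :
      Runs (.while b p) s (b.cost + 1 + t + t') s''
  | whileFalse {b : Test} (p : Program) {s : Store} (hb : ¬ b.Holds s) :
      Runs (.while b p) s (b.cost + 1) s

/-- The initial store for an `n × n` complex matrix: `n` in counter `0`, the real parts of the
entries in array `0`, the imaginary parts in array `1`, zero everywhere else. -/
def inputStore {n : ℕ} (M : Matrix (Fin n) (Fin n) ℂ) : Store where
  counter := fun x => if x = 0 then n else 0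
  cell := fun a i j =>
    if h : i < n ∧ j < n then
      if a = 0 then (M ⟨i, h.1⟩ ⟨j, h.2⟩).re
      else if a = 1 then (M ⟨i, h.1⟩ ⟨j, h.2⟩).im
      else 0
    else 0

/-- The result of a computation is read off from the cell `(0, 0)` of array `2`. -/
def Store.output (s : Store) : ℝ := s.cell 2 0 0

end AZ

end

/-!
In each class the symmetries are linear constraints `X H = ± H X` with real-linear operators `X`.

*Components.* The segment from `H` to `sgn H` stays in the set (`joinedIn_sgn`), so it suffices to
connect Hermitian involutions `F`, `G` with the same index. If `F + G` is invertible, the segment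
from `F` to `G` consists of invertible matrices (`joinedIn_of_isUnit_add`). Otherwise the kernel of
`F + G` is the orthogonal sum of the spaces `F = 1, G = -1` and `F = -1, G = 1`. Take orthonormal
families `e` and `f` in the first and the second of these spaces whose exchange
`K = ∑ |f⟩⟨e| + |e⟩⟨f|` is compatible with the symmetries; rotating `F` by `K` reverses its sign on
the span of `e` and `f`, and the kernel shrinks (`joinedIn_of_hasRotation`). In the classes `A`,
`AI`, `AII` equality of the signatures makes both spaces nonzero (`exists_unit_posNeg_of_trace`). In
the other seven classes an operator that anticommutes with `F` and `G` interchanges the two spaces,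
and `f` is the image of `e` up to phases and reordering. In the classes `BDI` and `D` the rotation
needs two-dimensional spaces. If they are lines, reflecting `F` in a hyperplane reverses its sign on
the whole kernel (`joinedIn_reflect`), so that the reflected involution is joined to `G`; but the
reflection has real determinant `-1` and reverses the index (`sign_pfaffian_reflect`,
`sign_det_block_reflect`), which contradicts the equality of the indices.

Conversely, the index is constant along paths: the signature is locally constant on invertible
Hermitian matrices (`eventually_signature_eq`), because `⟨sgn A v, B v⟩` is positive for `B` near
`A`, which makes `sgn A + sgn B` invertible; the Pfaffian and the determinant of the block are
continuous and do not vanish.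

*Range.* The signature is `n` minus twice the number of negative eigenvalues. In class `AII` these
come in Kramers pairs `v`, `T v` (`exists_trace_eq_AII`).

*Computation.* Symmetric elimination `A ↦ L A Lᴴ` with transvections `L` brings `A` to diagonal
form (signature), to `2 × 2` block-diagonal form (Pfaffian) or makes its upper right block diagonal
(class `BDI`), with `O(n²)` transvections of cost `O(n)`. The invariance of the signature
under a transvection follows from its invariance along the path `t ↦ L(t)`, that of the Pfaffian
from `pfaffian (B A Bᵀ) = det B * pfaffian A` (`pfaffian_congruence`).

*Adapted bases* are built one vector at a time: the orthogonal complement of a family of real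
vectors is invariant under the symmetries and contains a further real vector
(`exists_orthonormalBasis`). In class `BDI` the spaces `S = ± 1` have equal dimensions because
an invertible matrix anticommuting with `S` forces `tr S = 0`.
-/

noncomputable section

namespace AZ

open Matrix Topology Filter

/-! ### Matrices as operators -/

section operators
variable {n : ℕ}

lemma toLin_mul (A B : Matrix (Fin n) (Fin n) ℂ) (v : Hilb n) :
    toEuclideanLin (A * B) v = toEuclideanLin A (toEuclideanLin B v) := by
  simp [toEuclideanLin]

lemma toLin_one (v : Hilb n) : toEuclideanLin (1 : Matrix (Fin n) (Fin n) ℂ) v = v := by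
  simp [toEuclideanLin]

lemma toLin_add (A B : Matrix (Fin n) (Fin n) ℂ) (v : Hilb n) :
    toEuclideanLin (A + B) v = toEuclideanLin A v + toEuclideanLin B v := by
  simp

lemma toLin_sub (A B : Matrix (Fin n) (Fin n) ℂ) (v : Hilb n) :
    toEuclideanLin (A - B) v = toEuclideanLin A v - toEuclideanLin B v := by
  simp

lemma toLin_neg (A : Matrix (Fin n) (Fin n) ℂ) (v : Hilb n) :
    toEuclideanLin (-A) v = -toEuclideanLin A v := by
  simp

lemma toLin_real_smul (a : ℝ) (A : Matrix (Fin n) (Fin n) ℂ) (v : Hilb n) :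
    toEuclideanLin (a • A) v = (a : ℂ) • toEuclideanLin A v := by
  rw [← Complex.coe_smul a A, map_smul, LinearMap.smul_apply]

lemma toLin_ext {A B : Matrix (Fin n) (Fin n) ℂ}
    (h : ∀ v, toEuclideanLin A v = toEuclideanLin B v) : A = B :=
  toEuclideanLin.injective (LinearMap.ext h)

lemma inner_toLin_left (A : Matrix (Fin n) (Fin n) ℂ) (v w : Hilb n) :
    inner ℂ (toEuclideanLin A v) w = inner ℂ v (toEuclideanLin Aᴴ w) := by
  rw [Matrix.toEuclideanLin_conjTranspose_eq_adjoint, LinearMap.adjoint_inner_right]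

lemma inner_toLin_right (A : Matrix (Fin n) (Fin n) ℂ) (v w : Hilb n) :
    inner ℂ v (toEuclideanLin A w) = inner ℂ (toEuclideanLin Aᴴ v) w := by
  rw [Matrix.toEuclideanLin_conjTranspose_eq_adjoint, LinearMap.adjoint_inner_left]

lemma isUnit_of_injective {A : Matrix (Fin n) (Fin n) ℂ}
    (h : ∀ v, toEuclideanLin A v = 0 → v = 0) : IsUnit A := by
  rw [← Matrix.mulVec_injective_iff_isUnit]
  intro x y hxy
  have := h (WithLp.toLp 2 (x - y)) (by
    simp only [toEuclideanLin, toLpLin_apply, Matrix.mulVec_sub]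
    simp [hxy])
  exact sub_eq_zero.1 ((WithLp.toLp_eq_zero 2).1 this)

lemma toLin_injective_of_isUnit {A : Matrix (Fin n) (Fin n) ℂ} (hA : IsUnit A) {v : Hilb n}
    (h : toEuclideanLin A v = 0) : v = 0 := by
  obtain ⟨B, hB⟩ := hA.exists_left_inv
  rw [← toLin_one v, ← hB, toLin_mul, h, map_zero]

lemma isUnit_of_sq_eq_one {A : Matrix (Fin n) (Fin n) ℂ} (h : A * A = 1) : IsUnit A :=
  ⟨⟨A, A, h, h⟩, rfl⟩

end operators

/-! ### Functional calculus and the sign of a Hermitian matrix -/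

section calculus
variable {n : ℕ} {A : Matrix (Fin n) (Fin n) ℂ}

lemma continuousOn_spectrum (A : Matrix (Fin n) (Fin n) ℂ) (f : ℝ → ℝ) :
    ContinuousOn f (spectrum ℝ A) :=
  (Matrix.finite_real_spectrum (A := A)).continuousOn f

/-- Writing `f y - f x = g y * (y - x)` reduces the claim to `(A - x) v = 0`. -/
lemma cfc_toLin_eigenvector (hA : A.IsHermitian) (f : ℝ → ℝ) {v : Hilb n} {x : ℝ}
    (hv : toEuclideanLin A v = (x : ℂ) • v) :
    toEuclideanLin (cfc f A) v = (f x : ℂ) • v := by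
  set g : ℝ → ℝ := fun y => (f y - f x) / (y - x)
  have hsa : IsSelfAdjoint A := hA
  have h : cfc f A = cfc g A * (A - x • 1) + f x • 1 := by
    have h1 : (A - x • 1 : Matrix (Fin n) (Fin n) ℂ) = cfc (fun y => y - x) A := by
      have h2 := cfc_add_const (-x) (fun y : ℝ => y) A (continuousOn_spectrum A _)
      rw [cfc_id' ℝ A, Algebra.algebraMap_eq_smul_one, neg_smul] at h2
      simpa only [sub_eq_add_neg] using h2.symm
    rw [h1, ← cfc_mul g _ A (continuousOn_spectrum A _) (continuousOn_spectrum A _),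
      ← Algebra.algebraMap_eq_smul_one,
      ← cfc_add_const (f x) _ A (continuousOn_spectrum A _)]
    congr 1
    funext y
    by_cases hy : y = x
    · simp [hy]
    · simp only [g]
      field_simp [sub_ne_zero.2 hy]
      ring
  rw [h, toLin_add, toLin_mul, toLin_sub, toLin_real_smul, toLin_real_smul, toLin_one, hv]
  simp

/-- The sign of a Hermitian matrix, in the sense of functional calculus. -/
def sgn (A : Matrix (Fin n) (Fin n) ℂ) : Matrix (Fin n) (Fin n) ℂ := cfc Real.sign A

lemma isHermitian_cfc (f : ℝ → ℝ) (A : Matrix (Fin n) (Fin n) ℂ) : (cfc f A).IsHermitian :=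
  cfc_predicate f A

lemma zero_notMem_spectrum (hu : IsUnit A) : (0 : ℝ) ∉ spectrum ℝ A :=
  spectrum.zero_notMem ℝ hu

lemma sgn_mul_sgn (hA : A.IsHermitian) (hu : IsUnit A) : sgn A * sgn A = 1 := by
  have hsa : IsSelfAdjoint A := hA
  rw [sgn, ← cfc_mul _ _ A (continuousOn_spectrum A _) (continuousOn_spectrum A _),
    ← cfc_const_one ℝ A]
  refine cfc_congr fun x hx => ?_
  have hx0 : x ≠ 0 := fun h => zero_notMem_spectrum hu (h ▸ hx)
  rcases hx0.lt_or_gt with h | h <;> simp [Real.sign_of_neg, Real.sign_of_pos, h]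

open Classical in
lemma signature_eq_sum (hA : A.IsHermitian) :
    (signature A : ℝ) = ∑ j, Real.sign (hA.eigenvalues j) := by
  rw [signature, dif_pos hA, Finset.card_filter, Finset.card_filter]
  push_cast
  rw [← Finset.sum_sub_distrib]
  refine Finset.sum_congr rfl fun j _ => ?_
  rcases lt_trichotomy (hA.eigenvalues j) 0 with h | h | h
  · simp [h, h.le, Real.sign_of_neg]
  · simp [h]
  · simp [h, h.le, Real.sign_of_pos]

/-- In this form the signature depends only on the characteristic polynomial. -/
lemma signature_eq_roots (hA : A.IsHermitian) :
    (signature A : ℝ) = (A.charpoly.roots.map fun z => Real.sign z.re).sum := by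
  rw [signature_eq_sum hA, hA.roots_charpoly_eq_eigenvalues, Multiset.map_map]
  simp [Finset.sum]

lemma trace_cfc (hA : A.IsHermitian) (f : ℝ → ℝ) :
    (cfc f A).trace = ∑ j, (f (hA.eigenvalues j) : ℂ) := by
  rw [hA.cfc_eq, Matrix.IsHermitian.cfc, Unitary.conjStarAlgAut_apply, Matrix.trace_mul_cycle]
  simp [Matrix.trace]

lemma trace_sgn (hA : A.IsHermitian) : (sgn A).trace = (signature A : ℝ) := by
  rw [signature_eq_sum hA, sgn, trace_cfc hA]
  push_cast
  rfl

lemma signature_diagonal (d : Fin n → ℝ) :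
    (signature (Matrix.diagonal fun i => (d i : ℂ)) : ℝ) = ∑ i, Real.sign (d i) := by
  have h : (Matrix.diagonal fun i => (d i : ℂ)).IsHermitian := by
    rw [Matrix.isHermitian_diagonal_iff]
    intro i
    simp [isSelfAdjoint_iff]
  have h2 : (∏ i, (Polynomial.X - Polynomial.C (d i : ℂ))).roots
      = Finset.univ.val.map fun i => (d i : ℂ) := by
    have := Polynomial.roots_multiset_prod_X_sub_C (Finset.univ.val.map fun i => (d i : ℂ))
    rwa [Multiset.map_map] at this
  rw [signature_eq_roots h, Matrix.charpoly_diagonal, h2, Multiset.map_map]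
  simp [Finset.sum]

/-- The operator `|A| = sgn A * A` is bounded below when `A` is invertible. -/
lemma exists_le_inner_sgn (hA : A.IsHermitian) (hu : IsUnit A) :
    ∃ c : ℝ, 0 < c ∧ ∀ v : Hilb n,
      c * ‖v‖ ^ 2 ≤ (inner ℂ (toEuclideanLin (sgn A) v) (toEuclideanLin A v)).re := by
  have hsa : IsSelfAdjoint A := hA
  set B := cfc (fun x => Real.sqrt |x|) A with hB
  have hBH : Bᴴ = B := isHermitian_cfc _ _
  have hBB : B * B = sgn A * A := by
    have h2 : sgn A * A = cfc (fun x => Real.sign x * id x) A := by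
      rw [cfc_mul _ _ A (continuousOn_spectrum A _) (continuousOn_spectrum A _), cfc_id ℝ A, sgn]
    rw [h2, hB, ← cfc_mul _ _ A (continuousOn_spectrum A _) (continuousOn_spectrum A _)]
    refine cfc_congr fun x _ => ?_
    simp only [id]
    rw [Real.mul_self_sqrt (abs_nonneg x)]
    rcases lt_trichotomy x 0 with h | h | h
    · simp [Real.sign_of_neg h, abs_of_neg h]
    · simp [h]
    · simp [Real.sign_of_pos h, abs_of_pos h]
  have hBu : IsUnit B := by
    have : IsUnit (B * B) := by
      rw [hBB]
      exact (isUnit_of_sq_eq_one (sgn_mul_sgn hA hu)).mul hu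
    rw [Matrix.isUnit_iff_isUnit_det] at this ⊢
    rw [Matrix.det_mul] at this
    exact isUnit_of_mul_isUnit_left this
  obtain ⟨D, hD⟩ := hBu.exists_left_inv
  set C := toEuclideanCLM (n := Fin n) (𝕜 := ℂ) D
  have hle (v : Hilb n) : ‖v‖ ≤ (‖C‖ + 1) * ‖toEuclideanLin B v‖ := by
    have h1 : C (toEuclideanLin B v) = v := by
      conv_rhs => rw [← toLin_one v, ← hD, toLin_mul]
      rfl
    calc ‖v‖ = ‖C (toEuclideanLin B v)‖ := by rw [h1]
      _ ≤ ‖C‖ * ‖toEuclideanLin B v‖ := C.le_opNorm _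
      _ ≤ _ := by gcongr; linarith
  have hpos : 0 < ‖C‖ + 1 := by positivity
  refine ⟨((‖C‖ + 1) ^ 2)⁻¹, by positivity, fun v => ?_⟩
  have h2 : inner ℂ (toEuclideanLin (sgn A) v) (toEuclideanLin A v)
      = inner ℂ (toEuclideanLin B v) (toEuclideanLin B v) := by
    have hs : (sgn A)ᴴ = sgn A := isHermitian_cfc _ _
    rw [inner_toLin_left, inner_toLin_left, ← toLin_mul, ← toLin_mul, hs, hBH, hBB]
  rw [h2, inner_self_eq_norm_sq_to_K, inv_mul_le_iff₀ (by positivity)]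
  have := hle v
  calc ‖v‖ ^ 2 ≤ ((‖C‖ + 1) * ‖toEuclideanLin B v‖) ^ 2 := by gcongr
    _ = _ := by
      rw [mul_pow]
      congr 1
      norm_cast

/-- Two Hermitian involutions with invertible sum are conjugate, hence have the same trace. -/
lemma trace_eq_of_isUnit_add {F G : Matrix (Fin n) (Fin n) ℂ} (hF : F * F = 1) (hG : G * G = 1)
    (hu : IsUnit (F + G)) : F.trace = G.trace := by
  obtain ⟨u, hu⟩ := hu
  have h : (u : Matrix (Fin n) (Fin n) ℂ) * F = G * u := by
    rw [hu, add_mul, mul_add, hF, hG, add_comm]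
  calc F.trace = ((↑u⁻¹ : Matrix (Fin n) (Fin n) ℂ) * (u * F)).trace := by
        rw [← mul_assoc, Units.inv_mul, one_mul]
    _ = G.trace := by
        rw [h, Matrix.trace_mul_comm, mul_assoc, Units.mul_inv, mul_one]

/-- The signature is locally constant on invertible Hermitian matrices: if `B` is close to `A` and
`sgn A v = -sgn B v`, then `⟪sgn A v, B v⟫` is at once positive, by closeness to `⟪sgn A v, A v⟫`,
and negative. Hence `sgn A + sgn B` is invertible, and the traces of `sgn A` and `sgn B` agree. -/
lemma eventually_signature_eq (hA : A.IsHermitian) (hu : IsUnit A) :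
    ∀ᶠ B in 𝓝 A, B.IsHermitian → IsUnit B → signature B = signature A := by
  obtain ⟨c, hc, hcA⟩ := exists_le_inner_sgn hA hu
  set Φ : Matrix (Fin n) (Fin n) ℂ → (Hilb n →L[ℂ] Hilb n) :=
    fun B => toEuclideanCLM (n := Fin n) (𝕜 := ℂ) B with hΦ
  have hcont : Continuous Φ :=
    LinearMap.continuous_of_finiteDimensional
      ((toEuclideanCLM (n := Fin n) (𝕜 := ℂ)).toAlgEquiv.toLinearMap)
  have hlim : Tendsto (fun B => ‖Φ (sgn A)‖ * ‖Φ (B - A)‖) (𝓝 A) (𝓝 0) := by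
    have : Continuous fun B => ‖Φ (sgn A)‖ * ‖Φ (B - A)‖ := by fun_prop
    have h2 := this.tendsto A
    simpa [hΦ] using h2
  filter_upwards [hlim.eventually (gt_mem_nhds hc)] with B hB hBH hBu
  obtain ⟨d, hd, hdB⟩ := exists_le_inner_sgn hBH hBu
  have hsum : IsUnit (sgn B + sgn A) := by
    refine isUnit_of_injective fun v hv => ?_
    by_contra hv0
    have hvpos : 0 < ‖v‖ ^ 2 := by positivity
    have e : toEuclideanLin (sgn A) v = -toEuclideanLin (sgn B) v := by
      rw [toLin_add] at hv
      exact eq_neg_of_add_eq_zero_right hv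
    have h1 := hcA v
    have h2 := hdB v
    have h3 : (inner ℂ (toEuclideanLin (sgn A) v) (toEuclideanLin B v)).re ≤ - (d * ‖v‖ ^ 2) := by
      rw [e, inner_neg_left, Complex.neg_re]
      linarith
    have h4 : |(inner ℂ (toEuclideanLin (sgn A) v) (toEuclideanLin (B - A) v)).re|
        ≤ ‖Φ (sgn A)‖ * ‖Φ (B - A)‖ * ‖v‖ ^ 2 := by
      calc _ ≤ ‖inner ℂ (toEuclideanLin (sgn A) v) (toEuclideanLin (B - A) v)‖ :=
            Complex.abs_re_le_norm _
        _ ≤ ‖Φ (sgn A) v‖ * ‖Φ (B - A) v‖ := norm_inner_le_norm _ _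
        _ ≤ (‖Φ (sgn A)‖ * ‖v‖) * (‖Φ (B - A)‖ * ‖v‖) := by
            gcongr <;> exact ContinuousLinearMap.le_opNorm _ _
        _ = _ := by ring
    have h5 : (inner ℂ (toEuclideanLin (sgn A) v) (toEuclideanLin (B - A) v)).re
        = (inner ℂ (toEuclideanLin (sgn A) v) (toEuclideanLin B v)).re
          - (inner ℂ (toEuclideanLin (sgn A) v) (toEuclideanLin A v)).re := by
      rw [toLin_sub, inner_sub_right, Complex.sub_re]
    have h6 := (abs_le.1 h4).1
    have h7 : ‖Φ (sgn A)‖ * ‖Φ (B - A)‖ * ‖v‖ ^ 2 < c * ‖v‖ ^ 2 :=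
      mul_lt_mul_of_pos_right hB hvpos
    have h8 : 0 < d * ‖v‖ ^ 2 := by positivity
    linarith
  have ht := trace_eq_of_isUnit_add (sgn_mul_sgn hBH hBu) (sgn_mul_sgn hA hu) hsum
  rw [trace_sgn hBH, trace_sgn hA] at ht
  exact_mod_cast ht

lemma signature_eq_of_joinedIn {S : Set (Matrix (Fin n) (Fin n) ℂ)}
    (hS : ∀ B ∈ S, B.IsHermitian ∧ IsUnit B) {B C : Matrix (Fin n) (Fin n) ℂ}
    (h : JoinedIn S B C) : signature B = signature C := by
  obtain ⟨γ, hγ⟩ := h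
  have hloc : IsLocallyConstant fun t => signature (γ t) := by
    rw [IsLocallyConstant.iff_eventually_eq]
    intro t
    obtain ⟨h1, h2⟩ := hS _ (hγ t)
    filter_upwards [γ.continuous.continuousAt.eventually (eventually_signature_eq h1 h2)] with s hs
    exact hs (hS _ (hγ s)).1 (hS _ (hγ s)).2
  have := hloc.apply_eq_of_preconnectedSpace 0 1
  simpa using this

/-- Sylvester's law of inertia for a transvection, which is joined to the identity through the
transvections with smaller coefficient. -/
lemma signature_transvection {p q : Fin n} (hpq : p ≠ q) (z : ℂ) (hA : A.IsHermitian)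
    (hu : IsUnit A) :
    signature (transvection p q z * A * (transvection p q z)ᴴ) = signature A := by
  have hmem (w : ℂ) : (transvection p q w * A * (transvection p q w)ᴴ).IsHermitian ∧
      IsUnit (transvection p q w * A * (transvection p q w)ᴴ) := by
    refine ⟨Matrix.isHermitian_mul_mul_conjTranspose _ hA, ?_⟩
    rw [Matrix.isUnit_iff_isUnit_det] at hu ⊢
    simpa [Matrix.det_mul, Matrix.det_conjTranspose, Matrix.det_transvection_of_ne _ _ hpq] using hu
  have hcont : Continuous fun t : unitInterval =>
      transvection p q ((t : ℝ) * z) * A * (transvection p q ((t : ℝ) * z))ᴴ := by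
    have h1 : Continuous fun t : unitInterval => transvection p q ((t : ℝ) * z) := by
      have : (fun t : unitInterval => transvection p q ((t : ℝ) * z))
          = fun t : unitInterval => 1 + ((t : ℝ) : ℂ) • Matrix.single p q z := by
        funext t
        simp [transvection, Matrix.smul_single]
      rw [this]
      fun_prop
    exact (h1.mul continuous_const).mul (h1.matrix_conjTranspose)
  refine (signature_eq_of_joinedIn (S := {B | B.IsHermitian ∧ IsUnit B}) (fun _ h => h) ?_).symm
  exact ⟨⟨⟨_, hcont⟩, by simp, by simp⟩, fun t => hmem _⟩

end calculus

/-! ### Matrices compatible with a set of real-linear operators -/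

section compat
variable {n : ℕ}

/-- A constraint: a real-linear operator `X` together with a sign `ε`, standing for the relation
`X H = ε H X`. Real linearity covers unitary and antiunitary operators alike. -/
abbrev Constraint (n : ℕ) := (Hilb n →ₗ[ℝ] Hilb n) × ℝ

/-- `H` satisfies the constraints: `X H = ε H X` for every `(X, ε)` in the set. -/
def Compat (O : Set (Constraint n)) (H : Matrix (Fin n) (Fin n) ℂ) : Prop :=
  ∀ x ∈ O, ∀ v, x.1 (toEuclideanLin H v) = x.2 • toEuclideanLin H (x.1 v)

/-- The invertible Hermitian matrices that satisfy the constraints. -/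
def compatInvertibles (O : Set (Constraint n)) : Set (Matrix (Fin n) (Fin n) ℂ) :=
  {H | H.IsHermitian ∧ IsUnit H ∧ Compat O H}

variable {O : Set (Constraint n)} {F G H K : Matrix (Fin n) (Fin n) ℂ}

lemma toLin_smul_real (H : Matrix (Fin n) (Fin n) ℂ) (a : ℝ) (v : Hilb n) :
    toEuclideanLin H (a • v) = a • toEuclideanLin H v := by
  rw [← Complex.coe_smul, map_smul, Complex.coe_smul]

lemma toLin_smul_left (a : ℝ) (H : Matrix (Fin n) (Fin n) ℂ) (v : Hilb n) :
    toEuclideanLin (a • H) v = a • toEuclideanLin H v := by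
  rw [toLin_real_smul, Complex.coe_smul]

lemma Compat.add (hG : Compat O G) (hH : Compat O H) : Compat O (G + H) := by
  intro x hx v
  rw [toLin_add, toLin_add, map_add, hG x hx, hH x hx, smul_add]

lemma Compat.smul (a : ℝ) (hH : Compat O H) : Compat O (a • H) := by
  intro x hx v
  rw [toLin_smul_left, map_smul, hH x hx, toLin_smul_left, smul_comm]

lemma Compat.sub (hG : Compat O G) (hH : Compat O H) : Compat O (G - H) := by
  have := hG.add (hH.smul (-1))
  rwa [neg_one_smul, ← sub_eq_add_neg] at this

lemma Compat.mul_mul (hO : ∀ x ∈ O, x.2 = 1 ∨ x.2 = -1) (hF : Compat O F) (hG : Compat O G)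
    (hH : Compat O H) : Compat O (F * G * H) := by
  intro x hx v
  simp only [toLin_mul, hF x hx, hG x hx, hH x hx, toLin_smul_real, smul_smul]
  rcases hO x hx with h | h <;> simp [h]

lemma Compat.sgn (hO : ∀ x ∈ O, x.2 = 1 ∨ x.2 = -1) (hH : H.IsHermitian) (hc : Compat O H) :
    Compat O (sgn H) := by
  intro x hx v
  set U := hH.eigenvectorBasis
  have hU (i : Fin n) (z : ℂ) : toEuclideanLin H (z • U i) = (hH.eigenvalues i : ℂ) • z • U i := by
    have := hH.mulVec_eigenvectorBasis i
    rw [map_smul, smul_comm]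
    congr 1
    apply WithLp.ofLp_injective 2
    simpa [toEuclideanLin, toLpLin_apply] using this
  have key (i : Fin n) (z : ℂ) : x.1 (toEuclideanLin (AZ.sgn H) (z • U i))
      = x.2 • toEuclideanLin (AZ.sgn H) (x.1 (z • U i)) := by
    have h1 : toEuclideanLin H (x.1 (z • U i))
        = ((x.2 * hH.eigenvalues i : ℝ) : ℂ) • x.1 (z • U i) := by
      have h2 := hc x hx (z • U i)
      rw [hU, Complex.coe_smul, map_smul] at h2
      have h3 : x.2 • x.2 • toEuclideanLin H (x.1 (z • U i))
          = toEuclideanLin H (x.1 (z • U i)) := by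
        rw [smul_smul]
        rcases hO x hx with h | h <;> simp [h]
      rw [← h3, ← h2, Complex.coe_smul, mul_smul]
    rw [AZ.sgn, cfc_toLin_eigenvector hH _ (hU i z), cfc_toLin_eigenvector hH _ h1,
      Complex.coe_smul, Complex.coe_smul, map_smul, smul_smul]
    congr 1
    rcases hO x hx with h | h <;> simp [h, Real.sign_neg]
  conv_lhs => rw [← U.sum_repr v]
  conv_rhs => rw [← U.sum_repr v]
  simp only [map_sum, Finset.smul_sum]
  exact Finset.sum_congr rfl fun i _ => key i _

/-- A Hermitian invertible matrix is joined to its sign by a segment. -/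
lemma joinedIn_sgn (hO : ∀ x ∈ O, x.2 = 1 ∨ x.2 = -1) (hH : H ∈ compatInvertibles O) :
    JoinedIn (compatInvertibles O) H (sgn H) := by
  obtain ⟨h1, h2, h3⟩ := hH
  have h4 := sgn_mul_sgn h1 h2
  have hsH : (sgn H)ᴴ = sgn H := isHermitian_cfc _ _
  refine JoinedIn.of_segment_subset ?_
  rintro _ ⟨a, b, ha, hb, hab, rfl⟩
  refine ⟨?_, ?_, (h3.smul a).add ((h3.sgn hO h1).smul b)⟩
  · rw [Matrix.IsHermitian, conjTranspose_add, conjTranspose_smul, conjTranspose_smul, hsH, h1.eq]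
    simp
  · refine isUnit_of_injective fun v hv => ?_
    obtain ⟨c, hc, hcH⟩ := exists_le_inner_sgn h1 h2
    by_contra hv0
    have hvpos : 0 < ‖v‖ ^ 2 := by positivity
    have h5 : (inner ℂ (toEuclideanLin (sgn H) v) (toEuclideanLin (a • H + b • sgn H) v)).re
        = a * (inner ℂ (toEuclideanLin (sgn H) v) (toEuclideanLin H v)).re + b * ‖v‖ ^ 2 := by
      rw [toLin_add, toLin_real_smul, toLin_real_smul, inner_add_right, inner_smul_right,
        inner_smul_right, inner_toLin_left (sgn H) v (toEuclideanLin (sgn H) v), hsH, ← toLin_mul,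
        h4, toLin_one, inner_self_eq_norm_sq_to_K, Complex.add_re, Complex.re_ofReal_mul,
        Complex.re_ofReal_mul]
      norm_cast
    rw [hv, inner_zero_right] at h5
    have h6 := hcH v
    have h7 : 0 < c * ‖v‖ ^ 2 := by positivity
    have h8 := mul_le_mul_of_nonneg_left h6 ha
    simp only [Complex.zero_re] at h5
    rcases ha.eq_or_lt with h | h
    · subst h
      have : b = 1 := by linarith
      subst this
      linarith
    · have := mul_pos h h7
      have := mul_nonneg hb hvpos.le
      linarith

lemma sgn_mem (hO : ∀ x ∈ O, x.2 = 1 ∨ x.2 = -1) (hH : H ∈ compatInvertibles O) :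
    sgn H ∈ compatInvertibles O :=
  (joinedIn_sgn hO hH).target_mem

/-- A unitary involution preserves norms. -/
lemma norm_toLin_of_involution (hF : F.IsHermitian) (hF2 : F * F = 1) (v : Hilb n) :
    ‖toEuclideanLin F v‖ = ‖v‖ := by
  have h : inner ℂ (toEuclideanLin F v) (toEuclideanLin F v) = inner ℂ v v := by
    rw [inner_toLin_left, hF.eq, ← toLin_mul, hF2, toLin_one]
  rw [@norm_eq_sqrt_re_inner ℂ, @norm_eq_sqrt_re_inner ℂ _ _ _ _ v, h]

/-- Two Hermitian involutions with invertible sum are joined by a segment: if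
`(1 - t) F v = -t G v` with `v ≠ 0`, comparing norms gives `t = 1/2`. -/
lemma joinedIn_of_isUnit_add (hF : F ∈ compatInvertibles O) (hG : G ∈ compatInvertibles O)
    (hF2 : F * F = 1) (hG2 : G * G = 1) (hu : IsUnit (F + G)) :
    JoinedIn (compatInvertibles O) F G := by
  refine JoinedIn.of_segment_subset ?_
  rintro _ ⟨a, b, ha, hb, hab, rfl⟩
  refine ⟨?_, ?_, (hF.2.2.smul a).add (hG.2.2.smul b)⟩
  · rw [Matrix.IsHermitian, conjTranspose_add, conjTranspose_smul, conjTranspose_smul, hF.1.eq,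
      hG.1.eq]
    simp
  · refine isUnit_of_injective fun v hv => ?_
    by_contra hv0
    have hvpos : 0 < ‖v‖ := by positivity
    rw [toLin_add, toLin_smul_left, toLin_smul_left] at hv
    have h1 := congrArg norm (eq_neg_of_add_eq_zero_left hv)
    rw [norm_neg, norm_smul, norm_smul, norm_toLin_of_involution hF.1 hF2,
      norm_toLin_of_involution hG.1 hG2, Real.norm_of_nonneg ha, Real.norm_of_nonneg hb] at h1
    have h2 : a = b := mul_right_cancel₀ hvpos.ne' h1
    have h3 : a ≠ 0 := by
      rintro rfl
      rw [← h2] at hab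
      simp at hab
    rw [← h2, ← smul_add, ← toLin_add] at hv
    exact hv0 (toLin_injective_of_isUnit hu ((smul_eq_zero.1 hv).resolve_left h3))

/-- Rotating a Hermitian involution `F` towards a matrix `K` that anticommutes with it reverses the
sign of `F` on the range of the projection `K ^ 2`. -/
lemma joinedIn_rotation (hO : ∀ x ∈ O, x.2 = 1 ∨ x.2 = -1) (hF : F ∈ compatInvertibles O)
    (hF2 : F * F = 1) (hK : K.IsHermitian) (hKc : Compat O K) (hFK : F * K = -(K * F))
    (hK3 : K * K * K = K) :
    JoinedIn (compatInvertibles O) F (F - (2 : ℝ) • (F * K * K)) ∧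
      (F - (2 : ℝ) • (F * K * K)) * (F - (2 : ℝ) • (F * K * K)) = 1 := by
  set D := F * K * K with hD
  have hDc : Compat O D := hF.2.2.mul_mul hO hKc hKc
  have hKF : K * F = -(F * K) := by rw [hFK, neg_neg]
  have hKKF : K * K * F = D := by
    rw [mul_assoc, hKF, mul_neg, ← mul_assoc, hKF, neg_mul, neg_neg, hD]
  have hDH : D.IsHermitian := by
    rw [Matrix.IsHermitian, hD, conjTranspose_mul, conjTranspose_mul, hK.eq, hF.1.eq, ← mul_assoc,
      hKKF]
  have hK4 : K * K * (K * K) = K * K := by rw [← mul_assoc, hK3]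
  have hFD : F * D = K * K := by rw [hD, ← mul_assoc, ← mul_assoc, hF2, one_mul]
  have hDF : D * F = K * K := by rw [hD, mul_assoc F, mul_assoc F, hKKF, hFD]
  have hDD : D * D = K * K := by
    nth_rw 1 [← hKKF]
    rw [mul_assoc, hFD, hK4]
  have hDK : D * K = F * K := by rw [hD, mul_assoc F, mul_assoc F, hK3]
  have hKD : K * D = -(F * K) := by rw [hD, ← mul_assoc, ← mul_assoc, hKF, neg_mul, neg_mul,
    mul_assoc F, mul_assoc F, hK3]
  have sq (a b : ℝ) (hab : a ^ 2 + b ^ 2 = 1) :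
      (F + (a - 1) • D + b • K) * (F + (a - 1) • D + b • K) = 1 := by
    have e : (F + (a - 1) • D + b • K) * (F + (a - 1) • D + b • K)
        = 1 + (a ^ 2 + b ^ 2 - 1) • (K * K) := by
      simp only [add_mul, mul_add, smul_mul_assoc, mul_smul_comm, hF2, hFD, hDF, hDD, hDK, hKD,
        hKF, smul_neg]
      module
    rw [e, hab, sub_self, zero_smul, add_zero]
  have hcont : Continuous fun t : unitInterval =>
      F + (Real.cos (t * Real.pi) - 1) • D + Real.sin (t * Real.pi) • K := by fun_prop
  refine ⟨⟨⟨⟨_, hcont⟩, by simp, ?_⟩, fun t => ⟨?_, ?_, ?_⟩⟩, ?_⟩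
  · simp only [Set.Icc.coe_one, one_mul, Real.cos_pi, Real.sin_pi]
    module
  · change (F + (Real.cos (t * Real.pi) - 1) • D + Real.sin (t * Real.pi) • K).IsHermitian
    rw [Matrix.IsHermitian, conjTranspose_add, conjTranspose_add, conjTranspose_smul,
      conjTranspose_smul, hF.1.eq, hDH.eq, hK.eq]
    simp
  · exact isUnit_of_sq_eq_one (sq _ _ (by rw [Real.cos_sq_add_sin_sq]))
  · exact (hF.2.2.add (hDc.smul _)).add (hKc.smul _)
  · have := sq (-1) 0 (by norm_num)
    have e : F + (-1 - 1 : ℝ) • D + (0 : ℝ) • K = F - (2 : ℝ) • D := by module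
    rwa [e] at this

/-! ### Rank-one operators -/

/-- The rank-one operator `v ↦ ⟪e, v⟫ f`. -/
def outer (f e : Hilb n) : Matrix (Fin n) (Fin n) ℂ := vecMulVec f (star (e : Fin n → ℂ))

lemma toLin_outer (f e v : Hilb n) : toEuclideanLin (outer f e) v = inner ℂ e v • f := by
  ext i
  simp [outer, toEuclideanLin, toLpLin_apply, vecMulVec_mulVec,
    EuclideanSpace.inner_eq_star_dotProduct, dotProduct_comm, mul_comm]

lemma outer_neg_left (f e : Hilb n) : outer (-f) e = -outer f e :=
  toLin_ext fun v => by rw [toLin_neg, toLin_outer, toLin_outer, smul_neg]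

lemma outer_neg_right (f e : Hilb n) : outer f (-e) = -outer f e :=
  toLin_ext fun v => by rw [toLin_neg, toLin_outer, toLin_outer, inner_neg_left, neg_smul]

lemma conjTranspose_outer (f e : Hilb n) : (outer f e)ᴴ = outer e f := by
  ext i j
  simp [outer, vecMulVec_apply, mul_comm]

/-! ### Connecting involutions by rotations -/

/-- If `Q` projects onto a part of the kernel of `F + G` on which `F` is reversed, the kernel of the
new sum is the part of the old kernel orthogonal to the range of `Q`. -/
lemma kernel_add_of_projection {F G : Matrix (Fin n) (Fin n) ℂ} {Q : Matrix (Fin n) (Fin n) ℂ}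
    (hF : F.IsHermitian) (hG : G.IsHermitian) (hF2 : F * F = 1) (hQ : Q.IsHermitian)
    (hQ2 : Q * Q = Q) (hQF : Q * F = F * Q) (hFG : (F + G) * Q = 0) {v : Hilb n}
    (hv : toEuclideanLin (F - (2 : ℝ) • (F * Q) + G) v = 0) :
    toEuclideanLin (F + G) v = 0 ∧ toEuclideanLin Q v = 0 := by
  have h1 : Q * (F + G) = 0 := by
    have := congrArg conjTranspose hFG
    rwa [conjTranspose_mul, conjTranspose_add, hF.eq, hG.eq, hQ.eq, conjTranspose_zero] at this
  have h2 : F * Q * (F - (2 : ℝ) • (F * Q) + G) = (-2 : ℝ) • Q := by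
    have e : F * Q * (F - (2 : ℝ) • (F * Q) + G)
        = F * (Q * (F + G)) - (2 : ℝ) • (F * (Q * F) * Q) := by
      simp only [mul_add, mul_sub, mul_smul_comm, mul_assoc]
      abel
    rw [e, h1, hQF, ← mul_assoc, hF2, one_mul, hQ2]
    simp
  have h3 : toEuclideanLin Q v = 0 := by
    have h4 : toEuclideanLin ((-2 : ℝ) • Q) v = 0 := by rw [← h2, toLin_mul, hv, map_zero]
    rw [toLin_smul_left] at h4
    exact (smul_eq_zero.1 h4).resolve_left (by norm_num)
  refine ⟨?_, h3⟩
  have e : F - (2 : ℝ) • (F * Q) + G = F + G - (2 : ℝ) • (F * Q) := by abel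
  rw [e, toLin_sub, toLin_smul_left, toLin_mul F Q, h3, map_zero, smul_zero, sub_zero] at hv
  exact hv

/-- `F` acts as `1` and `G` as `-1` on `e`. -/
def PosNeg (F G : Matrix (Fin n) (Fin n) ℂ) (e : Hilb n) : Prop :=
  toEuclideanLin F e = e ∧ toEuclideanLin G e = -e

lemma PosNeg.add {e e' : Hilb n} (h : PosNeg F G e) (h' : PosNeg F G e') : PosNeg F G (e + e') :=
  ⟨by rw [map_add, h.1, h'.1], by rw [map_add, h.2, h'.2, neg_add]⟩

lemma PosNeg.smul {e : Hilb n} (z : ℂ) (h : PosNeg F G e) : PosNeg F G (z • e) :=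
  ⟨by rw [map_smul, h.1], by rw [map_smul, h.2, smul_neg]⟩

lemma PosNeg.neg {e : Hilb n} (h : PosNeg F G e) : PosNeg F G (-e) := by
  simpa using h.smul (-1)

lemma PosNeg.inner_eq_zero (hF : F.IsHermitian) {e f : Hilb n} (h : PosNeg F G e)
    (h' : PosNeg G F f) : inner ℂ e f = 0 := by
  have h1 : inner ℂ (toEuclideanLin F e) f = inner ℂ e (toEuclideanLin F f) := by
    rw [inner_toLin_left, hF.eq]
  rw [h.1, h'.2, inner_neg_right] at h1
  exact self_eq_neg.1 h1

/-- `F` preserves the kernel of `F + G`, so a kernel vector splits into eigenvectors of `F`. -/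
lemma exists_posNeg (hF2 : F * F = 1) (hG2 : G * G = 1) {v : Hilb n}
    (hv : toEuclideanLin (F + G) v = 0) :
    ∃ e f, PosNeg F G e ∧ PosNeg G F f ∧ v = e + f := by
  rw [toLin_add] at hv
  have h1 : toEuclideanLin G v = -toEuclideanLin F v := eq_neg_of_add_eq_zero_right hv
  have h2 : toEuclideanLin F (toEuclideanLin F v) = v := by rw [← toLin_mul, hF2, toLin_one]
  have h3 : toEuclideanLin G (toEuclideanLin F v) = -v := by
    rw [← neg_neg (toEuclideanLin F v), ← h1, map_neg, ← toLin_mul, hG2, toLin_one]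
  refine ⟨(1 / 2 : ℂ) • (v + toEuclideanLin F v), (1 / 2 : ℂ) • (v - toEuclideanLin F v),
    ⟨?_, ?_⟩, ⟨?_, ?_⟩, by module⟩ <;>
  · simp only [map_smul, map_add, map_sub, h1, h2, h3]
    module

lemma map_posNeg {X : Constraint n} (hX : X ∈ O) (hF : Compat O F) (hG : Compat O G)
    (h1 : X.2 = 1) {e : Hilb n} (he : PosNeg F G e) : PosNeg F G (X.1 e) := by
  have h2 := hF X hX e
  have h3 := hG X hX e
  rw [h1, one_smul] at h2 h3
  rw [he.1] at h2
  rw [he.2, map_neg] at h3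
  exact ⟨h2.symm, h3.symm⟩

/-- An operator that anticommutes with `F` and `G` interchanges the two halves of the kernel of
`F + G`. -/
lemma map_posNeg_swap {X : Constraint n} (hX : X ∈ O) (hF : Compat O F) (hG : Compat O G)
    (h1 : X.2 = -1) {e : Hilb n} (he : PosNeg F G e) : PosNeg G F (X.1 e) := by
  have h2 := hF X hX e
  have h3 := hG X hX e
  rw [h1, neg_one_smul] at h2 h3
  rw [he.1] at h2
  rw [he.2, map_neg, neg_inj] at h3
  exact ⟨h3.symm, neg_eq_iff_eq_neg.1 h2.symm⟩

/-- The Hermitian matrix that exchanges `e i` and `f i` for all `i`. -/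
def exchange {m : ℕ} (e f : Fin m → Hilb n) : Matrix (Fin n) (Fin n) ℂ :=
  ∑ i, (outer (f i) (e i) + outer (e i) (f i))

lemma toLin_exchange {m : ℕ} (e f : Fin m → Hilb n) (v : Hilb n) :
    toEuclideanLin (exchange e f) v
      = ∑ i, (inner ℂ (e i) v • f i + inner ℂ (f i) v • e i) := by
  simp only [exchange, map_sum, LinearMap.sum_apply, toLin_add, toLin_outer]

/-- A system of vectors on which `F` can be rotated towards `-F`: orthonormal families `e` and `f`
in the kernel of `F + G`, eigenvectors of `F` for `1` and `-1`, such that exchanging them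
is compatible with the constraints. -/
def HasRotation (O : Set (Constraint n)) (F G : Matrix (Fin n) (Fin n) ℂ) : Prop :=
  ∃ (m : ℕ) (e f : Fin (m + 1) → Hilb n), Orthonormal ℂ e ∧ Orthonormal ℂ f ∧
    (∀ i, PosNeg F G (e i)) ∧ (∀ i, PosNeg G F (f i)) ∧ Compat O (exchange e f)

/-- A rotation reverses `F` on part of the kernel of `F + G`, which thereby shrinks. -/
lemma HasRotation.exists_joinedIn (hO : ∀ x ∈ O, x.2 = 1 ∨ x.2 = -1)
    (hF : F ∈ compatInvertibles O) (hG : G ∈ compatInvertibles O) (hF2 : F * F = 1)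
    (h : HasRotation O F G) :
    ∃ F' : Matrix (Fin n) (Fin n) ℂ, F' * F' = 1 ∧ JoinedIn (compatInvertibles O) F F' ∧
      LinearMap.ker (toEuclideanLin (F' + G)) < LinearMap.ker (toEuclideanLin (F + G)) := by
  obtain ⟨m, e, f, he, hf, hFe, hFf, hc⟩ := h
  set K := exchange e f with hKdef
  have hef (i j) : inner ℂ (e i) (f j) = 0 := (hFe i).inner_eq_zero hF.1 (hFf j)
  have hfe (i j) : inner ℂ (f i) (e j) = 0 := by rw [← inner_conj_symm, hef, map_zero]
  have hee := orthonormal_iff_ite.1 he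
  have hff := orthonormal_iff_ite.1 hf
  have hK : K.IsHermitian := by
    rw [Matrix.IsHermitian, hKdef, exchange, conjTranspose_sum]
    simp only [conjTranspose_add, conjTranspose_outer, add_comm]
  have hKe (i) : toEuclideanLin K (e i) = f i := by
    rw [hKdef, toLin_exchange]
    simp [hee, hfe]
  have hKf (i) : toEuclideanLin K (f i) = e i := by
    rw [hKdef, toLin_exchange]
    simp [hff, hef]
  have hKK (v) : toEuclideanLin K (toEuclideanLin K v)
      = ∑ i, (inner ℂ (e i) v • e i + inner ℂ (f i) v • f i) := by
    conv_lhs => rw [hKdef, toLin_exchange e f v, ← hKdef]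
    simp [hKe, hKf]
  have hK3 : K * K * K = K := by
    refine toLin_ext fun v => ?_
    rw [mul_assoc, toLin_mul, toLin_mul, hKK v]
    conv_rhs => rw [hKdef, toLin_exchange]
    simp [hKe, hKf]
  have hFK : F * K = -(K * F) := by
    refine toLin_ext fun v => ?_
    have h1 (i) : inner ℂ (e i) (toEuclideanLin F v) = inner ℂ (e i) v := by
      rw [inner_toLin_right, hF.1.eq, (hFe i).1]
    have h2 (i) : inner ℂ (f i) (toEuclideanLin F v) = -inner ℂ (f i) v := by
      rw [inner_toLin_right, hF.1.eq, (hFf i).2, inner_neg_left]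
    rw [toLin_neg, toLin_mul, toLin_mul, hKdef, toLin_exchange, toLin_exchange]
    simp [h1, h2, (hFe _).1, (hFf _).2, ← Finset.sum_neg_distrib, add_comm]
  have hsum : (F + G) * K = 0 := by
    refine toLin_ext fun v => ?_
    rw [toLin_mul, hKdef, toLin_exchange, toLin_add]
    simp only [map_sum, map_add, map_smul, (hFe _).1, (hFf _).2, (hFe _).2, (hFf _).1,
      ← Finset.sum_add_distrib, smul_neg, map_zero, LinearMap.zero_apply]
    exact Finset.sum_eq_zero fun i _ => by abel
  obtain ⟨hj, hsq⟩ := joinedIn_rotation hO hF hF2 hK hc hFK hK3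
  refine ⟨_, hsq, hj, ?_⟩
  have hker {v : Hilb n} (hv : toEuclideanLin (F - (2 : ℝ) • (F * K * K) + G) v = 0) :
      toEuclideanLin (F + G) v = 0 ∧ toEuclideanLin (K * K) v = 0 := by
    rw [mul_assoc] at hv
    refine kernel_add_of_projection hF.1 hG.1 hF2 ?_ ?_ ?_ ?_ hv
    · rw [Matrix.IsHermitian, conjTranspose_mul, hK.eq]
    · rw [← mul_assoc, hK3]
    · have hKF : K * F = -(F * K) := by rw [hFK, neg_neg]
      rw [mul_assoc, hKF, mul_neg, ← mul_assoc, hKF, neg_mul, neg_neg, mul_assoc]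
    · rw [← mul_assoc, hsum, zero_mul]
  refine lt_of_le_of_ne (fun v hv => (hker hv).1) fun heq => ?_
  have h1 : e 0 ∈ LinearMap.ker (toEuclideanLin (F + G)) := by
    rw [LinearMap.mem_ker, toLin_add, (hFe 0).1, (hFe 0).2, add_neg_cancel]
  rw [← heq, LinearMap.mem_ker] at h1
  have h2 := (hker h1).2
  rw [toLin_mul, hKe, hKf] at h2
  exact he.ne_zero 0 h2

/-- If a rotation is available whenever `F` and `G` are involutions with the same value of an
invariant `ι` and singular sum, then `ι` classifies the path components. -/
theorem joinedIn_of_hasRotation {α : Type*} (hO : ∀ x ∈ O, x.2 = 1 ∨ x.2 = -1)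
    (ι : Matrix (Fin n) (Fin n) ℂ → α)
    (hι : ∀ F G, JoinedIn (compatInvertibles O) F G → ι F = ι G)
    (step : ∀ F ∈ compatInvertibles O, ∀ G ∈ compatInvertibles O, F * F = 1 → G * G = 1 →
      ι F = ι G → (∃ v, v ≠ 0 ∧ toEuclideanLin (F + G) v = 0) → HasRotation O F G)
    (hF : F ∈ compatInvertibles O) (hG : G ∈ compatInvertibles O) (h : ι F = ι G) :
    JoinedIn (compatInvertibles O) F G := by
  have main (d : ℕ) : ∀ F ∈ compatInvertibles O, ∀ G ∈ compatInvertibles O, F * F = 1 →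
      G * G = 1 → ι F = ι G →
      Module.finrank ℂ (LinearMap.ker (toEuclideanLin (F + G))) = d →
      JoinedIn (compatInvertibles O) F G := by
    induction d using Nat.strong_induction_on with
    | _ d ih =>
      intro F hF G hG hF2 hG2 hFG hd
      by_cases hv : ∃ v, v ≠ 0 ∧ toEuclideanLin (F + G) v = 0
      · obtain ⟨F', h1, h2, h3⟩ :=
          (step F hF G hG hF2 hG2 hFG hv).exists_joinedIn hO hF hG hF2
        refine h2.trans (ih _ ?_ F' h2.target_mem G hG h1 hG2 ((hι _ _ h2).symm.trans hFG) rfl)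
        rw [← hd]
        exact Submodule.finrank_lt_finrank_of_lt h3
      · refine joinedIn_of_isUnit_add hF hG hF2 hG2 (isUnit_of_injective fun v h0 => ?_)
        by_contra hne
        exact hv ⟨v, hne, h0⟩
  have h1 := joinedIn_sgn hO hF
  have h2 := joinedIn_sgn hO hG
  refine h1.trans ((main _ _ h1.target_mem _ h2.target_mem (sgn_mul_sgn hF.1 hF.2.1)
    (sgn_mul_sgn hG.1 hG.2.1) ?_ rfl).trans h2.symm)
  rw [← hι _ _ h1, ← hι _ _ h2, h]

end compat

/-! ### The symmetry operators as constraints -/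

section symmetries
variable {n : ℕ} {O : Set (Constraint n)} {F G : Matrix (Fin n) (Fin n) ℂ}

/-- An antiunitary operator as a real-linear map. -/
def antiOp (T : AntiUnitary n) : Hilb n →ₗ[ℝ] Hilb n where
  toFun := T
  map_add' := map_add T
  map_smul' r v := by
    rw [← Complex.coe_smul, map_smulₛₗ, Complex.conj_ofReal, Complex.coe_smul, RingHom.id_apply]

/-- A unitary operator as a real-linear map. -/
def unitOp (S : UnitaryOp n) : Hilb n →ₗ[ℝ] Hilb n where
  toFun := S
  map_add' := map_add S
  map_smul' r v := by
    rw [← Complex.coe_smul, map_smul, Complex.coe_smul, RingHom.id_apply]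

@[simp] lemma antiOp_apply (T : AntiUnitary n) (v : Hilb n) : antiOp T v = T v := rfl

@[simp] lemma unitOp_apply (S : UnitaryOp n) (v : Hilb n) : unitOp S v = S v := rfl

/-- The constraints that the symmetry operators impose on a Hamiltonian. -/
def AZSymmetry.constraints {c : AZClass} (σ : AZSymmetry n c) : Set (Constraint n) :=
  match σ with
  | .A => ∅
  | .AIII S _ => {(unitOp S, -1)}
  | .AI T _ => {(antiOp T, 1)}
  | .BDI T P _ _ _ => {(antiOp T, 1), (antiOp P, -1)}
  | .D P _ => {(antiOp P, -1)}
  | .DIII T P _ _ _ => {(antiOp T, 1), (antiOp P, -1)}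
  | .AII T _ => {(antiOp T, 1)}
  | .CII T P _ _ _ => {(antiOp T, 1), (antiOp P, -1)}
  | .C P _ => {(antiOp P, -1)}
  | .CI T P _ _ _ => {(antiOp T, 1), (antiOp P, -1)}

lemma AZSymmetry.constraints_sign {c : AZClass} (σ : AZSymmetry n c) :
    ∀ x ∈ σ.constraints, x.2 = 1 ∨ x.2 = -1 := by
  cases σ <;> simp [AZSymmetry.constraints]

lemma AZSymmetry.invertibles_eq {c : AZClass} (σ : AZSymmetry n c) :
    σ.invertibles = compatInvertibles σ.constraints := by
  ext H
  cases σ <;> simp [AZSymmetry.invertibles, compatInvertibles, AZSymmetry.constraints, Compat,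
    AZSymmetry.Respects, CommutesWith, AnticommutesWith]

lemma anti_smul (T : AntiUnitary n) (z : ℂ) (v : Hilb n) : T (z • v) = star z • T v :=
  map_smulₛₗ T z v

/-- Polarization: `T` preserves norms, hence real parts of inner products; antilinearity yields the
imaginary parts. -/
lemma anti_inner (T : AntiUnitary n) (v w : Hilb n) : inner ℂ (T v) (T w) = inner ℂ w v := by
  have hre (v w : Hilb n) : (inner ℂ (T v) (T w)).re = (inner ℂ v w).re := by
    have h1 := @norm_add_sq ℂ _ _ _ _ (T v) (T w)
    have h2 := @norm_add_sq ℂ _ _ _ _ v w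
    rw [← map_add, T.norm_map, T.norm_map, T.norm_map] at h1
    have h3 := h1.symm.trans h2
    simp only [RCLike.re_eq_complex_re] at h3
    linarith
  have him := hre v (Complex.I • w)
  rw [anti_smul, inner_smul_right, inner_smul_right] at him
  rw [← inner_conj_symm w v]
  apply Complex.ext
  · rw [Complex.conj_re]
    exact hre v w
  · rw [Complex.conj_im]
    simpa using him

lemma anti_exchange {m : ℕ} (T : AntiUnitary n) (e f : Fin m → Hilb n) (v : Hilb n) :
    T (toEuclideanLin (exchange e f) v)
      = toEuclideanLin (exchange (fun i => T (e i)) fun i => T (f i)) (T v) := by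
  simp only [toLin_exchange, map_sum, map_add, anti_smul, anti_inner]
  simp

lemma unitary_exchange {m : ℕ} (S : UnitaryOp n) (e f : Fin m → Hilb n) (v : Hilb n) :
    S (toEuclideanLin (exchange e f) v)
      = toEuclideanLin (exchange (fun i => S (e i)) fun i => S (f i)) (S v) := by
  simp only [toLin_exchange, map_sum, map_add, map_smul, LinearIsometryEquiv.inner_map_map]

/-- The joint eigenspace on which `F` is `1` and `G` is `-1`. -/
def posNegSpace (F G : Matrix (Fin n) (Fin n) ℂ) : Submodule ℂ (Hilb n) where
  carrier := {e | PosNeg F G e}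
  add_mem' := PosNeg.add
  zero_mem' := ⟨by simp, by simp⟩
  smul_mem' z _ h := h.smul z

lemma exists_unit {W : Submodule ℂ (Hilb n)} (h : ∃ v ∈ W, v ≠ 0) : ∃ v ∈ W, ‖v‖ = 1 := by
  obtain ⟨v, hv, h0⟩ := h
  refine ⟨((‖v‖ : ℂ)⁻¹) • v, W.smul_mem _ hv, ?_⟩
  rw [norm_smul, norm_inv, Complex.norm_real, norm_norm, inv_mul_cancel₀ (norm_ne_zero_iff.2 h0)]

/-- A nonzero subspace invariant under an antiunitary involution contains a real unit vector. -/
lemma exists_real_unit (T : AntiUnitary n) (hT : ∀ v, T (T v) = v) {W : Submodule ℂ (Hilb n)}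
    (hW : ∀ v ∈ W, T v ∈ W) (h : ∃ v ∈ W, v ≠ 0) : ∃ v ∈ W, ‖v‖ = 1 ∧ T v = v := by
  have h1 : ∃ v ∈ W, v ≠ 0 ∧ T v = v := by
    obtain ⟨v, hv, h0⟩ := h
    by_cases h2 : v + T v = 0
    · have h3 : T v = -v := eq_neg_of_add_eq_zero_right h2
      exact ⟨Complex.I • v, W.smul_mem _ hv, by simp [h0], by simp [anti_smul, h3]⟩
    · exact ⟨_, W.add_mem hv (hW v hv), h2, by rw [map_add, hT, add_comm]⟩
  obtain ⟨v, hv, h0, h2⟩ := h1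
  refine ⟨((‖v‖ : ℂ)⁻¹) • v, W.smul_mem _ hv, ?_, by simp [anti_smul, h2]⟩
  rw [norm_smul, norm_inv, Complex.norm_real, norm_norm, inv_mul_cancel₀ (norm_ne_zero_iff.2 h0)]

/-- Kramers degeneracy: if `T² = -1`, then `v` and `T v` are orthogonal. -/
lemma inner_anti_self (T : AntiUnitary n) (hT : ∀ v, T (T v) = -v) (v : Hilb n) :
    inner ℂ v (T v) = 0 := by
  have h := anti_inner T v (T v)
  rw [hT, inner_neg_right] at h
  have h2 : inner ℂ (T v) v = 0 := self_eq_neg.1 h.symm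
  rw [← inner_conj_symm, h2, map_zero]

lemma orthonormal_single {e : Hilb n} (he : ‖e‖ = 1) : Orthonormal ℂ ![e] := by
  rw [orthonormal_iff_ite]
  intro i j
  fin_cases i
  fin_cases j
  simp [inner_self_eq_norm_sq_to_K, he]

lemma orthonormal_pair {e e' : Hilb n} (he : ‖e‖ = 1) (he' : ‖e'‖ = 1) (h : inner ℂ e e' = 0) :
    Orthonormal ℂ ![e, e'] := by
  have h' : inner ℂ e' e = 0 := by rw [← inner_conj_symm, h, map_zero]
  rw [orthonormal_iff_ite]
  intro i j
  fin_cases i <;> fin_cases j <;> simp [inner_self_eq_norm_sq_to_K, he, he', h, h']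

lemma HasRotation.of_single {e f : Hilb n} (he : ‖e‖ = 1) (hf : ‖f‖ = 1) (hPe : PosNeg F G e)
    (hPf : PosNeg G F f) (hc : Compat O (exchange ![e] ![f])) : HasRotation O F G := by
  refine ⟨0, ![e], ![f], orthonormal_single he, orthonormal_single hf, fun i => ?_, fun i => ?_, hc⟩
  · fin_cases i; exact hPe
  · fin_cases i; exact hPf

lemma HasRotation.of_pair {e e' f f' : Hilb n} (he : ‖e‖ = 1) (he' : ‖e'‖ = 1) (hf : ‖f‖ = 1)
    (hf' : ‖f'‖ = 1) (hee : inner ℂ e e' = 0) (hff : inner ℂ f f' = 0) (hPe : PosNeg F G e)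
    (hPe' : PosNeg F G e') (hPf : PosNeg G F f) (hPf' : PosNeg G F f')
    (hc : Compat O (exchange ![e, e'] ![f, f'])) : HasRotation O F G := by
  refine ⟨1, ![e, e'], ![f, f'], orthonormal_pair he he' hee, orthonormal_pair hf hf' hff,
    fun i => ?_, fun i => ?_, hc⟩
  · fin_cases i
    exacts [hPe, hPe']
  · fin_cases i
    exacts [hPf, hPf']

open scoped ComplexOrder in
/-- If two involutions have the same trace and singular sum, then the kernel of the sum meets both
eigenspaces of `F`: if `F` were `-1` on the kernel, with projection `Q`, then `F + 2 Q` would be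
an involution with invertible sum with `G` and larger trace. -/
lemma exists_unit_posNeg_of_trace (hF : F.IsHermitian) (hG : G.IsHermitian) (hF2 : F * F = 1)
    (hG2 : G * G = 1) (htr : F.trace = G.trace)
    (h : ∃ v, v ≠ 0 ∧ toEuclideanLin (F + G) v = 0) : ∃ e ∈ posNegSpace F G, ‖e‖ = 1 := by
  apply exists_unit
  by_contra! hno
  have hFN {v : Hilb n} (hv : toEuclideanLin (F + G) v = 0) : toEuclideanLin F v = -v := by
    obtain ⟨e, f, he, hf, rfl⟩ := exists_posNeg hF2 hG2 hv
    rw [hno e he, zero_add, hf.2]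
  have hsum : (F + G).IsHermitian := hF.add hG
  have hsa : IsSelfAdjoint (F + G) := hsum
  set g : ℝ → ℝ := fun x => if x = 0 then 1 else 0
  set Q := cfc g (F + G)
  have hQ : Qᴴ = Q := isHermitian_cfc _ _
  have hQ2 : Q * Q = Q := by
    rw [← cfc_mul _ _ _ (continuousOn_spectrum _ _) (continuousOn_spectrum _ _)]
    refine cfc_congr fun x _ => ?_
    by_cases hx : x = 0 <;> simp [g, hx]
  have hSQ : (F + G) * Q = 0 := by
    have h1 : (F + G) * Q = cfc (fun x => id x * g x) (F + G) := by
      rw [cfc_mul _ _ _ (continuousOn_spectrum _ _) (continuousOn_spectrum _ _), cfc_id ℝ (F + G)]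
    rw [h1, ← cfc_const_zero ℝ (F + G)]
    refine cfc_congr fun x _ => ?_
    by_cases hx : x = 0 <;> simp [g, hx]
  have hQN {v : Hilb n} (hv : toEuclideanLin (F + G) v = 0) : toEuclideanLin Q v = v := by
    have := cfc_toLin_eigenvector hsum g (v := v) (x := 0) (by simpa using hv)
    simpa [g] using this
  have hFQ : F * Q = -Q := by
    refine toLin_ext fun v => ?_
    rw [toLin_mul, toLin_neg]
    exact hFN (by rw [← toLin_mul, hSQ]; simp)
  have hQF : Q * F = -Q := by
    have := congrArg conjTranspose hFQ
    rwa [conjTranspose_mul, conjTranspose_neg, hF.eq, hQ] at this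
  set F' := F - (2 : ℝ) • (F * Q) with hF'
  have hF'' : F' = F + (2 : ℝ) • Q := by rw [hF', hFQ, smul_neg, sub_neg_eq_add]
  have h1 : F' * F' = 1 := by
    rw [hF'']
    simp only [add_mul, mul_add, smul_mul_assoc, mul_smul_comm, hF2, hFQ, hQF, hQ2]
    module
  have h2 : IsUnit (F' + G) := by
    refine isUnit_of_injective fun v hv => ?_
    obtain ⟨h3, h4⟩ := kernel_add_of_projection hF hG hF2 hQ hQ2 (by rw [hQF, hFQ]) hSQ hv
    rw [← hQN h3, h4]
  have h3 := trace_eq_of_isUnit_add h1 hG2 h2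
  rw [hF'', trace_add, htr, add_eq_left, trace_smul, smul_eq_zero] at h3
  have h4 : (Qᴴ * Q).trace = 0 := by
    rw [hQ, hQ2]
    exact h3.resolve_left (by norm_num)
  have h5 := trace_conjTranspose_mul_self_eq_zero_iff.1 h4
  obtain ⟨v, hv0, hv⟩ := h
  apply hv0
  rw [← hQN hv, h5]
  simp

/-- With an anticommuting operator among the constraints, each half of a nonzero kernel of `F + G`
is nonzero. -/
lemma exists_unit_posNeg_of_swap {X : Constraint n} (hX : X ∈ O) (h1 : X.2 = -1)
    (hinj : ∀ v, X.1 v = 0 → v = 0) (hF : Compat O F) (hG : Compat O G) (hF2 : F * F = 1)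
    (hG2 : G * G = 1) (h : ∃ v, v ≠ 0 ∧ toEuclideanLin (F + G) v = 0) :
    ∃ e ∈ posNegSpace F G, e ≠ 0 := by
  obtain ⟨v, hv0, hv⟩ := h
  obtain ⟨e, f, he, hf, rfl⟩ := exists_posNeg hF2 hG2 hv
  by_cases h0 : e = 0
  · refine ⟨_, map_posNeg_swap hX hG hF h1 hf, fun h2 => hv0 ?_⟩
    rw [h0, hinj f h2, add_zero]
  · exact ⟨e, he, h0⟩

/-! ### Reflections -/

/-- The reflection in the hyperplane orthogonal to the unit vector `u`. -/
def reflect (u : Hilb n) : Matrix (Fin n) (Fin n) ℂ := 1 - (2 : ℝ) • outer u u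

lemma toLin_reflect (u v : Hilb n) :
    toEuclideanLin (reflect u) v = v - (2 : ℝ) • inner ℂ u v • u := by
  rw [reflect, toLin_sub, toLin_one, toLin_smul_left, toLin_outer]

lemma reflect_isHermitian (u : Hilb n) : (reflect u).IsHermitian := by
  rw [Matrix.IsHermitian, reflect, conjTranspose_sub, conjTranspose_smul, conjTranspose_outer]
  simp

lemma outer_mul_outer (a b c d : Hilb n) : outer a b * outer c d = inner ℂ b c • outer a d := by
  refine toLin_ext fun v => ?_
  rw [toLin_mul, toLin_outer, toLin_outer, map_smul, LinearMap.smul_apply, toLin_outer,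
    inner_smul_right, smul_smul, mul_comm]

lemma reflect_mul_self {u : Hilb n} (hu : ‖u‖ = 1) : reflect u * reflect u = 1 := by
  have h : inner ℂ u u = 1 := by rw [inner_self_eq_norm_sq_to_K, hu]; simp
  have h2 : outer u u * outer u u = outer u u := by rw [outer_mul_outer, h, one_smul]
  simp only [reflect, sub_mul, mul_sub, one_mul, mul_one, smul_mul_assoc, mul_smul_comm, h2]
  module

lemma mul_outer (A : Matrix (Fin n) (Fin n) ℂ) (u v : Hilb n) :
    A * outer u v = outer (toEuclideanLin A u) v := by
  refine toLin_ext fun w => ?_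
  rw [toLin_mul, toLin_outer, toLin_outer, map_smul]

lemma outer_mul (A : Matrix (Fin n) (Fin n) ℂ) (u v : Hilb n) :
    outer u v * A = outer u (toEuclideanLin Aᴴ v) := by
  refine toLin_ext fun w => ?_
  rw [toLin_mul, toLin_outer, toLin_outer, inner_toLin_right]

/-- If the kernel of `F + G` is spanned by `e` and `f`, then conjugating `F` with the reflection in
`e + f` reverses the sign of `F` on this kernel, and the result is joined to `G` by a segment. -/
lemma joinedIn_reflect (hF : F ∈ compatInvertibles O) (hG : G ∈ compatInvertibles O)
    (hF2 : F * F = 1) (hG2 : G * G = 1) {e f u : Hilb n} (he : ‖e‖ = 1) (hf : ‖f‖ = 1)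
    (hPe : PosNeg F G e) (hPf : PosNeg G F f)
    (hWe : ∀ v, PosNeg F G v → inner ℂ e v = 0 → v = 0)
    (hWf : ∀ v, PosNeg G F v → inner ℂ f v = 0 → v = 0)
    (hu : u = ((√2 : ℝ)⁻¹ : ℝ) • (e + f))
    (hR : ∀ x ∈ O, x.1 u = u ∨ x.1 u = -u)
    (hRi : ∀ x ∈ O, ∀ v, x.1 (inner ℂ u v • u) = inner ℂ (x.1 u) (x.1 v) • x.1 u) :
    ‖u‖ = 1 ∧ JoinedIn (compatInvertibles O) (reflect u * F * reflect u) G := by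
  have hef : inner ℂ e f = 0 := hPe.inner_eq_zero hF.1 hPf
  have hfe : inner ℂ f e = 0 := by rw [← inner_conj_symm, hef, map_zero]
  have hee : inner ℂ e e = 1 := by rw [inner_self_eq_norm_sq_to_K, he]; simp
  have hff : inner ℂ f f = 1 := by rw [inner_self_eq_norm_sq_to_K, hf]; simp
  have hs : ((√2 : ℝ)⁻¹ : ℝ) * (√2 : ℝ)⁻¹ = 1 / 2 := by
    rw [← mul_inv, Real.mul_self_sqrt (by norm_num)]
    norm_num
  have hsC : (((√2 : ℝ)⁻¹ : ℝ) : ℂ) * (((√2 : ℝ)⁻¹ : ℝ) : ℂ) = 1 / 2 := by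
    rw [← Complex.ofReal_mul, hs]
    norm_num
  have huu : inner ℂ u u = 1 := by
    rw [hu, ← Complex.coe_smul, inner_smul_left, inner_smul_right, Complex.conj_ofReal, ← mul_assoc,
      hsC]
    simp only [inner_add_left, inner_add_right, hee, hff, hef, hfe]
    norm_num
  have hu1 : ‖u‖ = 1 := by
    have h := @inner_self_eq_norm_sq ℂ _ _ _ _ u
    rw [huu, RCLike.one_re] at h
    exact (pow_eq_one_iff_of_nonneg (norm_nonneg u) two_ne_zero).1 h.symm
  set Q := outer e e + outer f f with hQdef
  have hQ : Q.IsHermitian := by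
    rw [Matrix.IsHermitian, hQdef, conjTranspose_add, conjTranspose_outer, conjTranspose_outer]
  have hQ2 : Q * Q = Q := by
    simp only [hQdef, add_mul, mul_add, outer_mul_outer, hee, hff, hef, hfe, one_smul, zero_smul,
      add_zero, zero_add]
  have hFQ : F * Q = outer e e - outer f f := by
    rw [hQdef, mul_add, mul_outer, mul_outer, hPe.1, hPf.2, outer_neg_left, sub_eq_add_neg]
  have hQF : Q * F = F * Q := by
    rw [hFQ, hQdef, add_mul, outer_mul, outer_mul, hF.1.eq, hPe.1, hPf.2, outer_neg_right,
      sub_eq_add_neg]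
  have hSQ : (F + G) * Q = 0 := by
    rw [add_mul, hFQ, hQdef, mul_add, mul_outer, mul_outer, hPe.2, hPf.1, outer_neg_left]
    abel
  have hFu : toEuclideanLin F u = ((√2 : ℝ)⁻¹ : ℝ) • (e - f) := by
    rw [hu, toLin_smul_real, map_add, hPe.1, hPf.2, sub_eq_add_neg]
  have hRFR : reflect u * F * reflect u = F - (2 : ℝ) • (F * Q) := by
    have h1 : inner ℂ u (toEuclideanLin F u) = 0 := by
      rw [hFu, hu, ← Complex.coe_smul, ← Complex.coe_smul, inner_smul_left, inner_smul_right,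
        inner_add_left, inner_sub_right, inner_sub_right, hee, hff, hef, hfe]
      simp
    have h2 : outer u u * F * outer u u = 0 := by
      rw [mul_assoc, mul_outer, outer_mul_outer, h1, zero_smul]
    have h3 : outer u u * F + F * outer u u = F * Q := by
      rw [hFQ, mul_outer, outer_mul, hF.1.eq, hFu, hu]
      refine toLin_ext fun v => ?_
      simp only [toLin_add, toLin_sub, toLin_outer, ← Complex.coe_smul, inner_smul_left,
        Complex.conj_ofReal, inner_add_left, inner_sub_left, smul_smul, smul_add, smul_sub]
      have e1 (a b : ℂ) : ((((√2 : ℝ)⁻¹ : ℝ) : ℂ) * a - (((√2 : ℝ)⁻¹ : ℝ) : ℂ) * b)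
          * (((√2 : ℝ)⁻¹ : ℝ) : ℂ) = (a - b) / 2 := by linear_combination (a - b) * hsC
      have e2 (a b : ℂ) : ((((√2 : ℝ)⁻¹ : ℝ) : ℂ) * a + (((√2 : ℝ)⁻¹ : ℝ) : ℂ) * b)
          * (((√2 : ℝ)⁻¹ : ℝ) : ℂ) = (a + b) / 2 := by linear_combination (a + b) * hsC
      simp only [e1, e2]
      module
    have h4 : reflect u * F * reflect u = F - (2 : ℝ) • (outer u u * F + F * outer u u)
        + (4 : ℝ) • (outer u u * F * outer u u) := by
      simp only [reflect, sub_mul, mul_sub, one_mul, mul_one, smul_mul_assoc, mul_smul_comm]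
      module
    rw [h4, h3, h2]
    simp
  have hinv : (reflect u * F * reflect u) * (reflect u * F * reflect u) = 1 := by
    have h1 := reflect_mul_self hu1
    calc _ = reflect u * F * (reflect u * reflect u) * F * reflect u := by simp only [mul_assoc]
      _ = reflect u * (F * F) * reflect u := by rw [h1]; simp only [mul_assoc, one_mul]
      _ = 1 := by rw [hF2, mul_one, h1]
  have hcomm : ∀ x ∈ O, ∀ v, x.1 (toEuclideanLin (reflect u) v)
      = toEuclideanLin (reflect u) (x.1 v) := by
    intro x hx v
    rw [toLin_reflect, toLin_reflect, map_sub, map_smul, hRi x hx]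
    rcases hR x hx with h | h <;> simp [h]
  have hmem : reflect u * F * reflect u ∈ compatInvertibles O := by
    refine ⟨?_, isUnit_of_sq_eq_one hinv, fun x hx v => ?_⟩
    · rw [Matrix.IsHermitian, conjTranspose_mul, conjTranspose_mul, hF.1.eq,
        (reflect_isHermitian u).eq, mul_assoc]
    · rw [toLin_mul, toLin_mul, toLin_mul, toLin_mul, hcomm x hx, hF.2.2 x hx, hcomm x hx,
        toLin_smul_real]
  refine ⟨hu1, joinedIn_of_isUnit_add hmem hG hinv hG2 (isUnit_of_injective fun v hv => ?_)⟩
  rw [hRFR] at hv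
  obtain ⟨h1, h2⟩ := kernel_add_of_projection hF.1 hG.1 hF2 hQ hQ2 hQF hSQ hv
  obtain ⟨a, b, ha, hb, rfl⟩ := exists_posNeg hF2 hG2 h1
  have hbe : inner ℂ e b = 0 := hPe.inner_eq_zero hF.1 hb
  have haf : inner ℂ f a = 0 := by rw [← inner_conj_symm, ha.inner_eq_zero hF.1 hPf, map_zero]
  rw [hQdef, toLin_add, toLin_outer, toLin_outer, inner_add_right, inner_add_right, hbe, haf,
    add_zero, zero_add] at h2
  have h3 := congrArg (inner ℂ e) h2
  have h4 := congrArg (inner ℂ f) h2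
  simp only [inner_add_right, inner_smul_right, hee, hef, hfe, hff, mul_one, mul_zero, add_zero,
    zero_add, inner_zero_right] at h3 h4
  rw [hWe a ha h3, hWf b hb h4, add_zero]

end symmetries

/-! ### Rotations in the ten classes -/

section rotations
variable {n : ℕ} {F G : Matrix (Fin n) (Fin n) ℂ}

lemma anti_injective (P : AntiUnitary n) (v : Hilb n) (h : antiOp P v = 0) : v = 0 := by
  rw [antiOp_apply] at h
  rw [← norm_eq_zero, ← P.norm_map, h, norm_zero]

lemma inner_anti_left (T : AntiUnitary n) {e v : Hilb n} (he : T e = e) (hv : inner ℂ e v = 0) :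
    inner ℂ e (T v) = 0 := by
  rw [← he, anti_inner, ← inner_conj_symm, hv, map_zero]

lemma hasRotation_A (hF : F ∈ compatInvertibles AZSymmetry.A.constraints)
    (hG : G ∈ compatInvertibles AZSymmetry.A.constraints) (hF2 : F * F = 1) (hG2 : G * G = 1)
    (htr : F.trace = G.trace) (h : ∃ v, v ≠ 0 ∧ toEuclideanLin (F + G) v = 0) :
    HasRotation AZSymmetry.A.constraints F G := by
  obtain ⟨e, he, he1⟩ := exists_unit_posNeg_of_trace hF.1 hG.1 hF2 hG2 htr h
  obtain ⟨f, hf, hf1⟩ := exists_unit_posNeg_of_trace hG.1 hF.1 hG2 hF2 htr.symm (add_comm F G ▸ h)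
  exact .of_single he1 hf1 he hf fun x hx => hx.elim

/-- The partners are real eigenvectors. -/
lemma hasRotation_AI {T : AntiUnitary n} {hT : ∀ v, T (T v) = v}
    (hF : F ∈ compatInvertibles (AZSymmetry.AI T hT).constraints)
    (hG : G ∈ compatInvertibles (AZSymmetry.AI T hT).constraints) (hF2 : F * F = 1)
    (hG2 : G * G = 1)
    (htr : F.trace = G.trace) (h : ∃ v, v ≠ 0 ∧ toEuclideanLin (F + G) v = 0) :
    HasRotation (AZSymmetry.AI T hT).constraints F G := by
  have hX : ((antiOp T, 1) : Constraint n) ∈ (AZSymmetry.AI T hT).constraints := rfl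
  have ex {F G} (hF : F ∈ compatInvertibles (AZSymmetry.AI T hT).constraints)
      (hG : G ∈ compatInvertibles (AZSymmetry.AI T hT).constraints) (hF2 : F * F = 1)
      (hG2 : G * G = 1) (htr : F.trace = G.trace)
      (h : ∃ v, v ≠ 0 ∧ toEuclideanLin (F + G) v = 0) :
      ∃ e ∈ posNegSpace F G, ‖e‖ = 1 ∧ T e = e := by
    obtain ⟨e, he, he1⟩ := exists_unit_posNeg_of_trace hF.1 hG.1 hF2 hG2 htr h
    exact exists_real_unit T hT (fun v hv => map_posNeg hX hF.2.2 hG.2.2 rfl hv)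
      ⟨e, he, by rintro rfl; simp at he1⟩
  obtain ⟨e, he, he1, hTe⟩ := ex hF hG hF2 hG2 htr h
  obtain ⟨f, hf, hf1, hTf⟩ := ex hG hF hG2 hF2 htr.symm (add_comm F G ▸ h)
  refine .of_single he1 hf1 he hf ?_
  rintro _ rfl v
  rw [antiOp_apply, antiOp_apply, anti_exchange, one_smul]
  simp [toLin_exchange, hTe, hTf]

/-- The partners are two Kramers pairs `e`, `T e` and `f`, `T f`. -/
lemma hasRotation_AII {T : AntiUnitary n} {hT : ∀ v, T (T v) = -v}
    (hF : F ∈ compatInvertibles (AZSymmetry.AII T hT).constraints)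
    (hG : G ∈ compatInvertibles (AZSymmetry.AII T hT).constraints) (hF2 : F * F = 1)
    (hG2 : G * G = 1)
    (htr : F.trace = G.trace) (h : ∃ v, v ≠ 0 ∧ toEuclideanLin (F + G) v = 0) :
    HasRotation (AZSymmetry.AII T hT).constraints F G := by
  have hX : ((antiOp T, 1) : Constraint n) ∈ (AZSymmetry.AII T hT).constraints := rfl
  obtain ⟨e, he, he1⟩ := exists_unit_posNeg_of_trace hF.1 hG.1 hF2 hG2 htr h
  obtain ⟨f, hf, hf1⟩ := exists_unit_posNeg_of_trace hG.1 hF.1 hG2 hF2 htr.symm (add_comm F G ▸ h)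
  refine .of_pair he1 (T.norm_map e |>.trans he1) hf1 (T.norm_map f |>.trans hf1)
    (inner_anti_self T hT e) (inner_anti_self T hT f) he (map_posNeg hX hF.2.2 hG.2.2 rfl he) hf
    (map_posNeg hX hG.2.2 hF.2.2 rfl hf) ?_
  rintro _ rfl v
  rw [antiOp_apply, antiOp_apply, anti_exchange, one_smul]
  simp only [toLin_exchange, Fin.sum_univ_two, Matrix.cons_val_zero, Matrix.cons_val_one, hT,
    inner_neg_left]
  module

/-- The partner of `e` is `i S e`; the phase makes the exchange anticommute with `S`, which would
commute with the exchange of `e` and `S e`. -/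
lemma hasRotation_AIII {S : UnitaryOp n} {hS : ∀ v, S (S v) = v}
    (hF : F ∈ compatInvertibles (AZSymmetry.AIII S hS).constraints)
    (hG : G ∈ compatInvertibles (AZSymmetry.AIII S hS).constraints) (hF2 : F * F = 1)
    (hG2 : G * G = 1) (h : ∃ v, v ≠ 0 ∧ toEuclideanLin (F + G) v = 0) :
    HasRotation (AZSymmetry.AIII S hS).constraints F G := by
  have hX : ((unitOp S, -1) : Constraint n) ∈ (AZSymmetry.AIII S hS).constraints := rfl
  obtain ⟨e, he, he1⟩ := exists_unit (exists_unit_posNeg_of_swap hX rfl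
    (fun v hv => by rwa [unitOp_apply, LinearIsometryEquiv.map_eq_zero_iff] at hv)
    hF.2.2 hG.2.2 hF2 hG2 h)
  refine .of_single (f := Complex.I • S e) he1 (by simp [norm_smul, he1]) he
    ((map_posNeg_swap hX hF.2.2 hG.2.2 rfl he).smul _) ?_
  rintro _ rfl v
  rw [unitOp_apply, unitOp_apply, unitary_exchange]
  simp only [toLin_exchange, Fin.sum_univ_one, Matrix.cons_val_fin_one, map_smul, hS,
    inner_smul_left, Complex.conj_I]
  module

/-- The partner of `e` is `P e`; the sign in `P² = -1` makes the exchange anticommute with `P`. -/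
lemma hasRotation_C {P : AntiUnitary n} {hP : ∀ v, P (P v) = -v}
    (hF : F ∈ compatInvertibles (AZSymmetry.C P hP).constraints)
    (hG : G ∈ compatInvertibles (AZSymmetry.C P hP).constraints) (hF2 : F * F = 1)
    (hG2 : G * G = 1) (h : ∃ v, v ≠ 0 ∧ toEuclideanLin (F + G) v = 0) :
    HasRotation (AZSymmetry.C P hP).constraints F G := by
  have hX : ((antiOp P, -1) : Constraint n) ∈ (AZSymmetry.C P hP).constraints := rfl
  obtain ⟨e, he, he1⟩ := exists_unit
    (exists_unit_posNeg_of_swap hX rfl (anti_injective P) hF.2.2 hG.2.2 hF2 hG2 h)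
  refine .of_single he1 (P.norm_map e |>.trans he1) he
    (map_posNeg_swap hX hF.2.2 hG.2.2 rfl he) ?_
  rintro _ rfl v
  rw [antiOp_apply, antiOp_apply, anti_exchange]
  simp only [toLin_exchange, Fin.sum_univ_one, Matrix.cons_val_fin_one, hP, inner_neg_left]
  module

/-- The partner of a `T`-real vector `e` is `P e`. -/
lemma hasRotation_CI {T P : AntiUnitary n} {hT : ∀ v, T (T v) = v} {hP : ∀ v, P (P v) = -v}
    {hTP : ∀ v, T (P v) = P (T v)}
    (hF : F ∈ compatInvertibles (AZSymmetry.CI T P hT hP hTP).constraints)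
    (hG : G ∈ compatInvertibles (AZSymmetry.CI T P hT hP hTP).constraints) (hF2 : F * F = 1)
    (hG2 : G * G = 1) (h : ∃ v, v ≠ 0 ∧ toEuclideanLin (F + G) v = 0) :
    HasRotation (AZSymmetry.CI T P hT hP hTP).constraints F G := by
  have hXT : ((antiOp T, 1) : Constraint n) ∈ (AZSymmetry.CI T P hT hP hTP).constraints :=
    Or.inl rfl
  have hX : ((antiOp P, -1) : Constraint n) ∈ (AZSymmetry.CI T P hT hP hTP).constraints :=
    Or.inr rfl
  obtain ⟨e, he, he1, hTe⟩ := exists_real_unit T hT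
    (fun v hv => map_posNeg hXT hF.2.2 hG.2.2 rfl hv)
    (exists_unit_posNeg_of_swap hX rfl (anti_injective P) hF.2.2 hG.2.2 hF2 hG2 h)
  refine .of_single he1 (P.norm_map e |>.trans he1) he
    (map_posNeg_swap hX hF.2.2 hG.2.2 rfl he) ?_
  rintro _ (rfl | rfl) v <;> rw [antiOp_apply, antiOp_apply, anti_exchange] <;>
  simp only [toLin_exchange, Fin.sum_univ_one, Matrix.cons_val_fin_one, hP, inner_neg_left,
    hTP, hTe] <;>
  module

/-- The partner of the Kramers pair `e`, `T e` is the Kramers pair of `T P e`. -/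
lemma hasRotation_DIII {T P : AntiUnitary n} {hT : ∀ v, T (T v) = -v} {hP : ∀ v, P (P v) = v}
    {hTP : ∀ v, T (P v) = P (T v)}
    (hF : F ∈ compatInvertibles (AZSymmetry.DIII T P hT hP hTP).constraints)
    (hG : G ∈ compatInvertibles (AZSymmetry.DIII T P hT hP hTP).constraints) (hF2 : F * F = 1)
    (hG2 : G * G = 1) (h : ∃ v, v ≠ 0 ∧ toEuclideanLin (F + G) v = 0) :
    HasRotation (AZSymmetry.DIII T P hT hP hTP).constraints F G := by
  have hXT : ((antiOp T, 1) : Constraint n) ∈ (AZSymmetry.DIII T P hT hP hTP).constraints :=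
    Or.inl rfl
  have hX : ((antiOp P, -1) : Constraint n) ∈ (AZSymmetry.DIII T P hT hP hTP).constraints :=
    Or.inr rfl
  obtain ⟨e, he, he1⟩ := exists_unit
    (exists_unit_posNeg_of_swap hX rfl (anti_injective P) hF.2.2 hG.2.2 hF2 hG2 h)
  have hte := map_posNeg hXT hF.2.2 hG.2.2 rfl he
  refine .of_pair (e' := T e) (f := T (P e)) (f' := T (T (P e))) he1 (by simp [he1])
    (by simp [he1]) (by simp [he1]) (inner_anti_self T hT e) (inner_anti_self T hT _) he hte
    (map_posNeg hXT hG.2.2 hF.2.2 rfl (map_posNeg_swap hX hF.2.2 hG.2.2 rfl he))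
    (map_posNeg hXT hG.2.2 hF.2.2 rfl
      (map_posNeg hXT hG.2.2 hF.2.2 rfl (map_posNeg_swap hX hF.2.2 hG.2.2 rfl he))) ?_
  rintro _ (rfl | rfl) v <;> rw [antiOp_apply, antiOp_apply, anti_exchange] <;>
  simp only [toLin_exchange, Fin.sum_univ_two, Matrix.cons_val_zero, Matrix.cons_val_one, hP, hT,
    inner_neg_left, hTP, map_neg] <;>
  module

/-- The partner of the Kramers pair `e`, `T e` is the Kramers pair of `i T P e`; the phase makes up
for the sign of `P²`, which is opposite to that in class `DIII`. -/
lemma hasRotation_CII {T P : AntiUnitary n} {hT : ∀ v, T (T v) = -v} {hP : ∀ v, P (P v) = -v}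
    {hTP : ∀ v, T (P v) = P (T v)}
    (hF : F ∈ compatInvertibles (AZSymmetry.CII T P hT hP hTP).constraints)
    (hG : G ∈ compatInvertibles (AZSymmetry.CII T P hT hP hTP).constraints) (hF2 : F * F = 1)
    (hG2 : G * G = 1) (h : ∃ v, v ≠ 0 ∧ toEuclideanLin (F + G) v = 0) :
    HasRotation (AZSymmetry.CII T P hT hP hTP).constraints F G := by
  have hXT : ((antiOp T, 1) : Constraint n) ∈ (AZSymmetry.CII T P hT hP hTP).constraints :=
    Or.inl rfl
  have hX : ((antiOp P, -1) : Constraint n) ∈ (AZSymmetry.CII T P hT hP hTP).constraints :=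
    Or.inr rfl
  obtain ⟨e, he, he1⟩ := exists_unit
    (exists_unit_posNeg_of_swap hX rfl (anti_injective P) hF.2.2 hG.2.2 hF2 hG2 h)
  have hte := map_posNeg hXT hF.2.2 hG.2.2 rfl he
  have hf := (map_posNeg hXT hG.2.2 hF.2.2 rfl
    (map_posNeg_swap hX hF.2.2 hG.2.2 rfl he)).smul Complex.I
  refine .of_pair (e' := T e) (f := Complex.I • T (P e)) (f' := T (Complex.I • T (P e))) he1
    (by simp [he1]) (by simp [norm_smul, he1]) (by simp [norm_smul, he1]) (inner_anti_self T hT e)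
    (inner_anti_self T hT _) he hte hf (map_posNeg hXT hG.2.2 hF.2.2 rfl hf) ?_
  rintro _ (rfl | rfl) v <;> rw [antiOp_apply, antiOp_apply, anti_exchange] <;>
  simp only [toLin_exchange, Fin.sum_univ_two, Matrix.cons_val_zero, Matrix.cons_val_one, hP, hT,
    inner_neg_left, hTP, map_neg, anti_smul, inner_smul_left, Complex.conj_I, star_neg,
    RCLike.star_def, neg_neg, map_neg] <;>
  module

/-- In class `D` a rotation needs two orthogonal vectors `e`, `e'` in the kernel of `F + G`. If the
kernel is spanned by `e` and `P e`, a reflection of `F` in a real vector is joined to `G`. -/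
lemma hasRotation_D {P : AntiUnitary n} {hP : ∀ v, P (P v) = v}
    (hF : F ∈ compatInvertibles (AZSymmetry.D P hP).constraints)
    (hG : G ∈ compatInvertibles (AZSymmetry.D P hP).constraints) (hF2 : F * F = 1)
    (hG2 : G * G = 1) (h : ∃ v, v ≠ 0 ∧ toEuclideanLin (F + G) v = 0) :
    HasRotation (AZSymmetry.D P hP).constraints F G ∨
      ∃ u, ‖u‖ = 1 ∧ P u = u ∧ JoinedIn (compatInvertibles (AZSymmetry.D P hP).constraints)
        (reflect u * F * reflect u) G := by
  have hX : ((antiOp P, -1) : Constraint n) ∈ (AZSymmetry.D P hP).constraints := rfl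
  obtain ⟨e, he, he1⟩ := exists_unit
    (exists_unit_posNeg_of_swap hX rfl (anti_injective P) hF.2.2 hG.2.2 hF2 hG2 h)
  have hf := map_posNeg_swap hX hF.2.2 hG.2.2 rfl he
  by_cases h2 : ∃ v ∈ posNegSpace F G ⊓ (ℂ ∙ e)ᗮ, v ≠ 0
  · left
    obtain ⟨e', ⟨he', hee⟩, he'1⟩ := exists_unit h2
    have hee := Submodule.mem_orthogonal_singleton_iff_inner_right.1 hee
    have hf' := map_posNeg_swap hX hF.2.2 hG.2.2 rfl he'
    refine .of_pair (e := e) (e' := e') (f := P e') (f' := -P e) he1 he'1 (by simp [he'1])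
      (by simp [he1]) hee ?_ he he' hf' hf.neg ?_
    · rw [inner_neg_right, anti_inner, hee, neg_zero]
    rintro _ rfl v
    rw [antiOp_apply, antiOp_apply, anti_exchange]
    simp only [toLin_exchange, Fin.sum_univ_two, Matrix.cons_val_zero, Matrix.cons_val_one, hP,
      inner_neg_left, map_neg]
    module
  · right
    push Not at h2
    have hWe (v : Hilb n) (hv : PosNeg F G v) (hev : inner ℂ e v = 0) : v = 0 :=
      h2 v ⟨hv, Submodule.mem_orthogonal_singleton_iff_inner_right.2 hev⟩
    have hWf (v : Hilb n) (hv : PosNeg G F v) (hev : inner ℂ (P e) v = 0) : v = 0 := by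
      apply anti_injective P
      refine hWe _ (map_posNeg_swap hX hG.2.2 hF.2.2 rfl hv) ?_
      rw [antiOp_apply, ← hP e, anti_inner, ← inner_conj_symm, hev, map_zero]
    have hu : P (((√2 : ℝ)⁻¹ : ℝ) • (e + P e)) = ((√2 : ℝ)⁻¹ : ℝ) • (e + P e) := by
      have := (antiOp P).map_smul ((√2 : ℝ)⁻¹ : ℝ) (e + P e)
      simp only [antiOp_apply, map_add, hP] at this
      rw [this, add_comm]
    obtain ⟨h3, h4⟩ := joinedIn_reflect hF hG hF2 hG2 he1 (P.norm_map e |>.trans he1) he hf hWe hWf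
      rfl
      (by rintro _ rfl; exact Or.inl hu)
      (by
        rintro _ rfl v
        simp only [antiOp_apply, anti_smul, anti_inner]
        simp)
    exact ⟨_, h3, hu, h4⟩

/-- As in class `D`, with `T`-real vectors throughout. -/
lemma hasRotation_BDI {T P : AntiUnitary n} {hT : ∀ v, T (T v) = v} {hP : ∀ v, P (P v) = v}
    {hTP : ∀ v, T (P v) = P (T v)}
    (hF : F ∈ compatInvertibles (AZSymmetry.BDI T P hT hP hTP).constraints)
    (hG : G ∈ compatInvertibles (AZSymmetry.BDI T P hT hP hTP).constraints) (hF2 : F * F = 1)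
    (hG2 : G * G = 1) (h : ∃ v, v ≠ 0 ∧ toEuclideanLin (F + G) v = 0) :
    HasRotation (AZSymmetry.BDI T P hT hP hTP).constraints F G ∨
      ∃ u, ‖u‖ = 1 ∧ T u = u ∧ P u = u ∧
        JoinedIn (compatInvertibles (AZSymmetry.BDI T P hT hP hTP).constraints)
        (reflect u * F * reflect u) G := by
  have hXT : ((antiOp T, 1) : Constraint n) ∈ (AZSymmetry.BDI T P hT hP hTP).constraints :=
    Or.inl rfl
  have hX : ((antiOp P, -1) : Constraint n) ∈ (AZSymmetry.BDI T P hT hP hTP).constraints :=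
    Or.inr rfl
  obtain ⟨e, he, he1, hTe⟩ := exists_real_unit T hT
    (fun v hv => map_posNeg hXT hF.2.2 hG.2.2 rfl hv)
    (exists_unit_posNeg_of_swap hX rfl (anti_injective P) hF.2.2 hG.2.2 hF2 hG2 h)
  have hf := map_posNeg_swap hX hF.2.2 hG.2.2 rfl he
  by_cases h2 : ∃ v ∈ posNegSpace F G ⊓ (ℂ ∙ e)ᗮ, v ≠ 0
  · left
    obtain ⟨e', ⟨he', hee⟩, he'1, hTe'⟩ := exists_real_unit T hT (fun v hv =>
      Submodule.mem_inf.2 ⟨map_posNeg hXT hF.2.2 hG.2.2 rfl hv.1,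
        Submodule.mem_orthogonal_singleton_iff_inner_right.2 (inner_anti_left T hTe
          (Submodule.mem_orthogonal_singleton_iff_inner_right.1 hv.2))⟩) h2
    have hee := Submodule.mem_orthogonal_singleton_iff_inner_right.1 hee
    have hf' := map_posNeg_swap hX hF.2.2 hG.2.2 rfl he'
    refine .of_pair (e := e) (e' := e') (f := P e') (f' := -P e) he1 he'1 (by simp [he'1])
      (by simp [he1]) hee ?_ he he' hf' hf.neg ?_
    · rw [inner_neg_right, anti_inner, hee, neg_zero]
    rintro _ (rfl | rfl) v <;> rw [antiOp_apply, antiOp_apply, anti_exchange] <;>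
    simp only [toLin_exchange, Fin.sum_univ_two, Matrix.cons_val_zero, Matrix.cons_val_one, hP,
      inner_neg_left, map_neg, hTP, hTe, hTe'] <;>
    module
  · right
    push Not at h2
    have hWe (v : Hilb n) (hv : PosNeg F G v) (hev : inner ℂ e v = 0) : v = 0 :=
      h2 v ⟨hv, Submodule.mem_orthogonal_singleton_iff_inner_right.2 hev⟩
    have hWf (v : Hilb n) (hv : PosNeg G F v) (hev : inner ℂ (P e) v = 0) : v = 0 := by
      apply anti_injective P
      refine hWe _ (map_posNeg_swap hX hG.2.2 hF.2.2 rfl hv) ?_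
      rw [antiOp_apply, ← hP e, anti_inner, ← inner_conj_symm, hev, map_zero]
    have hu : P (((√2 : ℝ)⁻¹ : ℝ) • (e + P e)) = ((√2 : ℝ)⁻¹ : ℝ) • (e + P e) := by
      have := (antiOp P).map_smul ((√2 : ℝ)⁻¹ : ℝ) (e + P e)
      simp only [antiOp_apply, map_add, hP] at this
      rw [this, add_comm]
    have huT : T (((√2 : ℝ)⁻¹ : ℝ) • (e + P e)) = ((√2 : ℝ)⁻¹ : ℝ) • (e + P e) := by
      have := (antiOp T).map_smul ((√2 : ℝ)⁻¹ : ℝ) (e + P e)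
      simp only [antiOp_apply, map_add, hTP, hTe] at this
      exact this
    obtain ⟨h3, h4⟩ := joinedIn_reflect hF hG hF2 hG2 he1 (P.norm_map e |>.trans he1) he hf hWe hWf
      rfl
      (by
        rintro _ (rfl | rfl)
        exacts [Or.inl huT, Or.inl hu])
      (by
        rintro _ (rfl | rfl) v <;>
        · simp only [antiOp_apply, anti_smul, anti_inner]
          simp)
    exact ⟨_, h3, huT, hu, h4⟩

end rotations

/-! ### The Pfaffian -/

section pfaffian
variable {n : ℕ}

/-- The index `2 i` of the `i`-th pair. -/
def evenIdx (i : Fin (n / 2)) : Fin n := ⟨2 * i, by omega⟩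

/-- The index `2 i + 1` of the `i`-th pair. -/
def oddIdx (i : Fin (n / 2)) : Fin n := ⟨2 * i + 1, by omega⟩

/-- For even `n`, the set of indices is a disjoint union of the pairs `{2 i, 2 i + 1}`. -/
def pairEquiv (hn : Even n) : Fin (n / 2) × Fin 2 ≃ Fin n :=
  finProdFinEquiv.trans (finCongr (Nat.div_mul_cancel hn.two_dvd))

lemma pairEquiv_zero (hn : Even n) (i : Fin (n / 2)) : pairEquiv hn (i, 0) = evenIdx i := by
  ext; simp [pairEquiv, evenIdx, finProdFinEquiv]

lemma pairEquiv_one (hn : Even n) (i : Fin (n / 2)) : pairEquiv hn (i, 1) = oddIdx i := by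
  ext; simp [pairEquiv, oddIdx, finProdFinEquiv, add_comm]

lemma prod_pairs {α : Type*} [CommMonoid α] (hn : Even n) (F : Fin n → α) :
    ∏ j, F j = ∏ i, F (evenIdx i) * F (oddIdx i) := by
  rw [← (pairEquiv hn).prod_comp, Fintype.prod_prod_type]
  simp [pairEquiv_zero, pairEquiv_one]

/-- The product of the entries of `K` at the pairs that `a` selects. -/
def pairProd (K : Matrix (Fin n) (Fin n) ℝ) (a : Fin n → Fin n) : ℝ :=
  ∏ i : Fin (n / 2), K (a (evenIdx i)) (a (oddIdx i))

/-- The Pfaffian without its normalization. -/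
def pfSum (K : Matrix (Fin n) (Fin n) ℝ) : ℝ :=
  ∑ σ : Equiv.Perm (Fin n), ((Equiv.Perm.sign σ : ℤ) : ℝ) * pairProd K σ

lemma pfaffian_eq (hn : Even n) (K : Matrix (Fin n) (Fin n) ℝ) :
    pfaffian K = (1 / ((2 : ℝ) ^ (n / 2) * ((n / 2).factorial : ℝ))) * pfSum K := by
  rw [pfaffian, if_pos hn]
  rfl

lemma pairProd_congruence (hn : Even n) (B A : Matrix (Fin n) (Fin n) ℝ) (a : Fin n → Fin n) :
    pairProd (B * A * Bᵀ) a = ∑ f : Fin n → Fin n, (∏ j, B (a j) (f j)) * pairProd A f := by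
  have entry (x y : Fin n) :
      (B * A * Bᵀ) x y = ∑ h : Fin 2 → Fin n, B x (h 0) * B y (h 1) * A (h 0) (h 1) := by
    rw [Matrix.mul_apply, ← (finTwoArrowEquiv (Fin n)).symm.sum_comp, Fintype.sum_prod_type,
      Finset.sum_comm]
    refine Finset.sum_congr rfl fun y' _ => ?_
    rw [Matrix.mul_apply, Finset.sum_mul]
    refine Finset.sum_congr rfl fun x' _ => ?_
    simp [finTwoArrowEquiv, Matrix.transpose_apply]
    ring
  let Φ : (Fin n → Fin n) ≃ (Fin (n / 2) → Fin 2 → Fin n) :=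
    ((pairEquiv hn).symm.arrowCongr (Equiv.refl _)).trans (Equiv.curry _ _ _)
  have h0 (f : Fin n → Fin n) (i : Fin (n / 2)) : Φ f i 0 = f (evenIdx i) := by
    simp [Φ, Equiv.arrowCongr, pairEquiv_zero]
  have h1 (f : Fin n → Fin n) (i : Fin (n / 2)) : Φ f i 1 = f (oddIdx i) := by
    simp [Φ, Equiv.arrowCongr, pairEquiv_one]
  rw [pairProd]
  simp only [entry]
  rw [Finset.prod_univ_sum, Fintype.piFinset_univ, ← Φ.sum_comp]
  refine Finset.sum_congr rfl fun f _ => ?_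
  rw [prod_pairs hn, pairProd, ← Finset.prod_mul_distrib]
  simp only [h0, h1]

lemma pfSum_congruence (hn : Even n) (B A : Matrix (Fin n) (Fin n) ℝ) :
    pfSum (B * A * Bᵀ) = B.det * pfSum A := by
  have h1 : pfSum (B * A * Bᵀ)
      = ∑ f : Fin n → Fin n, pairProd A f * (B.submatrix id f).det := by
    simp only [pfSum, pairProd_congruence hn, Finset.mul_sum, Matrix.det_apply']
    rw [Finset.sum_comm]
    refine Finset.sum_congr rfl fun f _ => Finset.sum_congr rfl fun σ _ => ?_
    simp only [Matrix.submatrix_apply, id]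
    ring
  rw [h1, pfSum, Finset.mul_sum]
  symm
  refine Finset.sum_of_injOn (fun σ : Equiv.Perm (Fin n) => (σ : Fin n → Fin n))
    (fun σ _ τ _ h => DFunLike.coe_injective h)
    (fun _ _ => Finset.mem_coe.2 (Finset.mem_univ _)) ?_ ?_
  · intro f _ hf
    have hinj : ¬ Function.Injective f := fun h => hf
      ⟨Equiv.ofBijective f (Finite.injective_iff_bijective.1 h), by simp, rfl⟩
    simp only [Function.Injective, not_forall] at hinj
    obtain ⟨i, j, hij, hne⟩ := hinj
    rw [Matrix.det_zero_of_column_eq hne (by simp [hij]), mul_zero]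
  · intro σ _
    rw [Matrix.det_permute']
    ring

/-- Congruence multiplies the Pfaffian by the determinant. -/
lemma pfaffian_congruence (B A : Matrix (Fin n) (Fin n) ℝ) :
    pfaffian (B * A * Bᵀ) = B.det * pfaffian A := by
  by_cases hn : Even n
  · rw [pfaffian_eq hn, pfaffian_eq hn, pfSum_congruence hn]
    ring
  · simp [pfaffian, hn]

/-- The block-diagonal skew-symmetric matrix with blocks `[[0, d i], [-d i, 0]]`. -/
def skewBlock (d : Fin (n / 2) → ℝ) : Matrix (Fin n) (Fin n) ℝ := Matrix.of fun a b =>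
  if h : (a : ℕ) % 2 = 0 ∧ (b : ℕ) = a + 1 then d ⟨a / 2, by omega⟩
  else if h : (b : ℕ) % 2 = 0 ∧ (a : ℕ) = b + 1 then -d ⟨b / 2, by omega⟩ else 0

lemma skewBlock_even_odd (d : Fin (n / 2) → ℝ) (i : Fin (n / 2)) :
    skewBlock d (evenIdx i) (oddIdx i) = d i := by
  simp [skewBlock, evenIdx, oddIdx]

/-- A permutation that contributes to the Pfaffian of the standard symplectic matrix permutes the
pairs and possibly swaps the members of a pair; its sign is the number of swaps. -/
lemma sign_mul_pairProd_skewBlock (hn : Even n) (σ : Equiv.Perm (Fin n))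
    (h : pairProd (skewBlock fun _ => 1) σ ≠ 0) :
    ((Equiv.Perm.sign σ : ℤ) : ℝ) * pairProd (skewBlock fun _ => 1) σ = 1 := by
  set e := pairEquiv hn with he
  have hval (x : Fin (n / 2) × Fin 2) : ((e x : Fin n) : ℕ) = 2 * x.1 + x.2 := by
    simp [he, pairEquiv, finProdFinEquiv, add_comm]
  have hJ (x y : Fin (n / 2) × Fin 2) : skewBlock (fun _ => 1) (e x) (e y)
      = if x.1 = y.1 then (if x.2 = 0 ∧ y.2 = 1 then 1 else if x.2 = 1 ∧ y.2 = 0 then -1 else 0)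
        else (0 : ℝ) := by
    obtain ⟨x1, x2⟩ := x
    obtain ⟨y1, y2⟩ := y
    simp only [skewBlock, Matrix.of_apply, hval]
    fin_cases x2 <;> fin_cases y2 <;> simp [Fin.ext_iff] <;> grind
  set τ : Equiv.Perm (Fin (n / 2) × Fin 2) := (e.trans σ).trans e.symm with hτ
  have hσ (x) : σ (e x) = e (τ x) := by simp [hτ]
  have hprod : pairProd (skewBlock fun _ => 1) σ
      = ∏ i, skewBlock (fun _ => 1) (e (τ (i, 0))) (e (τ (i, 1))) := by
    simp only [pairProd, ← pairEquiv_zero hn, ← pairEquiv_one hn, ← he, hσ]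
  rw [hprod] at h ⊢
  have hne (i) : skewBlock (fun _ => (1 : ℝ)) (e (τ (i, 0))) (e (τ (i, 1))) ≠ 0 :=
    fun h0 => h (Finset.prod_eq_zero (Finset.mem_univ i) h0)
  have h1 (i) : (τ (i, 1)).1 = (τ (i, 0)).1 := by
    by_contra hc
    exact hne i (by rw [hJ, if_neg (Ne.symm hc)])
  have two (x : Fin 2) : x = 0 ∨ x = 1 := by fin_cases x <;> simp
  set s : Fin (n / 2) → Equiv.Perm (Fin 2) := fun i =>
    if (τ (i, 0)).2 = 0 then 1 else Equiv.swap 0 1 with hs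
  have h2 (i) : (τ (i, 0)).2 = s i 0 ∧ (τ (i, 1)).2 = s i 1 ∧
      skewBlock (fun _ => (1 : ℝ)) (e (τ (i, 0))) (e (τ (i, 1)))
        = ((Equiv.Perm.sign (s i) : ℤ) : ℝ) := by
    have h3 := hne i
    rw [hJ, if_pos (h1 i).symm] at h3
    rw [hJ, if_pos (h1 i).symm]
    rcases two (τ (i, 0)).2 with h4 | h4 <;> rcases two (τ (i, 1)).2 with h5 | h5 <;>
    simp [hs, h4, h5] at h3 ⊢
  have h3 (i b) : τ (i, b) = ((τ (i, 0)).1, s i b) := by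
    rcases two b with rfl | rfl
    · exact Prod.ext rfl (h2 i).1
    · exact Prod.ext (h1 i) (h2 i).2.1
  have hinj : Function.Injective fun i => (τ (i, 0)).1 := by
    intro i j hij
    have h4 : τ (i, (s i).symm 0) = τ (j, (s j).symm 0) := by
      rw [h3 i, h3 j, Equiv.apply_symm_apply, Equiv.apply_symm_apply]
      exact Prod.ext hij rfl
    exact congrArg Prod.fst (τ.injective h4)
  set π : Equiv.Perm (Fin (n / 2)) :=
    Equiv.ofBijective _ (Finite.injective_iff_bijective.1 hinj) with hπ
  have hdecomp : τ = Equiv.prodCongrLeft (fun _ : Fin 2 => π) * Equiv.prodCongrRight s := by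
    ext1 ⟨i, b⟩
    rw [h3 i b]
    rfl
  have hsign : Equiv.Perm.sign σ = Equiv.Perm.sign τ :=
    Equiv.Perm.sign_eq_sign_of_equiv _ _ e.symm (by intro x; simp [hτ])
  have hsq : Equiv.Perm.sign τ = ∏ i, Equiv.Perm.sign (s i) := by
    rw [hdecomp, map_mul, Equiv.Perm.sign_prodCongrLeft, Equiv.Perm.sign_prodCongrRight]
    simp
  rw [hsign, hsq, Finset.prod_congr rfl fun i _ => (h2 i).2.2]
  push_cast
  rw [← Finset.prod_mul_distrib]
  refine Finset.prod_eq_one fun i _ => ?_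
  rcases Int.units_eq_one_or (Equiv.Perm.sign (s i)) with h | h <;> simp [h]

lemma pfaffian_skewBlock_one_pos (hn : Even n) :
    0 < pfaffian (skewBlock fun _ : Fin (n / 2) => (1 : ℝ)) := by
  rw [pfaffian_eq hn]
  refine mul_pos (by positivity) ?_
  refine Finset.sum_pos' (fun σ _ => ?_) ⟨1, Finset.mem_univ _, ?_⟩
  · by_cases h : pairProd (skewBlock fun _ => (1 : ℝ)) σ = 0
    · rw [h, mul_zero]
    · rw [sign_mul_pairProd_skewBlock hn σ h]
      exact zero_le_one
  · simp [pairProd, skewBlock_even_odd]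

lemma sign_mul (x y : ℝ) : Real.sign (x * y) = Real.sign x * Real.sign y := by
  rcases lt_trichotomy x 0 with hx | hx | hx <;> rcases lt_trichotomy y 0 with hy | hy | hy <;>
  simp [hx, hy, Real.sign_of_neg, Real.sign_of_pos, mul_pos_of_neg_of_neg, mul_neg_of_neg_of_pos,
    mul_neg_of_pos_of_neg]

lemma sign_prod {ι : Type*} (s : Finset ι) (f : ι → ℝ) :
    Real.sign (∏ i ∈ s, f i) = ∏ i ∈ s, Real.sign (f i) := by
  induction s using Finset.cons_induction with
  | empty => simp
  | cons a s ha ih => rw [Finset.prod_cons, Finset.prod_cons, sign_mul, ih]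

lemma sign_pfaffian_skewBlock (hn : Even n) (d : Fin (n / 2) → ℝ) :
    Real.sign (pfaffian (skewBlock d)) = ∏ i, Real.sign (d i) := by
  set D : Matrix (Fin n) (Fin n) ℝ := Matrix.diagonal fun a =>
    if a.1 % 2 = 0 then d ⟨a / 2, by have := hn.two_dvd; omega⟩ else 1
  have h1 : skewBlock d = D * (skewBlock fun _ => 1) * Dᵀ := by
    ext a b
    rw [Matrix.diagonal_transpose, Matrix.mul_diagonal, Matrix.diagonal_mul]
    simp only [skewBlock, Matrix.of_apply]
    split_ifs <;> first | omega | simp_all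
  have h2 : D.det = ∏ i, d i := by
    rw [Matrix.det_diagonal, prod_pairs hn]
    refine Finset.prod_congr rfl fun i _ => ?_
    simp [evenIdx, oddIdx]
  rw [h1, pfaffian_congruence, sign_mul, Real.sign_of_pos (pfaffian_skewBlock_one_pos hn), mul_one,
    h2, sign_prod]

end pfaffian

/-! ### Running programs within a time bound -/

section exec

/-- Started on `s`, the program halts after at most `T` steps in a store satisfying `Q`. The
numerical constants in the bounds `T` below are generous rather than sharp. -/
def Exec (p : Program) (s : Store) (T : ℕ) (Q : Store → Prop) : Prop :=
  ∃ t s', Runs p s t s' ∧ t ≤ T ∧ Q s'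

variable {p q : Program} {s : Store} {T T' : ℕ} {Q Q' : Store → Prop}

lemma Exec.mono (h : Exec p s T Q) (hT : T ≤ T') (hQ : ∀ s, Q s → Q' s) : Exec p s T' Q' := by
  obtain ⟨t, s', h1, h2, h3⟩ := h
  exact ⟨t, s', h1, h2.trans hT, hQ _ h3⟩

lemma Exec.skip (hT : 1 ≤ T) (hQ : Q s) : Exec .skip s T Q := ⟨1, s, .skip s, hT, hQ⟩

lemma Exec.setCounter {x : ℕ} {e : AddrExpr} (hT : e.cost + 1 ≤ T)
    (hQ : Q (s.setCounter x (e.eval s))) : Exec (.setCounter x e) s T Q :=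
  ⟨_, _, .setCounter x e s, hT, hQ⟩

lemma Exec.setCell {a : ℕ} {i j : AddrExpr} {e : RealExpr} (hT : i.cost + j.cost + e.cost + 1 ≤ T)
    (hQ : Q (s.setCell a (i.eval s) (j.eval s) (e.eval s))) : Exec (.setCell a i j e) s T Q :=
  ⟨_, _, .setCell a i j e s, hT, hQ⟩

lemma Exec.seq {T₁ T₂ : ℕ} (h : Exec p s T₁ fun s' => Exec q s' T₂ Q) (hT : T₁ + T₂ ≤ T) :
    Exec (.seq p q) s T Q := by
  obtain ⟨t, s', h1, h2, t', s'', h3, h4, h5⟩ := h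
  exact ⟨_, s'', .seq h1 h3, by omega, h5⟩

lemma Exec.ite {b : Test} {T₁ : ℕ} (h1 : b.Holds s → Exec p s T₁ Q)
    (h2 : ¬ b.Holds s → Exec q s T₁ Q) (hT : b.cost + 1 + T₁ ≤ T) : Exec (.ite b p q) s T Q := by
  by_cases hb : b.Holds s
  · obtain ⟨t, s', h3, h4, h5⟩ := h1 hb
    exact ⟨_, s', .iteTrue q hb h3, by omega, h5⟩
  · obtain ⟨t, s', h3, h4, h5⟩ := h2 hb
    exact ⟨_, s', .iteFalse p hb h3, by omega, h5⟩

/-- `for x = lo, …, hi - 1` -/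
def forLoop (x : ℕ) (lo hi : AddrExpr) (body : Program) : Program :=
  .seq (.setCounter x lo) (.while (.addrLt (.var x) hi)
    (.seq body (.setCounter x (.add (.var x) (.const 1)))))

/-- The loop rule: an invariant `I i` that holds whenever the loop counter has the value `i`. The
bound `hi` may be re-evaluated in every round, provided that it stops the loop at `N`. -/
lemma Exec.forLoop {x : ℕ} {lo hi : AddrExpr} {N : ℕ} (I : ℕ → Store → Prop)
    (hN : lo.eval s ≤ N) (h0 : I (lo.eval s) (s.setCounter x (lo.eval s)))
    (hx : ∀ i s, I i s → s.counter x = i ∧ (i < hi.eval s ↔ i < N))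
    (hbody : ∀ i s', lo.eval s ≤ i → i < N → I i s' → Exec p s' T fun s'' =>
      s''.counter x = i ∧ I (i + 1) (s''.setCounter x (i + 1)))
    (hQ : ∀ s, I N s → Q s) (hT : (N + 1) * (T + hi.cost + 7) + lo.cost + 1 ≤ T') :
    Exec (AZ.forLoop x lo hi p) s T' Q := by
  have main (d : ℕ) : ∀ i s', lo.eval s ≤ i → i + d = N → I i s' →
      Exec (.while (.addrLt (.var x) hi) (.seq p (.setCounter x (.add (.var x) (.const 1))))) s'
        ((d + 1) * (T + hi.cost + 7)) Q := by
    induction d with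
    | zero =>
      intro i s' _ hi' hI
      obtain ⟨h1, h2⟩ := hx i s' hI
      refine ⟨_, s', .whileFalse _ ?_, ?_, hQ _ ?_⟩
      · simp only [Test.Holds, AddrExpr.eval, h1, h2]
        omega
      · simp only [Test.cost, AddrExpr.cost]
        omega
      · rwa [show i = N by omega] at hI
    | succ d ih =>
      intro i s' hlo hi' hI
      obtain ⟨h1, h2⟩ := hx i s' hI
      obtain ⟨t, s'', h3, h4, h5, h6⟩ := hbody i s' hlo (by omega) hI
      obtain ⟨t', s3, h7, h8, h9⟩ := ih (i + 1) _ (by omega) (by omega) h6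
      refine ⟨_, s3, .whileTrue (t' := t') ?_ (.seq h3 (.setCounter _ _ _)) ?_, ?_, h9⟩
      · simp only [Test.Holds, AddrExpr.eval, h1, h2]
        omega
      · simpa only [AddrExpr.eval, h5] using h7
      · simp only [Test.cost, AddrExpr.cost]
        have : (d + 1 + 1) * (T + hi.cost + 7) =
            (d + 1) * (T + hi.cost + 7) + (T + hi.cost + 7) := by
          ring
        omega
  refine Exec.seq (T₁ := lo.cost + 1) (T₂ := (N + 1) * (T + hi.cost + 7))
    (Exec.setCounter le_rfl ?_) (by omega)
  refine (main (N - lo.eval s) _ _ le_rfl (by omega) h0).mono ?_ fun _ h => h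
  exact Nat.mul_le_mul_right _ (by omega)

end exec

/-! ### Congruence by a transvection as a program -/

section congruence
variable {n m k i : ℕ} {r : ℝ} {A : Matrix (Fin n) (Fin n) ℂ} {s : Store}

/-- The memory layout of the programs: the matrix `A` is stored in the arrays `0` and `1`, the
result so far in array `2`; the counters `0` and `4` hold `n` and `m`, and the counters `1` and
`2` the loop variables `k` and `i`. -/
structure Holds (s : Store) (m k i : ℕ) (r : ℝ) (A : Matrix (Fin n) (Fin n) ℂ) : Prop where
  size : s.counter 0 = n
  outer : s.counter 1 = k
  inner : s.counter 2 = i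
  half : s.counter 4 = m
  out : s.cell 2 0 0 = r
  re : ∀ a b : Fin n, s.cell 0 a b = (A a b).re
  im : ∀ a b : Fin n, s.cell 1 a b = (A a b).im

lemma Holds.setOuter (h : Holds s m k i r A) (k' : ℕ) : Holds (s.setCounter 1 k') m k' i r A :=
  ⟨h.size, rfl, h.inner, h.half, h.out, h.re, h.im⟩

lemma Holds.setInner (h : Holds s m k i r A) (i' : ℕ) : Holds (s.setCounter 2 i') m k i' r A :=
  ⟨h.size, h.outer, rfl, h.half, h.out, h.re, h.im⟩

lemma Holds.setHalf (h : Holds s m k i r A) (m' : ℕ) : Holds (s.setCounter 4 m') m' k i r A :=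
  ⟨h.size, h.outer, h.inner, rfl, h.out, h.re, h.im⟩

lemma Holds.setScratchCounter (h : Holds s m k i r A) (l : ℕ) :
    Holds (s.setCounter 3 l) m k i r A :=
  ⟨h.size, h.outer, h.inner, h.half, h.out, h.re, h.im⟩

lemma Holds.setScratchCell (h : Holds s m k i r A) (a b : ℕ) (v : ℝ) :
    Holds (s.setCell 3 a b v) m k i r A := by
  refine ⟨h.size, h.outer, h.inner, h.half, ?_, fun a' b' => ?_, fun a' b' => ?_⟩
  · simpa [Store.setCell] using h.out
  · simpa [Store.setCell] using h.re a' b'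
  · simpa [Store.setCell] using h.im a' b'

lemma Holds.setOut (h : Holds s m k i r A) (v : ℝ) : Holds (s.setCell 2 0 0 v) m k i v A := by
  refine ⟨h.size, h.outer, h.inner, h.half, ?_, fun a' b' => ?_, fun a' b' => ?_⟩
  · simp [Store.setCell]
  · simpa [Store.setCell] using h.re a' b'
  · simpa [Store.setCell] using h.im a' b'

lemma Holds.setEntry (h : Holds s m k i r A) (a b : Fin n) (z : ℂ) :
    Holds ((s.setCell 0 a b z.re).setCell 1 a b z.im) m k i r
      (Matrix.of fun a' b' => if a' = a ∧ b' = b then z else A a' b') := by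
  refine ⟨h.size, h.outer, h.inner, h.half, ?_, fun a' b' => ?_, fun a' b' => ?_⟩
  · simpa [Store.setCell] using h.out
  · by_cases hab : a' = a ∧ b' = b
    · simp [Store.setCell, hab]
    · have : ¬ ((a' : ℕ) = a ∧ (b' : ℕ) = b) := by simpa [Fin.ext_iff] using hab
      simp [Store.setCell, hab, this, h.re]
  · by_cases hab : a' = a ∧ b' = b
    · simp [Store.setCell, hab]
    · have : ¬ ((a' : ℕ) = a ∧ (b' : ℕ) = b) := by simpa [Fin.ext_iff] using hab
      simp [Store.setCell, hab, this, h.im]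

/-- The coefficient of the transvection, in array `3`. -/
def HoldsCoeff (s : Store) (c : ℂ) : Prop := s.cell 3 0 0 = c.re ∧ s.cell 3 0 1 = c.im

/-- An address that does not depend on the counter `3`. -/
def Stable (p : AddrExpr) : Prop :=
  ∀ s s' : Store, (∀ x, x ≠ 3 → s.counter x = s'.counter x) → p.eval s = p.eval s'

/-- Add `c` times row `q` to row `p`. -/
def rowOp (p q : AddrExpr) : Program :=
  forLoop 3 (.const 0) (.var 0) <| .seq
    (.setCell 0 p (.var 3) (.add (.cell 0 p (.var 3))
      (.sub (.mul (.cell 3 (.const 0) (.const 0)) (.cell 0 q (.var 3)))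
        (.mul (.cell 3 (.const 0) (.const 1)) (.cell 1 q (.var 3))))))
    (.setCell 1 p (.var 3) (.add (.cell 1 p (.var 3))
      (.add (.mul (.cell 3 (.const 0) (.const 0)) (.cell 1 q (.var 3)))
        (.mul (.cell 3 (.const 0) (.const 1)) (.cell 0 q (.var 3))))))

/-- Add the complex conjugate of `c` times column `q` to column `p`. -/
def colOp (p q : AddrExpr) : Program :=
  forLoop 3 (.const 0) (.var 0) <| .seq
    (.setCell 0 (.var 3) p (.add (.cell 0 (.var 3) p)
      (.add (.mul (.cell 3 (.const 0) (.const 0)) (.cell 0 (.var 3) q))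
        (.mul (.cell 3 (.const 0) (.const 1)) (.cell 1 (.var 3) q)))))
    (.setCell 1 (.var 3) p (.add (.cell 1 (.var 3) p)
      (.sub (.mul (.cell 3 (.const 0) (.const 0)) (.cell 1 (.var 3) q))
        (.mul (.cell 3 (.const 0) (.const 1)) (.cell 0 (.var 3) q)))))

lemma conjTranspose_transvection {R : Type*} [CommRing R] [StarRing R] (p q : Fin n) (c : R) :
    (transvection p q c)ᴴ = transvection q p (star c) := by
  simp [transvection, Matrix.conjTranspose_single]

lemma Holds.rowOp {p q : AddrExpr} {P P' : Fin n} {c : ℂ} (h : Holds s m k i r A)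
    (hc : HoldsCoeff s c) (hp : p.eval s = P) (hq : q.eval s = P') (hne : P ≠ P')
    (hps : Stable p) (hqs : Stable q) (hpc : p.cost ≤ 10) (hqc : q.cost ≤ 10) :
    Exec (AZ.rowOp p q) s ((n + 1) * 210) fun s' =>
      Holds s' m k i r (transvection P P' c * A) ∧ HoldsCoeff s' c ∧ p.eval s' = P ∧
        q.eval s' = P' := by
  refine Exec.forLoop (N := n) (T := 200) (fun l s' => s'.counter 3 = l ∧
      p.eval s' = P ∧ q.eval s' = P' ∧ HoldsCoeff s' c ∧ Holds s' m k i r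
        (Matrix.of fun a b => if (b : ℕ) < l then (transvection P P' c * A) a b else A a b))
    (Nat.zero_le _) ?_ ?_ ?_ ?_ ?_
  · refine ⟨rfl, ?_, ?_, hc, ?_⟩
    · rw [← hp]
      exact hps _ _ fun x hx => by simp [Store.setCounter, hx]
    · rw [← hq]
      exact hqs _ _ fun x hx => by simp [Store.setCounter, hx]
    · refine (congrArg (Holds (s.setCounter 3 0) m k i r) ?_).mpr (h.setScratchCounter 0)
      ext1 a b
      simp [AddrExpr.eval]
  · rintro l s' ⟨h1, -, -, -, h2⟩
    exact ⟨h1, by simp [AddrExpr.eval, h2.size]⟩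
  · rintro l s' - hl ⟨h1, hp', hq', hc', h2⟩
    set B : Matrix (Fin n) (Fin n) ℂ :=
      Matrix.of fun a b => if (b : ℕ) < l then (transvection P P' c * A) a b else A a b
    set z : ℂ := A P ⟨l, hl⟩ + c * A P' ⟨l, hl⟩ with hz
    have hB (a : Fin n) : B a ⟨l, hl⟩ = A a ⟨l, hl⟩ := by simp [B]
    have hre (a : Fin n) : s'.cell 0 a l = (A a ⟨l, hl⟩).re := by
      rw [← hB]
      exact h2.re a ⟨l, hl⟩
    have him (a : Fin n) : s'.cell 1 a l = (A a ⟨l, hl⟩).im := by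
      rw [← hB]
      exact h2.im a ⟨l, hl⟩
    have hPP : ¬ (P' : ℕ) = P := fun h => hne (Fin.ext h.symm)
    refine Exec.seq (T₁ := 100) (T₂ := 100) (Exec.setCell ?_ (Exec.setCell ?_ ?_)) le_rfl
    · simp only [AddrExpr.cost, RealExpr.cost]
      omega
    · simp only [AddrExpr.cost, RealExpr.cost]
      omega
    set s1 := s'.setCell 0 (p.eval s') (AddrExpr.eval s' (.var 3)) _ with hs1
    have e1 : s1 = s'.setCell 0 P l z.re := by
      rw [hs1, hp']
      simp [AddrExpr.eval, RealExpr.eval, h1, hp', hq', hre, him, hc'.1, hc'.2, hz]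
    have hp1 : p.eval s1 = P := by
      rw [← hp', e1]
      exact hps _ _ fun x _ => rfl
    have hq1 : q.eval s1 = P' := by
      rw [← hq', e1]
      exact hqs _ _ fun x _ => rfl
    have h31 : s1.counter 3 = l := by rw [e1]; exact h1
    have hv : RealExpr.eval s1 (.add (.cell 1 p (.var 3))
        (.add (.mul (.cell 3 (.const 0) (.const 0)) (.cell 1 q (.var 3)))
        (.mul (.cell 3 (.const 0) (.const 1)) (.cell 0 q (.var 3))))) = z.im := by
      simp only [RealExpr.eval, AddrExpr.eval, hp1, hq1, h31]
      rw [e1]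
      simp [Store.setCell, hPP, hre, him, hc'.1, hc'.2, hz]
    rw [hv, hp1]
    simp only [AddrExpr.eval, h31]
    rw [e1]
    have h3 := h2.setEntry P ⟨l, hl⟩ z
    refine ⟨h1, rfl, ?_, ?_, ?_, ?_⟩
    · rw [← hp']
      exact hps _ _ fun x hx => by simp [Store.setCounter, Store.setCell, hx]
    · rw [← hq']
      exact hqs _ _ fun x hx => by simp [Store.setCounter, Store.setCell, hx]
    · simpa [HoldsCoeff, Store.setCounter, Store.setCell] using hc'
    · convert h3.setScratchCounter (l + 1) using 1
      ext1 a b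
      simp only [Matrix.of_apply, B]
      by_cases hb : b = ⟨l, hl⟩
      · subst hb
        by_cases ha : a = P
        · simp [ha, hz]
        · simp [ha]
      · have hb' : (b : ℕ) ≠ l := fun h => hb (Fin.ext h)
        simp only [hb, and_false, if_false]
        exact if_congr (by omega) rfl rfl
  · rintro s' ⟨-, hp', hq', h1, h2⟩
    refine ⟨?_, h1, hp', hq'⟩
    convert h2 using 1
    ext1 a b
    simp
  · simp only [AddrExpr.cost]
    omega

lemma Holds.colOp {p q : AddrExpr} {P P' : Fin n} {c : ℂ} (h : Holds s m k i r A)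
    (hc : HoldsCoeff s c) (hp : p.eval s = P) (hq : q.eval s = P') (hne : P ≠ P')
    (hps : Stable p) (hqs : Stable q) (hpc : p.cost ≤ 10) (hqc : q.cost ≤ 10) :
    Exec (AZ.colOp p q) s ((n + 1) * 210) fun s' =>
      Holds s' m k i r (A * (transvection P P' c)ᴴ) := by
  rw [conjTranspose_transvection]
  refine Exec.forLoop (N := n) (T := 200) (fun l s' => s'.counter 3 = l ∧
      p.eval s' = P ∧ q.eval s' = P' ∧ HoldsCoeff s' c ∧ Holds s' m k i r
        (Matrix.of fun a b => if (a : ℕ) < l then (A * transvection P' P (star c)) a b else A a b))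
    (Nat.zero_le _) ?_ ?_ ?_ ?_ ?_
  · refine ⟨rfl, ?_, ?_, hc, ?_⟩
    · rw [← hp]
      exact hps _ _ fun x hx => by simp [Store.setCounter, hx]
    · rw [← hq]
      exact hqs _ _ fun x hx => by simp [Store.setCounter, hx]
    · refine (congrArg (Holds (s.setCounter 3 0) m k i r) ?_).mpr (h.setScratchCounter 0)
      ext1 a b
      simp [AddrExpr.eval]
  · rintro l s' ⟨h1, -, -, -, h2⟩
    exact ⟨h1, by simp [AddrExpr.eval, h2.size]⟩
  · rintro l s' - hl ⟨h1, hp', hq', hc', h2⟩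
    set B : Matrix (Fin n) (Fin n) ℂ :=
      Matrix.of fun a b => if (a : ℕ) < l then (A * transvection P' P (star c)) a b else A a b
    set z : ℂ := A ⟨l, hl⟩ P + star c * A ⟨l, hl⟩ P' with hz
    have hB (a : Fin n) : B ⟨l, hl⟩ a = A ⟨l, hl⟩ a := by simp [B]
    have hre (a : Fin n) : s'.cell 0 l a = (A ⟨l, hl⟩ a).re := by
      rw [← hB]
      exact h2.re ⟨l, hl⟩ a
    have him (a : Fin n) : s'.cell 1 l a = (A ⟨l, hl⟩ a).im := by
      rw [← hB]
      exact h2.im ⟨l, hl⟩ a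
    have hPP : ¬ (P' : ℕ) = P := fun h => hne (Fin.ext h.symm)
    refine Exec.seq (T₁ := 100) (T₂ := 100) (Exec.setCell ?_ (Exec.setCell ?_ ?_)) le_rfl
    · simp only [AddrExpr.cost, RealExpr.cost]
      omega
    · simp only [AddrExpr.cost, RealExpr.cost]
      omega
    set s1 := s'.setCell 0 (AddrExpr.eval s' (.var 3)) (p.eval s') _ with hs1
    have e1 : s1 = s'.setCell 0 l P z.re := by
      rw [hs1, hp']
      simp [AddrExpr.eval, RealExpr.eval, h1, hp', hq', hre, him, hc'.1, hc'.2, hz]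
    have hp1 : p.eval s1 = P := by
      rw [← hp', e1]
      exact hps _ _ fun x _ => rfl
    have hq1 : q.eval s1 = P' := by
      rw [← hq', e1]
      exact hqs _ _ fun x _ => rfl
    have h31 : s1.counter 3 = l := by rw [e1]; exact h1
    have hv : RealExpr.eval s1 (.add (.cell 1 (.var 3) p)
        (.sub (.mul (.cell 3 (.const 0) (.const 0)) (.cell 1 (.var 3) q))
        (.mul (.cell 3 (.const 0) (.const 1)) (.cell 0 (.var 3) q)))) = z.im := by
      simp only [RealExpr.eval, AddrExpr.eval, hp1, hq1, h31]
      rw [e1]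
      simp [Store.setCell, hPP, hre, him, hc'.1, hc'.2, hz]
      ring
    rw [hv, hp1]
    simp only [AddrExpr.eval, h31]
    rw [e1]
    have h3 := h2.setEntry ⟨l, hl⟩ P z
    refine ⟨h1, rfl, ?_, ?_, ?_, ?_⟩
    · rw [← hp']
      exact hps _ _ fun x hx => by simp [Store.setCounter, Store.setCell, hx]
    · rw [← hq']
      exact hqs _ _ fun x hx => by simp [Store.setCounter, Store.setCell, hx]
    · simpa [HoldsCoeff, Store.setCounter, Store.setCell] using hc'
    · convert h3.setScratchCounter (l + 1) using 1
      ext1 a b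
      simp only [Matrix.of_apply, B]
      by_cases hb : a = ⟨l, hl⟩
      · subst hb
        by_cases ha : b = P
        · simp [ha, hz]
        · simp [ha]
      · have hb' : (a : ℕ) ≠ l := fun h => hb (Fin.ext h)
        simp only [hb, false_and, if_false]
        exact if_congr (by omega) rfl rfl
  · rintro s' ⟨-, -, -, h1, h2⟩
    convert h2 using 1
    ext1 a b
    simp
  · simp only [AddrExpr.cost]
    omega

/-- The congruence of `A` by the transvection with coefficient `c` at `(p, q)`. -/
def cong {R : Type*} [CommRing R] [StarRing R] (p q : Fin n) (c : R)
    (A : Matrix (Fin n) (Fin n) R) : Matrix (Fin n) (Fin n) R :=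
  transvection p q c * A * (transvection p q c)ᴴ

lemma cong_apply {R : Type*} [CommRing R] [StarRing R] (p q : Fin n) (c : R)
    (A : Matrix (Fin n) (Fin n) R) (a b : Fin n) :
    cong p q c A a b = (A a b + if a = p then c * A q b else 0)
      + if b = p then star c * (A a q + if a = p then c * A q q else 0) else 0 := by
  have h1 (a b : Fin n) :
      (transvection p q c * A) a b = A a b + if a = p then c * A q b else 0 := by
    by_cases ha : a = p
    · simp [ha]
    · simp [ha]
  rw [cong, conjTranspose_transvection]
  by_cases hb : b = p
  · subst hb
    rw [Matrix.mul_transvection_apply_same, h1, h1]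
    simp
  · rw [Matrix.mul_transvection_apply_of_ne _ _ _ _ hb, h1]
    simp [hb]

/-- The program replacing `A` by its congruence by a transvection whose coefficient has the real
and imaginary parts `e` and `e'`. -/
def congProgram (p q : AddrExpr) (e e' : RealExpr) : Program :=
  .seq (.setCell 3 (.const 0) (.const 0) e) <| .seq (.setCell 3 (.const 0) (.const 1) e') <|
    .seq (rowOp p q) (colOp p q)

lemma Holds.congProgram {p q : AddrExpr} {e e' : RealExpr} {P P' : Fin n} (c : ℂ)
    (h : Holds s m k i r A) (he : e.eval s = c.re)
    (he' : ∀ v, e'.eval (s.setCell 3 0 0 v) = c.im)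
    (hp : p.eval s = P) (hq : q.eval s = P') (hne : P ≠ P')
    (hps : Stable p) (hqs : Stable q) (hpc : p.cost ≤ 10) (hqc : q.cost ≤ 10) (hec : e.cost ≤ 100)
    (hec' : e'.cost ≤ 100) :
    Exec (AZ.congProgram p q e e') s ((n + 1) * 700) fun s' =>
      Holds s' m k i r (cong P P' c A) := by
  refine Exec.seq (T₁ := 110) (T₂ := (n + 1) * 590) (Exec.setCell ?_ ?_) (by omega)
  · simp only [AddrExpr.cost]
    omega
  refine Exec.seq (T₁ := 110) (T₂ := (n + 1) * 480) (Exec.setCell ?_ ?_) (by omega)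
  · simp only [AddrExpr.cost]
    omega
  simp only [AddrExpr.eval, he, he']
  refine Exec.seq (T₁ := (n + 1) * 210) (T₂ := (n + 1) * 210) ?_ (by omega)
  refine (Holds.rowOp (c := c) (P := P) (P' := P') ((h.setScratchCell _ _ _).setScratchCell _ _ _)
    ?_ ?_ ?_ hne hps hqs hpc hqc).mono le_rfl ?_
  · simp [HoldsCoeff, Store.setCell]
  · rw [← hp]
    exact hps _ _ fun x hx => rfl
  · rw [← hq]
    exact hqs _ _ fun x hx => rfl
  · rintro s' ⟨h1, h2, h3, h4⟩
    exact h1.colOp h2 h3 h4 hne hps hqs hpc hqc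

end congruence

/-! ### Computing the signature -/

lemma stable_var {x : ℕ} (hx : x ≠ 3) : Stable (.var x) := fun _ _ h => h x hx

lemma stable_const (x : ℕ) : Stable (.const x) := fun _ _ _ => rfl

lemma stable_add {e f : AddrExpr} (he : Stable e) (hf : Stable f) : Stable (.add e f) :=
  fun s s' h => by simp only [AddrExpr.eval, he s s' h, hf s s' h]

section signatureProgram
variable {n : ℕ}

/-- The state of the elimination before round `k`: the first `k` rows and columns of `A` are
diagonal, and the signs of their diagonal entries have been summed up. -/
structure SigInv (d : ℤ) (A₀ : Matrix (Fin n) (Fin n) ℂ) (k : ℕ) (r : ℝ)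
    (A : Matrix (Fin n) (Fin n) ℂ) : Prop where
  herm : A.IsHermitian
  unit : IsUnit A
  sig : signature A = signature A₀
  diag : ∀ a b : Fin n, (a : ℕ) < k → a ≠ b → A a b = 0
  out : r = (∑ l : Fin n, if (l : ℕ) < k then Real.sign (A l l).re else 0) / d

lemma SigInv.start {A : Matrix (Fin n) (Fin n) ℂ} (hA : A.IsHermitian) (hu : IsUnit A) (d : ℤ) :
    SigInv d A 0 0 A :=
  ⟨hA, hu, rfl, fun _ _ ha => (Nat.not_lt_zero _ ha).elim, by simp⟩

lemma SigInv.cong {d : ℤ} {A₀ A : Matrix (Fin n) (Fin n) ℂ} {k : ℕ} {r : ℝ}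
    (h : SigInv d A₀ k r A) {p q : Fin n} (hp : k ≤ p) (hq : k ≤ q) (hpq : p ≠ q) (c : ℂ) :
    SigInv d A₀ k r (cong p q c A) := by
  have hlt {a x : Fin n} (ha : (a : ℕ) < k) (hx : k ≤ (x : ℕ)) : a ≠ x := fun e => by
    rw [e] at ha; omega
  have hrow (a b : Fin n) (ha : (a : ℕ) < k) : AZ.cong p q c A a b = A a b := by
    rw [cong_apply, if_neg (hlt ha hp), if_neg (hlt ha hp), h.diag a q ha (hlt ha hq)]
    simp
  refine ⟨isHermitian_mul_mul_conjTranspose _ h.herm, ?_,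
    (signature_transvection hpq c h.herm h.unit).trans h.sig, fun a b ha hab => ?_, ?_⟩
  · have hu := h.unit
    rw [Matrix.isUnit_iff_isUnit_det] at hu ⊢
    simpa [AZ.cong, Matrix.det_mul, Matrix.det_conjTranspose,
      Matrix.det_transvection_of_ne _ _ hpq] using hu
  · rw [hrow a b ha, h.diag a b ha hab]
  · rw [h.out]
    congr 1
    refine Finset.sum_congr rfl fun l _ => ?_
    split_ifs with hl
    · rw [hrow l l hl]
    · rfl

lemma herm_entry {A : Matrix (Fin n) (Fin n) ℂ} (h : A.IsHermitian) (a b : Fin n) :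
    A a b = star (A b a) := (h.apply a b).symm

lemma herm_diag_im {A : Matrix (Fin n) (Fin n) ℂ} (h : A.IsHermitian) (a : Fin n) :
    (A a a).im = 0 := by
  have h1 := congrArg Complex.im (herm_entry h a a)
  simp only [RCLike.star_def, Complex.conj_im] at h1
  linarith

/-- If the pivot vanishes, add a multiple of row and column `i` to row and column `k`. The
coefficient `A k i / (1 + (A i i) ^ 2)` makes the new pivot nonzero if `A k i` is nonzero. -/
def sigPivot : Program :=
  .ite (.realEq (.cell 0 (.var 1) (.var 1)) (.const 0))
    (congProgram (.var 1) (.var 2)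
      (.div (.cell 0 (.var 1) (.var 2))
        (.add (.const 1) (.mul (.cell 0 (.var 2) (.var 2)) (.cell 0 (.var 2) (.var 2)))))
      (.div (.cell 1 (.var 1) (.var 2))
        (.add (.const 1) (.mul (.cell 0 (.var 2) (.var 2)) (.cell 0 (.var 2) (.var 2))))))
    .skip

/-- Clear the entries `(i, k)` and `(k, i)`. -/
def sigClear : Program :=
  congProgram (.var 2) (.var 1)
    (.neg (.div (.cell 0 (.var 2) (.var 1)) (.cell 0 (.var 1) (.var 1))))
    (.neg (.div (.cell 1 (.var 2) (.var 1)) (.cell 0 (.var 1) (.var 1))))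

/-- The signature divided by `d`, by symmetric Gaussian elimination. -/
def sigProgram (d : ℤ) : Program :=
  forLoop 1 (.const 0) (.var 0) <|
    .seq (forLoop 2 (.add (.var 1) (.const 1)) (.var 0) sigPivot) <|
    .seq (forLoop 2 (.add (.var 1) (.const 1)) (.var 0) sigClear) <|
    .ite (.realLt (.const 0) (.cell 0 (.var 1) (.var 1)))
      (.setCell 2 (.const 0) (.const 0)
        (.add (.cell 2 (.const 0) (.const 0)) (.div (.const 1) (.const d))))
      (.setCell 2 (.const 0) (.const 0)
        (.sub (.cell 2 (.const 0) (.const 0)) (.div (.const 1) (.const d))))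

variable {m k i : ℕ} {r : ℝ} {A A₀ : Matrix (Fin n) (Fin n) ℂ} {s : Store} {d : ℤ}

/-- Once the loop has reached `i`, either the pivot is nonzero or the entries `(k, b)` with
`k < b < i` vanish. -/
lemma exec_sigPivot (hk : k < n) (hi : i < n) (hki : k < i) (h : Holds s m k i r A)
    (hI : SigInv d A₀ k r A) (hz : A ⟨k, hk⟩ ⟨k, hk⟩ ≠ 0 ∨
      ∀ b : Fin n, k < (b : ℕ) → (b : ℕ) < i → A ⟨k, hk⟩ b = 0) :
    Exec sigPivot s ((n + 1) * 710) fun s' => ∃ A', Holds s' m k i r A' ∧ SigInv d A₀ k r A' ∧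
      (A' ⟨k, hk⟩ ⟨k, hk⟩ ≠ 0 ∨
        ∀ b : Fin n, k < (b : ℕ) → (b : ℕ) < i + 1 → A' ⟨k, hk⟩ b = 0) := by
  set K : Fin n := ⟨k, hk⟩
  set J : Fin n := ⟨i, hi⟩
  have hKJ : K ≠ J := fun e => by have := Fin.ext_iff.1 e; simp [K, J] at this; omega
  refine Exec.ite (T₁ := (n + 1) * 700) (fun ht => ?_) (fun ht => ?_) (by
    simp only [Test.cost, RealExpr.cost, AddrExpr.cost]; omega)
  · have hre : (A K K).re = 0 := by
      rw [← h.re K K]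
      simpa [Test.Holds, RealExpr.eval, AddrExpr.eval, h.outer] using ht
    have hKK : A K K = 0 := Complex.ext hre (herm_diag_im hI.herm K)
    set w : ℝ := 1 + (A J J).re * (A J J).re with hw
    have hw0 : 0 < w := by nlinarith [mul_self_nonneg (A J J).re]
    set c : ℂ := A K J * ((w⁻¹ : ℝ) : ℂ) with hc
    have hJJ : A J J = ((A J J).re : ℂ) := Complex.ext (by simp) (by simp [herm_diag_im hI.herm])
    refine (Holds.congProgram (p := .var 1) (q := .var 2) (P := K) (P' := J) c h ?_
      (fun v => ?_) h.outer h.inner hKJ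
      (stable_var (by decide)) (stable_var (by decide)) (by simp [AddrExpr.cost])
      (by simp [AddrExpr.cost]) (by simp [RealExpr.cost, AddrExpr.cost])
      (by simp [RealExpr.cost, AddrExpr.cost])).mono le_rfl ?_
    · have h1 := h.re K J
      have h2 := h.re J J
      simp only [K, J] at h1 h2
      rw [hc, Complex.re_mul_ofReal]
      simp [RealExpr.eval, AddrExpr.eval, h.outer, h.inner, h1, h2, hw, div_eq_mul_inv, K, J]
    · have h1 := h.im K J
      have h2 := h.re J J
      simp only [K, J] at h1 h2
      rw [hc, Complex.im_mul_ofReal]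
      simp [RealExpr.eval, AddrExpr.eval, Store.setCell, h.outer, h.inner, h1, h2, hw,
        div_eq_mul_inv, K, J]
    · intro s' h'
      refine ⟨_, h', hI.cong le_rfl hki.le hKJ c, ?_⟩
      by_cases h0 : A K J = 0
      · right
        have hc0 : c = 0 := by rw [hc, h0, zero_mul]
        intro b hb hb'
        rw [hc0, cong_apply]
        by_cases hbi : b = J
        · rw [hbi, h0]
          simp
        · have : (b : ℕ) ≠ i := fun e => hbi (Fin.ext e)
          simp [(hz.resolve_left (not_not.2 hKK)) b hb (by omega)]
      · left
        have hnew : AZ.cong K J c A K K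
            = ((Complex.normSq (A K J) * (w⁻¹ * (2 + (A J J).re * w⁻¹)) : ℝ) : ℂ) := by
          rw [cong_apply, if_pos rfl, if_pos rfl, if_pos rfl, hKK, herm_entry hI.herm J K, hJJ, hc]
          simp only [Complex.ofReal_mul, Complex.ofReal_add, ← Complex.mul_conj, star_mul',
            RCLike.star_def, Complex.conj_ofReal, Complex.ofReal_ofNat, Complex.ofReal_re]
          ring
        rw [hnew]
        norm_cast
        refine mul_ne_zero (Complex.normSq_pos.2 h0).ne' (mul_ne_zero (inv_pos.2 hw0).ne' ?_)
        have h5 : -1 ≤ (A J J).re * w⁻¹ := by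
          rw [← div_eq_mul_inv, le_div_iff₀ hw0]
          nlinarith [sq_nonneg ((A J J).re + 1)]
        linarith
  · have hre : (A K K).re ≠ 0 := by
      rw [← h.re K K]
      simpa [Test.Holds, RealExpr.eval, AddrExpr.eval, h.outer] using ht
    exact Exec.skip (by omega) ⟨A, h, hI, Or.inl fun h0 => hre (by rw [h0]; rfl)⟩

/-- Once the loop has reached `i`, the entries `(k, b)` with `k < b < i` vanish. -/
lemma exec_sigClear (hk : k < n) (hi : i < n) (hki : k < i) (h : Holds s m k i r A)
    (hI : SigInv d A₀ k r A) (hp : A ⟨k, hk⟩ ⟨k, hk⟩ ≠ 0)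
    (hz : ∀ b : Fin n, k < (b : ℕ) → (b : ℕ) < i → A ⟨k, hk⟩ b = 0) :
    Exec sigClear s ((n + 1) * 700) fun s' => ∃ A', Holds s' m k i r A' ∧ SigInv d A₀ k r A' ∧
      A' ⟨k, hk⟩ ⟨k, hk⟩ ≠ 0 ∧
        ∀ b : Fin n, k < (b : ℕ) → (b : ℕ) < i + 1 → A' ⟨k, hk⟩ b = 0 := by
  set K : Fin n := ⟨k, hk⟩
  set J : Fin n := ⟨i, hi⟩
  have hKJ : J ≠ K := fun e => by have := Fin.ext_iff.1 e; simp [K, J] at this; omega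
  set c : ℂ := -(A J K) * (((A K K).re⁻¹ : ℝ) : ℂ) with hc
  have hKK : A K K = ((A K K).re : ℂ) := Complex.ext (by simp) (by simp [herm_diag_im hI.herm])
  have hre : ((A K K).re : ℂ) ≠ 0 := by rwa [← hKK]
  refine (Holds.congProgram (p := .var 2) (q := .var 1) (P := J) (P' := K) c h ?_
      (fun v => ?_) h.inner h.outer hKJ
      (stable_var (by decide)) (stable_var (by decide)) (by simp [AddrExpr.cost])
      (by simp [AddrExpr.cost]) (by simp [RealExpr.cost, AddrExpr.cost])
      (by simp [RealExpr.cost, AddrExpr.cost])).mono le_rfl ?_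
  · have h1 := h.re J K
    have h2 := h.re K K
    simp only [K, J] at h1 h2
    rw [hc, Complex.re_mul_ofReal]
    simp [RealExpr.eval, AddrExpr.eval, h.outer, h.inner, h1, h2, div_eq_mul_inv, K, J]
  · have h1 := h.im J K
    have h2 := h.re K K
    simp only [K, J] at h1 h2
    rw [hc, Complex.im_mul_ofReal]
    simp [RealExpr.eval, AddrExpr.eval, Store.setCell, h.outer, h.inner, h1, h2,
      div_eq_mul_inv, K, J]
  · intro s' h'
    refine ⟨_, h', hI.cong hki.le le_rfl hKJ c, ?_, fun b hb hb' => ?_⟩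
    · simpa [cong_apply, hKJ.symm] using hp
    · rw [cong_apply, if_neg hKJ.symm, if_neg hKJ.symm]
      by_cases hbi : b = J
      · subst hbi
        rw [if_pos rfl, hc, herm_entry hI.herm K J, hKK]
        simp only [star_mul', star_neg, RCLike.star_def, Complex.conj_ofReal, Complex.ofReal_re]
        rw [Complex.ofReal_inv]
        field_simp
        ring
      · have : (b : ℕ) ≠ i := fun e => hbi (Fin.ext e)
        simp [hbi, hz b hb (by omega)]

lemma exec_sigProgram (h : Holds s m k i 0 A) (hA : A.IsHermitian) (hu : IsUnit A) (d : ℤ) :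
    Exec (sigProgram d) s ((n + 1) ^ 3 * 1600) fun s' => s'.output = (signature A : ℝ) / d := by
  have hn1 : n + 1 ≤ (n + 1) ^ 2 := Nat.le_self_pow two_ne_zero _
  have hsq : (n + 1) * (n + 1) = (n + 1) ^ 2 := (sq _).symm
  refine Exec.forLoop (N := n) (T := (n + 1) ^ 2 * 1580) (fun k s' => ∃ i r B, Holds s' m k i r B ∧
    SigInv d A k r B) (Nat.zero_le _) ?_ ?_ ?_ ?_ ?_
  · exact ⟨i, 0, A, h.setOuter 0, .start hA hu d⟩
  · rintro k s' ⟨i, r, B, h1, -⟩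
    exact ⟨h1.outer, by simp [AddrExpr.eval, h1.size]⟩
  · rintro k s' - hk ⟨i, r, B, h1, h2⟩
    set K : Fin n := ⟨k, hk⟩
    refine Exec.seq (T₁ := (n + 1) ^ 2 * 740) (T₂ := (n + 1) ^ 2 * 840)
      (Exec.forLoop (N := n) (T := (n + 1) * 710) (fun i s' => ∃ B, Holds s' m k i r B ∧
        SigInv d A k r B ∧ (B K K ≠ 0 ∨ ∀ b : Fin n, k < (b : ℕ) → (b : ℕ) < i → B K b = 0))
        (by simp [AddrExpr.eval, h1.outer]; omega)
        ⟨B, h1.setInner _, h2, Or.inr fun b hb hb' => by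
          simp only [AddrExpr.eval, h1.outer] at hb'
          omega⟩
        (fun i s' ⟨B, h3, _⟩ => ⟨h3.inner, by simp [AddrExpr.eval, h3.size]⟩)
        (fun i s' hlo hi ⟨B, h3, h4, h5⟩ =>
          (exec_sigPivot hk hi (by simp only [AddrExpr.eval, h1.outer] at hlo; omega)
            h3 h4 h5).mono le_rfl fun s'' ⟨B', h6, h7, h8⟩ =>
              ⟨h6.inner, B', h6.setInner _, h7, h8⟩)
        (Q := fun s' => Exec _ s' _ _) ?_ (by simp only [AddrExpr.cost]; nlinarith)) (by omega)
    rintro s1 ⟨B1, h3, h4, h5⟩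
    have hp : B1 K K ≠ 0 := by
      rcases h5 with h5 | h5
      · exact h5
      · intro h0
        have hu1 := h4.unit
        rw [Matrix.isUnit_iff_isUnit_det, Matrix.det_eq_zero_of_row_eq_zero K] at hu1
        · simp at hu1
        · intro b
          rcases lt_trichotomy (b : ℕ) k with hb | hb | hb
          · rw [herm_entry h4.herm, h4.diag b K hb (fun e => by rw [e] at hb; simp [K] at hb),
              star_zero]
          · rw [show b = K from Fin.ext hb, h0]
          · exact h5 b hb b.2
    refine Exec.seq (T₁ := (n + 1) ^ 2 * 740) (T₂ := (n + 1) ^ 2 * 100)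
      (Exec.forLoop (N := n) (T := (n + 1) * 700) (fun i s' => ∃ B, Holds s' m k i r B ∧
        SigInv d A k r B ∧ B K K ≠ 0 ∧ ∀ b : Fin n, k < (b : ℕ) → (b : ℕ) < i → B K b = 0)
        (by simp [AddrExpr.eval, h3.outer]; omega)
        ⟨B1, h3.setInner _, h4, hp, fun b hb hb' => by
          simp only [AddrExpr.eval, h3.outer] at hb'
          omega⟩
        (fun i s' ⟨B, h3, _⟩ => ⟨h3.inner, by simp [AddrExpr.eval, h3.size]⟩)
        (fun i s' hlo hi ⟨B, h3', h4, h5, h6⟩ =>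
          (exec_sigClear hk hi (by simp only [AddrExpr.eval, h3.outer] at hlo; omega)
            h3' h4 h5 h6).mono le_rfl fun s'' ⟨B', h6, h7, h8⟩ =>
              ⟨h6.inner, B', h6.setInner _, h7, h8⟩)
        (Q := fun s' => Exec _ s' _ _) ?_ (by simp only [AddrExpr.cost]; nlinarith)) (by omega)
    rintro s2 ⟨B2, h6, h7, h8, h9⟩
    have hdiag : ∀ a b : Fin n, (a : ℕ) < k + 1 → a ≠ b → B2 a b = 0 := by
      intro a b ha hab
      rcases Nat.lt_succ_iff_lt_or_eq.1 ha with ha | ha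
      · exact h7.diag a b ha hab
      · have ha' : a = K := Fin.ext ha
        rcases lt_trichotomy (b : ℕ) k with hb | hb | hb
        · rw [herm_entry h7.herm, h7.diag b a hb hab.symm, star_zero]
        · exact (hab (Fin.ext (ha.trans hb.symm))).elim
        · rw [ha']
          exact h9 b hb b.2
    have hsum : (∑ l : Fin n, if (l : ℕ) < k + 1 then Real.sign (B2 l l).re else 0)
        = (∑ l : Fin n, if (l : ℕ) < k then Real.sign (B2 l l).re else 0)
          + Real.sign (B2 K K).re := by
      have e (l : Fin n) : (if (l : ℕ) < k + 1 then Real.sign (B2 l l).re else 0)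
          = (if (l : ℕ) < k then Real.sign (B2 l l).re else 0)
            + if l = K then Real.sign (B2 l l).re else 0 := by
        by_cases hl : l = K
        · simp [hl, K]
        · have : (l : ℕ) ≠ k := fun e => hl (Fin.ext e)
          have h3 : (l : ℕ) < k + 1 ↔ (l : ℕ) < k := by omega
          simp [hl, h3]
      rw [Finset.sum_congr rfl fun l _ => e l, Finset.sum_add_distrib]
      simp
    have hre := h6.re K K
    simp only [K] at hre
    refine Exec.ite (T₁ := 20) (fun ht => Exec.setCell ?_ ?_) (fun ht => Exec.setCell ?_ ?_) ?_
    · simp [RealExpr.cost, AddrExpr.cost]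
    · have hpos : 0 < (B2 K K).re := by
        simpa [Test.Holds, RealExpr.eval, AddrExpr.eval, h6.outer, hre] using ht
      refine ⟨h6.outer, _, _, B2, (h6.setOut _).setOuter _, h7.herm, h7.unit, h7.sig, hdiag, ?_⟩
      simp only [RealExpr.eval, AddrExpr.eval, h6.out]
      rw [hsum, Real.sign_of_pos hpos, add_div, ← h7.out]
      simp
    · simp [RealExpr.cost, AddrExpr.cost]
    · have hneg : (B2 K K).re < 0 := by
        have h10 : (B2 K K).re ≤ 0 := by
          simpa [Test.Holds, RealExpr.eval, AddrExpr.eval, h6.outer, hre] using ht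
        refine lt_of_le_of_ne h10 fun h0 => h8 (Complex.ext h0 (herm_diag_im h7.herm K))
      refine ⟨h6.outer, _, _, B2, (h6.setOut _).setOuter _, h7.herm, h7.unit, h7.sig, hdiag, ?_⟩
      simp only [RealExpr.eval, AddrExpr.eval, h6.out]
      rw [hsum, Real.sign_of_neg hneg, add_div, ← h7.out]
      simp
      ring
    · simp only [Test.cost, RealExpr.cost, AddrExpr.cost]
      omega
  · rintro s' ⟨i, r, B, h1, h2⟩
    have hB : B = Matrix.diagonal fun a => ((B a a).re : ℂ) := by
      ext a b
      by_cases hab : a = b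
      · subst hab
        rw [Matrix.diagonal_apply_eq]
        exact Complex.ext (by simp) (by simp [herm_diag_im h2.herm])
      · rw [Matrix.diagonal_apply_ne _ hab, h2.diag a b a.2 hab]
    rw [Store.output, h1.out, h2.out, ← h2.sig]
    conv_rhs => rw [hB]
    rw [signature_diagonal]
    simp
  · simp only [AddrExpr.cost]
    have : (n + 1) ^ 3 = (n + 1) * (n + 1) ^ 2 := by ring
    nlinarith

end signatureProgram

/-! ### Computing the sign of the Pfaffian -/

section halving
variable {n m k i : ℕ} {r : ℝ} {A : Matrix (Fin n) (Fin n) ℂ} {s : Store}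

/-- Store `n / 2` in the counter `4`, for even `n`. -/
def halve : Program := forLoop 4 (.const 0) (.sub (.var 0) (.var 4)) .skip

lemma exec_halve (hn : Even n) (h : Holds s m k i r A) :
    Exec halve s ((n + 1) * 20) fun s' => Holds s' (n / 2) k i r A := by
  refine Exec.forLoop (N := n / 2) (T := 1) (fun j s' => Holds s' j k i r A) (Nat.zero_le _)
    (h.setHalf 0) (fun j s' h' => ⟨h'.half, ?_⟩)
    (fun j s' _ _ h' => Exec.skip le_rfl ⟨h'.half, h'.setHalf _⟩) (fun _ h' => h') ?_
  · have := hn.two_dvd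
    simp only [AddrExpr.eval, h'.size, h'.half]
    omega
  · simp only [AddrExpr.cost]
    omega

lemma holds_inputStore (M : Matrix (Fin n) (Fin n) ℂ) : Holds (inputStore M) 0 0 0 0 M := by
  refine ⟨rfl, rfl, rfl, rfl, ?_, fun a b => ?_, fun a b => ?_⟩ <;> simp [inputStore]

/-- Multiply the result by the sign of `t`. -/
def mulSign (t : Test) : Program :=
  .ite t .skip (.setCell 2 (.const 0) (.const 0) (.neg (.cell 2 (.const 0) (.const 0))))

lemma exec_mulSign {t : Test} {x : ℝ} (h : Holds s m k i r A) (ht : t.Holds s ↔ 0 < x)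
    (hx : x ≠ 0) (hc : t.cost ≤ 60) :
    Exec (mulSign t) s 70 fun s' => Holds s' m k i (r * Real.sign x) A := by
  refine Exec.ite (T₁ := 8) (fun h1 => Exec.skip (by omega) ?_)
    (fun h1 => Exec.setCell (by simp [RealExpr.cost, AddrExpr.cost]) ?_) (by omega)
  · rw [Real.sign_of_pos (ht.1 h1), mul_one]
    exact h
  · rw [Real.sign_of_neg (lt_of_le_of_ne (not_lt.1 fun h2 => h1 (ht.2 h2)) hx)]
    simp only [RealExpr.eval, AddrExpr.eval, h.out]
    rw [mul_neg_one]
    exact h.setOut _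

lemma prod_sign_succ {m k : ℕ} (hk : k < m) (f : Fin m → ℝ) :
    (∏ l : Fin m, if (l : ℕ) < k + 1 then Real.sign (f l) else 1)
      = (∏ l : Fin m, if (l : ℕ) < k then Real.sign (f l) else 1) * Real.sign (f ⟨k, hk⟩) := by
  have e (l : Fin m) : (if (l : ℕ) < k + 1 then Real.sign (f l) else 1)
      = (if (l : ℕ) < k then Real.sign (f l) else 1)
        * if l = ⟨k, hk⟩ then Real.sign (f l) else 1 := by
    by_cases hl : l = ⟨k, hk⟩
    · simp [hl]
    · have : (l : ℕ) ≠ k := fun e => hl (Fin.ext e)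
      have h3 : (l : ℕ) < k + 1 ↔ (l : ℕ) < k := by omega
      simp [hl, h3]
  rw [Finset.prod_congr rfl fun l _ => e l, Finset.prod_mul_distrib]
  simp

lemma det_cong {A : Matrix (Fin n) (Fin n) ℝ} {p q : Fin n} (hpq : p ≠ q) (c : ℝ) :
    (cong p q c A).det = A.det := by
  simp [cong, Matrix.det_mul, Matrix.det_transvection_of_ne _ _ hpq]

end halving

section pfaffianProgram
variable {n : ℕ}

/-- The matrix `-i A`, for real `A`. -/
def negI (A : Matrix (Fin n) (Fin n) ℝ) : Matrix (Fin n) (Fin n) ℂ :=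
  Matrix.of fun a b => ⟨0, -A a b⟩

lemma negI_apply (A : Matrix (Fin n) (Fin n) ℝ) (a b : Fin n) : negI A a b = ⟨0, -A a b⟩ := rfl

lemma cong_negI (A : Matrix (Fin n) (Fin n) ℝ) (p q : Fin n) (c : ℝ) :
    cong p q (c : ℂ) (negI A) = negI (cong p q c A) := by
  ext a b
  rw [cong_apply, negI_apply (AZ.cong p q c A), cong_apply]
  simp only [negI_apply]
  apply Complex.ext
  · split_ifs <;> simp
  · split_ifs <;> simp <;> ring

/-- The state of the elimination before round `k`: the rows and columns with index below `2 k`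
are block-diagonal with blocks of size two, and `r` is the product of the signs of the blocks. -/
structure PfInv (A₀ : Matrix (Fin n) (Fin n) ℝ) (k : ℕ) (r : ℝ)
    (A : Matrix (Fin n) (Fin n) ℝ) : Prop where
  skew : ∀ a b, A a b = -A b a
  det : A.det ≠ 0
  pf : pfaffian A = pfaffian A₀
  block : ∀ a b : Fin n, (a : ℕ) < 2 * k → (a : ℕ) / 2 ≠ b / 2 → A a b = 0
  out : r = ∏ l : Fin (n / 2), if (l : ℕ) < k then Real.sign (A (evenIdx l) (oddIdx l)) else 1
  unit : r = 1 ∨ r = -1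

lemma PfInv.start {A : Matrix (Fin n) (Fin n) ℝ} (hA : ∀ a b, A a b = -A b a) (hd : A.det ≠ 0) :
    PfInv A 0 1 A :=
  ⟨hA, hd, rfl, fun _ _ ha => (Nat.not_lt_zero _ ha).elim, by simp, Or.inl rfl⟩

lemma PfInv.diag {A A₀ : Matrix (Fin n) (Fin n) ℝ} {k : ℕ} {r : ℝ} (h : PfInv A₀ k r A)
    (a : Fin n) : A a a = 0 := self_eq_neg.1 (h.skew a a)

lemma PfInv.cong {A A₀ : Matrix (Fin n) (Fin n) ℝ} {k : ℕ} {r : ℝ}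
    (h : PfInv A₀ k r A) {p q : Fin n} (hp : 2 * k ≤ p) (hq : 2 * k ≤ q) (hpq : p ≠ q) (c : ℝ) :
    PfInv A₀ k r (cong p q c A) := by
  have hlt {a x : Fin n} (ha : (a : ℕ) < 2 * k) (hx : 2 * k ≤ (x : ℕ)) : a ≠ x := fun e => by
    rw [e] at ha; omega
  have hrow (a b : Fin n) (ha : (a : ℕ) < 2 * k) : AZ.cong p q c A a b = A a b := by
    rw [cong_apply, if_neg (hlt ha hp), if_neg (hlt ha hp), h.block a q ha (by omega)]
    simp
  refine ⟨fun a b => ?_, by rw [det_cong hpq]; exact h.det, ?_, fun a b ha hab => ?_, ?_, h.unit⟩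
  · rw [cong_apply, cong_apply, h.skew b a, h.skew q a, h.skew b q, h.diag q]
    split_ifs <;> simp <;> ring
  · rw [AZ.cong, Matrix.conjTranspose_eq_transpose_of_trivial, pfaffian_congruence,
      Matrix.det_transvection_of_ne _ _ hpq, one_mul, h.pf]
  · rw [hrow a b ha, h.block a b ha hab]
  · rw [h.out]
    refine Finset.prod_congr rfl fun l _ => ?_
    split_ifs with hl
    · rw [hrow _ _ (by simp only [evenIdx]; omega)]
    · rfl

/-- The address `2 k`. -/
def addrEven : AddrExpr := .add (.var 1) (.var 1)

/-- The address `2 k + 1`. -/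
def addrOdd : AddrExpr := .add (.add (.var 1) (.var 1)) (.const 1)

/-- If the pivot `(2 k, 2 k + 1)` vanishes, add row and column `i` to row and column `2 k + 1`. -/
def pfPivot : Program :=
  .ite (.realEq (.cell 1 addrEven addrOdd) (.const 0))
    (congProgram addrOdd (.var 2) (.const 1) (.const 0)) .skip

/-- Clear the entries of row and column `i` at `2 k` and `2 k + 1`. -/
def pfClear : Program :=
  .seq (congProgram (.var 2) addrOdd
      (.neg (.div (.cell 1 (.var 2) addrEven) (.cell 1 addrOdd addrEven))) (.const 0))
    (congProgram (.var 2) addrEven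
      (.neg (.div (.cell 1 (.var 2) addrOdd) (.cell 1 addrEven addrOdd))) (.const 0))

/-- The sign of the Pfaffian of `A`, from the matrix `-i A`, by skew-symmetric Gaussian
elimination. -/
def pfProgram : Program :=
  .seq halve <| .seq (.setCell 2 (.const 0) (.const 0) (.const 1)) <|
  forLoop 1 (.const 0) (.var 4) <|
    .seq (forLoop 2 (.add addrOdd (.const 1)) (.var 0) pfPivot) <|
    .seq (forLoop 2 (.add addrOdd (.const 1)) (.var 0) pfClear) <|
    mulSign (.realLt (.cell 1 addrEven addrOdd) (.const 0))

lemma stable_addrEven : Stable addrEven :=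
  stable_add (stable_var (by decide)) (stable_var (by decide))

lemma stable_addrOdd : Stable addrOdd := stable_add stable_addrEven (stable_const 1)

variable {m k i : ℕ} {r : ℝ} {A A₀ : Matrix (Fin n) (Fin n) ℝ} {s : Store}

lemma Holds.eval_addrEven {A : Matrix (Fin n) (Fin n) ℂ} (h : Holds s m k i r A) :
    addrEven.eval s = 2 * k := by
  simp only [addrEven, AddrExpr.eval, h.outer]
  omega

lemma Holds.eval_addrOdd {A : Matrix (Fin n) (Fin n) ℂ} (h : Holds s m k i r A) :
    addrOdd.eval s = 2 * k + 1 := by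
  simp only [addrOdd, AddrExpr.eval, h.outer]
  omega

lemma Holds.negI_entry (h : Holds s m k i r (negI A)) (a b : Fin n) : s.cell 1 a b = -A a b :=
  h.im a b

/-- As for the signature: either the pivot is nonzero or row `2 k` vanishes up to column `i`. -/
lemma exec_pfPivot (hk : 2 * k + 1 < n) (hi : i < n) (hki : 2 * k + 2 ≤ i)
    (h : Holds s m k i r (negI A))
    (hI : PfInv A₀ k r A) (hz : A ⟨2 * k, by omega⟩ ⟨2 * k + 1, hk⟩ ≠ 0 ∨
      ∀ b : Fin n, 2 * k + 2 ≤ (b : ℕ) → (b : ℕ) < i → A ⟨2 * k, by omega⟩ b = 0) :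
    Exec pfPivot s ((n + 1) * 730) fun s' => ∃ A', Holds s' m k i r (negI A') ∧ PfInv A₀ k r A' ∧
      (A' ⟨2 * k, by omega⟩ ⟨2 * k + 1, hk⟩ ≠ 0 ∨
        ∀ b : Fin n, 2 * k + 2 ≤ (b : ℕ) → (b : ℕ) < i + 1 → A' ⟨2 * k, by omega⟩ b = 0) := by
  set K : Fin n := ⟨2 * k, by omega⟩
  set K' : Fin n := ⟨2 * k + 1, hk⟩
  set J : Fin n := ⟨i, hi⟩
  have hKJ : K' ≠ J := fun e => by have := Fin.ext_iff.1 e; simp [K', J] at this; omega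
  have hKK : K ≠ K' := fun e => by have := Fin.ext_iff.1 e; simp [K, K'] at this
  have hcell := h.negI_entry K K'
  simp only [K, K'] at hcell
  refine Exec.ite (T₁ := (n + 1) * 700) (fun ht => ?_) (fun ht => ?_) (by
    simp only [Test.cost, RealExpr.cost, AddrExpr.cost, addrEven, addrOdd]; omega)
  · have h0 : A K K' = 0 := by
      simpa [Test.Holds, RealExpr.eval, h.eval_addrEven, h.eval_addrOdd, hcell] using ht
    refine (Holds.congProgram (p := addrOdd) (q := .var 2) (P := K') (P' := J) ((1 : ℝ) : ℂ) h
      (by simp [RealExpr.eval]) (by simp [RealExpr.eval]) h.eval_addrOdd h.inner hKJ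
      stable_addrOdd (stable_var (by decide)) (by simp [AddrExpr.cost, addrOdd])
      (by simp [AddrExpr.cost]) (by simp [RealExpr.cost]) (by simp [RealExpr.cost])).mono le_rfl ?_
    intro s' h'
    rw [cong_negI] at h'
    refine ⟨_, h', hI.cong (by simp [K']) (by simp [J]; omega) hKJ 1, ?_⟩
    by_cases hJ : A K J = 0
    · right
      intro b hb hb'
      have hbK : b ≠ K' := fun e => by rw [e] at hb; simp [K'] at hb
      rw [cong_apply, if_neg hKK, if_neg hbK, add_zero, add_zero]
      by_cases hbi : b = J
      · rw [hbi, hJ]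
      · have : (b : ℕ) ≠ i := fun e => hbi (Fin.ext e)
        exact (hz.resolve_left (not_not.2 h0)) b hb (by omega)
    · left
      rw [cong_apply, if_neg hKK, if_pos rfl, if_neg hKK, h0]
      simpa using hJ
  · have h0 : A K K' ≠ 0 := by
      simpa [Test.Holds, RealExpr.eval, h.eval_addrEven, h.eval_addrOdd, hcell] using ht
    exact Exec.skip (by omega) ⟨A, h, hI, Or.inl h0⟩

lemma exec_pfClear (hk : 2 * k + 1 < n) (hi : i < n) (hki : 2 * k + 2 ≤ i)
    (h : Holds s m k i r (negI A))
    (hI : PfInv A₀ k r A) (hp : A ⟨2 * k, by omega⟩ ⟨2 * k + 1, hk⟩ ≠ 0)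
    (hz : ∀ b : Fin n, 2 * k + 2 ≤ (b : ℕ) → (b : ℕ) < i →
      A ⟨2 * k, by omega⟩ b = 0 ∧ A ⟨2 * k + 1, hk⟩ b = 0) :
    Exec pfClear s ((n + 1) * 1400) fun s' => ∃ A', Holds s' m k i r (negI A') ∧ PfInv A₀ k r A' ∧
      A' ⟨2 * k, by omega⟩ ⟨2 * k + 1, hk⟩ ≠ 0 ∧
        ∀ b : Fin n, 2 * k + 2 ≤ (b : ℕ) → (b : ℕ) < i + 1 →
          A' ⟨2 * k, by omega⟩ b = 0 ∧ A' ⟨2 * k + 1, hk⟩ b = 0 := by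
  set K : Fin n := ⟨2 * k, by omega⟩ with hK
  set K' : Fin n := ⟨2 * k + 1, hk⟩ with hK'
  set J : Fin n := ⟨i, hi⟩ with hJ
  have hK'J : K' ≠ J := fun e => by have := Fin.ext_iff.1 e; simp [K', J] at this; omega
  have hKJ : K ≠ J := fun e => by have := Fin.ext_iff.1 e; simp [K, J] at this; omega
  have hKK : K ≠ K' := fun e => by have := Fin.ext_iff.1 e; simp [K, K'] at this
  have hsmall (b : Fin n) (hb : (b : ℕ) < i + 1) (hbJ : b ≠ J) : (b : ℕ) < i := by
    have : (b : ℕ) ≠ i := fun e => hbJ (Fin.ext e)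
    omega
  refine Exec.seq (T₁ := (n + 1) * 700) (T₂ := (n + 1) * 700) ?_ (by omega)
  set x : ℝ := -(A J K / A K' K) with hx
  have hcell1 := h.negI_entry J K
  have hcell2 := h.negI_entry K' K
  simp only [hJ, hK, hK'] at hcell1 hcell2
  refine (Holds.congProgram (p := .var 2) (q := addrOdd) (P := J) (P' := K') (x : ℂ) h
    (by
      simp only [RealExpr.eval, AddrExpr.eval, h.eval_addrEven, h.eval_addrOdd, h.inner, hcell1,
        hcell2, neg_div_neg_eq, Complex.ofReal_re, hx, hJ, hK, hK'])
    (by simp [RealExpr.eval]) h.inner h.eval_addrOdd hK'J.symm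
    (stable_var (by decide)) stable_addrOdd (by simp [AddrExpr.cost])
    (by simp [AddrExpr.cost, addrOdd]) (by simp [RealExpr.cost, AddrExpr.cost, addrEven, addrOdd])
    (by simp [RealExpr.cost])).mono le_rfl ?_
  intro s1 h1
  rw [cong_negI] at h1
  have hI1 := hI.cong (p := J) (q := K') (by simp [J]; omega) (by simp [K']) hK'J.symm x
  have eK (b : Fin n) : cong J K' x A K b = A K b + if b = J then x * A K K' else 0 := by
    rw [cong_apply, if_neg hKJ, if_neg hKJ]
    simp
  have eK' (b : Fin n) : cong J K' x A K' b = A K' b := by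
    rw [cong_apply, if_neg hK'J, if_neg hK'J, hI.diag K']
    simp
  have eKK : cong J K' x A K K' = A K K' := by rw [eK, if_neg hK'J, add_zero]
  have eKJ : cong J K' x A K J = 0 := by
    rw [eK, if_pos rfl, hx, hI.skew J K, hI.skew K' K, neg_div_neg_eq, neg_mul,
      div_mul_cancel₀ _ hp, add_neg_cancel]
  set B := cong J K' x A
  set y : ℝ := -(B J K' / B K K') with hy
  have hcell3 := h1.negI_entry J K'
  have hcell4 := h1.negI_entry K K'
  simp only [hJ, hK, hK'] at hcell3 hcell4
  refine (Holds.congProgram (p := .var 2) (q := addrEven) (P := J) (P' := K) (y : ℂ) h1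
    (by
      simp only [RealExpr.eval, AddrExpr.eval, h1.eval_addrEven, h1.eval_addrOdd, h1.inner, hcell3,
        hcell4, neg_div_neg_eq, Complex.ofReal_re, hy, hJ, hK, hK'])
    (by simp [RealExpr.eval]) h1.inner h1.eval_addrEven hKJ.symm
    (stable_var (by decide)) stable_addrEven (by simp [AddrExpr.cost])
    (by simp [AddrExpr.cost, addrEven]) (by simp [RealExpr.cost, AddrExpr.cost, addrEven, addrOdd])
    (by simp [RealExpr.cost])).mono le_rfl ?_
  intro s2 h2
  rw [cong_negI] at h2
  have fK (b : Fin n) : cong J K y B K b = B K b := by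
    rw [cong_apply, if_neg hKJ, if_neg hKJ, hI1.diag K]
    simp
  have fK' (b : Fin n) : cong J K y B K' b = B K' b + if b = J then y * B K' K else 0 := by
    rw [cong_apply, if_neg hK'J, if_neg hK'J]
    simp
  refine ⟨_, h2, hI1.cong (by simp [J]; omega) (by simp [K]) hKJ.symm y, ?_, fun b hb hb' => ?_⟩
  · rw [fK, eKK]
    exact hp
  · by_cases hbJ : b = J
    · subst hbJ
      rw [fK, eKJ, fK', if_pos rfl, hy, hI1.skew K' K, neg_mul_neg, eKK, div_mul_cancel₀ _ hp,
        hI1.skew K' J]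
      exact ⟨rfl, neg_add_cancel _⟩
    · obtain ⟨h3, h4⟩ := hz b hb (hsmall b hb' hbJ)
      rw [fK, eK, fK', if_neg hbJ, if_neg hbJ, eK', h3, h4]
      simp

lemma exec_pfProgram (h : Holds s m k i r (negI A)) (hA : ∀ a b, A a b = -A b a)
    (hd : A.det ≠ 0) (hn : Even n) :
    Exec pfProgram s ((n + 1) ^ 3 * 2500) fun s' => s'.output = Real.sign (pfaffian A) ∧
      (s'.output = 1 ∨ s'.output = -1) := by
  have hn2 := hn.two_dvd
  have hn1 : n + 1 ≤ (n + 1) ^ 2 := Nat.le_self_pow two_ne_zero _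
  have hn3 : (n + 1) ^ 2 ≤ (n + 1) ^ 3 := Nat.pow_le_pow_right (by omega) (by omega)
  have hsq : (n + 1) * (n + 1) = (n + 1) ^ 2 := (sq _).symm
  have hcu : (n + 1) * (n + 1) ^ 2 = (n + 1) ^ 3 := by ring
  refine Exec.seq (T₁ := (n + 1) * 20) (T₂ := (n + 1) ^ 3 * 2480)
    ((exec_halve hn h).mono le_rfl fun s0 h0 => ?_) (by omega)
  refine Exec.seq (T₁ := 10) (T₂ := (n + 1) ^ 3 * 2470) (Exec.setCell
    (by simp [RealExpr.cost, AddrExpr.cost]) ?_) (by omega)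
  simp only [RealExpr.eval, AddrExpr.eval, Int.cast_one]
  refine Exec.forLoop (N := n / 2) (T := (n + 1) ^ 2 * 2350) (fun k s' => ∃ i r B,
    Holds s' (n / 2) k i r (negI B) ∧ PfInv A k r B) (Nat.zero_le _) ?_ ?_ ?_ ?_ ?_
  · exact ⟨i, 1, A, (h0.setOut 1).setOuter 0, .start hA hd⟩
  · rintro k s' ⟨i, r, B, h1, -⟩
    exact ⟨h1.outer, by simp [AddrExpr.eval, h1.half]⟩
  · rintro k s' - hk ⟨i, r, B, h1, h2⟩
    have hk' : 2 * k + 1 < n := by omega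
    set K : Fin n := ⟨2 * k, by omega⟩ with hK
    set K' : Fin n := ⟨2 * k + 1, hk'⟩ with hK'
    have hlo {s' : Store} {i r} {B : Matrix (Fin n) (Fin n) ℂ} (h1 : Holds s' (n / 2) k i r B) :
        AddrExpr.eval s' (.add addrOdd (.const 1)) = 2 * k + 2 := by
      simp only [AddrExpr.eval, h1.eval_addrOdd]
    refine Exec.seq (T₁ := (n + 1) ^ 2 * 770) (T₂ := (n + 1) ^ 2 * 1580)
      (Exec.forLoop (N := n) (T := (n + 1) * 730) (fun i s' => ∃ B,
        Holds s' (n / 2) k i r (negI B) ∧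
        PfInv A k r B ∧ (B K K' ≠ 0 ∨
          ∀ b : Fin n, 2 * k + 2 ≤ (b : ℕ) → (b : ℕ) < i → B K b = 0))
        (by rw [hlo h1]; omega)
        ⟨B, h1.setInner _, h2, Or.inr fun b hb hb' => by
          rw [hlo h1] at hb'
          omega⟩
        (fun i s' ⟨B, h3, _⟩ => ⟨h3.inner, by simp [AddrExpr.eval, h3.size]⟩)
        (fun i s' hi' hi ⟨B, h3, h4, h5⟩ =>
          (exec_pfPivot hk' hi (by rwa [hlo h1] at hi') h3 h4 h5).mono le_rfl
            fun s'' ⟨B', h6, h7, h8⟩ => ⟨h6.inner, B', h6.setInner _, h7, h8⟩)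
        (Q := fun s' => Exec _ s' _ _) ?_ (by simp only [AddrExpr.cost, addrOdd]; nlinarith))
      (by omega)
    rintro s1 ⟨B1, h3, h4, h5⟩
    have hp : B1 K K' ≠ 0 := by
      rcases h5 with h5 | h5
      · exact h5
      · intro h0
        refine h4.det (Matrix.det_eq_zero_of_row_eq_zero K fun b => ?_)
        rcases Nat.lt_or_ge b (2 * k) with hb | hb
        · rw [h4.skew, h4.block b K hb (by simp only [hK]; omega), neg_zero]
        · rcases Nat.lt_or_ge b (2 * k + 2) with hb' | hb'
          · rcases (show (b : ℕ) = 2 * k ∨ (b : ℕ) = 2 * k + 1 by omega) with e | e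
            · rw [show b = K from Fin.ext e, h4.diag]
            · rw [show b = K' from Fin.ext e, h0]
          · exact h5 b hb' b.2
    refine Exec.seq (T₁ := (n + 1) ^ 2 * 1440) (T₂ := (n + 1) ^ 2 * 100)
      (Exec.forLoop (N := n) (T := (n + 1) * 1400) (fun i s' => ∃ B,
        Holds s' (n / 2) k i r (negI B) ∧
        PfInv A k r B ∧ B K K' ≠ 0 ∧
          ∀ b : Fin n, 2 * k + 2 ≤ (b : ℕ) → (b : ℕ) < i → B K b = 0 ∧ B K' b = 0)
        (by rw [hlo h3]; omega)
        ⟨B1, h3.setInner _, h4, hp, fun b hb hb' => by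
          rw [hlo h3] at hb'
          omega⟩
        (fun i s' ⟨B, h3, _⟩ => ⟨h3.inner, by simp [AddrExpr.eval, h3.size]⟩)
        (fun i s' hi' hi ⟨B, h3', h4, h5, h6⟩ =>
          (exec_pfClear hk' hi (by rwa [hlo h3] at hi') h3' h4 h5 h6).mono le_rfl
            fun s'' ⟨B', h6, h7, h8⟩ => ⟨h6.inner, B', h6.setInner _, h7, h8⟩)
        (Q := fun s' => Exec _ s' _ _) ?_ (by simp only [AddrExpr.cost, addrOdd]; nlinarith))
      (by omega)
    rintro s2 ⟨B2, h6, h7, h8, h9⟩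
    have hblock : ∀ a b : Fin n, (a : ℕ) < 2 * (k + 1) → (a : ℕ) / 2 ≠ b / 2 → B2 a b = 0 := by
      intro a b ha hab
      rcases Nat.lt_or_ge a (2 * k) with ha' | ha'
      · exact h7.block a b ha' hab
      rcases Nat.lt_or_ge b (2 * k) with hb | hb
      · rw [h7.skew, h7.block b a hb hab.symm, neg_zero]
      · have hb' : 2 * k + 2 ≤ (b : ℕ) := by omega
        rcases (show (a : ℕ) = 2 * k ∨ (a : ℕ) = 2 * k + 1 by omega) with e | e
        · rw [show a = K from Fin.ext e]
          exact (h9 b hb' b.2).1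
        · rw [show a = K' from Fin.ext e]
          exact (h9 b hb' b.2).2
    have hcell := h6.negI_entry K K'
    simp only [hK, hK'] at hcell
    refine (exec_mulSign (x := B2 K K') h6 ?_ h8 ?_).mono (by omega) fun s3 h10 => ⟨h10.outer, _, _,
      B2, h10.setOuter _, h7.skew, h7.det, h7.pf, hblock, ?_, ?_⟩
    · simp [Test.Holds, RealExpr.eval, h6.eval_addrEven, h6.eval_addrOdd, hcell, hK, hK']
    · simp [Test.cost, RealExpr.cost, AddrExpr.cost, addrEven, addrOdd]
    · rw [prod_sign_succ hk (fun l => B2 (evenIdx l) (oddIdx l)), h7.out]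
      rfl
    · rcases h7.unit with hr | hr <;> rcases h8.lt_or_gt with h11 | h11 <;>
      simp [hr, Real.sign_of_neg, Real.sign_of_pos, h11]
  · rintro s' ⟨i, r, B, h1, h2⟩
    have hB : B = skewBlock fun l => B (evenIdx l) (oddIdx l) := by
      ext a b
      by_cases hab : (a : ℕ) / 2 = b / 2
      · simp only [skewBlock, Matrix.of_apply]
        split_ifs with h3 h4
        · congr 1 <;> simp only [evenIdx, oddIdx, Fin.ext_iff] <;> omega
        · rw [h2.skew a b]
          congr 2 <;> simp only [evenIdx, oddIdx, Fin.ext_iff] <;> omega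
        · rw [show a = b from Fin.ext (by omega), h2.diag]
      · rw [h2.block a b (by omega) hab]
        simp only [skewBlock, Matrix.of_apply]
        rw [dif_neg (by omega), dif_neg (by omega)]
    have hout : s'.output = r := h1.out
    rw [hout]
    refine ⟨?_, h2.unit⟩
    rw [h2.out, ← h2.pf]
    conv_rhs => rw [hB]
    rw [sign_pfaffian_skewBlock hn]
    simp
  · simp only [AddrExpr.cost]
    refine Nat.le_trans (Nat.add_le_add_right (Nat.add_le_add_right (Nat.mul_le_mul_right _
      (show n / 2 + 1 ≤ n + 1 by omega)) _) _) ?_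
    nlinarith

end pfaffianProgram

/-! ### Computing the sign of the determinant of the off-diagonal block -/

section blockProgram
variable {n : ℕ}

/-- The indices `j` of the first half. -/
def lowIdx (j : Fin (n / 2)) : Fin n := ⟨j, by omega⟩

/-- The indices `n / 2 + j` of the second half. -/
def highIdx (j : Fin (n / 2)) : Fin n := ⟨n / 2 + j, by omega⟩

/-- The upper right block of a real matrix. -/
def block (A : Matrix (Fin n) (Fin n) ℝ) : Matrix (Fin (n / 2)) (Fin (n / 2)) ℝ :=
  A.submatrix lowIdx highIdx

lemma lowIdx_inj {a b : Fin (n / 2)} : lowIdx a = lowIdx b ↔ a = b := by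
  simp [lowIdx, Fin.ext_iff]

lemma highIdx_inj {a b : Fin (n / 2)} : highIdx a = highIdx b ↔ a = b := by
  simp [highIdx, Fin.ext_iff]

lemma lowIdx_ne_highIdx (a b : Fin (n / 2)) : lowIdx a ≠ highIdx b := by
  simp only [lowIdx, highIdx, ne_eq, Fin.ext_iff]
  omega

lemma cong_map_ofReal (A : Matrix (Fin n) (Fin n) ℝ) (p q : Fin n) (c : ℝ) :
    cong p q (c : ℂ) (A.map Complex.ofReal) = (cong p q c A).map Complex.ofReal := by
  ext a b
  simp only [cong_apply, Matrix.map_apply]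
  split_ifs <;> simp

lemma block_cong_low (A : Matrix (Fin n) (Fin n) ℝ) (p q : Fin (n / 2)) (c : ℝ) :
    block (cong (lowIdx p) (lowIdx q) c A) = transvection p q c * block A := by
  ext a b
  simp only [block, Matrix.submatrix_apply, cong_apply, lowIdx_inj,
    if_neg (lowIdx_ne_highIdx _ _).symm, add_zero]
  by_cases h : a = p
  · simp [h]
  · simp [h]

lemma block_cong_high (A : Matrix (Fin n) (Fin n) ℝ) (p q : Fin (n / 2)) (c : ℝ) :
    block (cong (highIdx p) (highIdx q) c A) = block A * transvection q p c := by
  ext a b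
  simp only [block, Matrix.submatrix_apply, cong_apply, highIdx_inj,
    if_neg (lowIdx_ne_highIdx _ _), add_zero]
  by_cases h : b = p
  · simp [h]
  · simp [h]

/-- The state of the elimination before round `k`: the first `k` rows and columns of `C` are
diagonal, and `r` is the product of the signs of their diagonal entries. -/
structure DetInv {m : ℕ} (C₀ : Matrix (Fin m) (Fin m) ℝ) (k : ℕ) (r : ℝ)
    (C : Matrix (Fin m) (Fin m) ℝ) : Prop where
  det : C.det = C₀.det
  diag : ∀ a b : Fin m, a ≠ b → (a : ℕ) < k ∨ (b : ℕ) < k → C a b = 0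
  out : r = ∏ l : Fin m, if (l : ℕ) < k then Real.sign (C l l) else 1

lemma DetInv.row {m k : ℕ} {r : ℝ} {C C₀ : Matrix (Fin m) (Fin m) ℝ} (h : DetInv C₀ k r C)
    {p q : Fin m} (hp : k ≤ p) (hq : k ≤ q) (hpq : p ≠ q) (c : ℝ) :
    DetInv C₀ k r (transvection p q c * C) := by
  have e (a b : Fin m) (hab : (a : ℕ) < k ∨ (b : ℕ) < k) :
      (transvection p q c * C) a b = C a b := by
    by_cases ha : a = p
    · subst ha
      rw [Matrix.transvection_mul_apply_same, h.diag q b (fun e => by subst e; omega) (by omega)]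
      simp
    · rw [Matrix.transvection_mul_apply_of_ne _ _ _ _ ha]
  refine ⟨by rw [det_mul, det_transvection_of_ne _ _ hpq, one_mul, h.det],
    fun a b hab hk => by rw [e a b hk, h.diag a b hab hk], ?_⟩
  rw [h.out]
  refine Finset.prod_congr rfl fun l _ => ?_
  split_ifs with hl
  · rw [e l l (Or.inl hl)]
  · rfl

lemma DetInv.col {m k : ℕ} {r : ℝ} {C C₀ : Matrix (Fin m) (Fin m) ℝ} (h : DetInv C₀ k r C)
    {p q : Fin m} (hp : k ≤ p) (hq : k ≤ q) (hpq : p ≠ q) (c : ℝ) :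
    DetInv C₀ k r (C * transvection q p c) := by
  have e (a b : Fin m) (hab : (a : ℕ) < k ∨ (b : ℕ) < k) :
      (C * transvection q p c) a b = C a b := by
    by_cases ha : b = p
    · subst ha
      rw [Matrix.mul_transvection_apply_same, h.diag a q (fun e => by subst e; omega) (by omega)]
      simp
    · rw [Matrix.mul_transvection_apply_of_ne _ _ _ _ ha]
  refine ⟨by rw [det_mul, det_transvection_of_ne _ _ hpq.symm, mul_one, h.det],
    fun a b hab hk => by rw [e a b hk, h.diag a b hab hk], ?_⟩
  rw [h.out]
  refine Finset.prod_congr rfl fun l _ => ?_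
  split_ifs with hl
  · rw [e l l (Or.inl hl)]
  · rfl

/-- The address `n / 2 + k`. -/
def addrHighOuter : AddrExpr := .add (.var 4) (.var 1)

/-- The address `n / 2 + i`. -/
def addrHighInner : AddrExpr := .add (.var 4) (.var 2)

/-- If the pivot `(k, k)` of the block vanishes, add row `i` to row `k`. -/
def detPivot : Program :=
  .ite (.realEq (.cell 0 (.var 1) addrHighOuter) (.const 0))
    (congProgram (.var 1) (.var 2) (.const 1) (.const 0)) .skip

/-- Clear the entries `(i, k)` and `(k, i)` of the block. -/
def detClear : Program :=
  .seq (congProgram (.var 2) (.var 1)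
      (.neg (.div (.cell 0 (.var 2) addrHighOuter) (.cell 0 (.var 1) addrHighOuter))) (.const 0))
    (congProgram addrHighInner addrHighOuter
      (.neg (.div (.cell 0 (.var 1) addrHighInner) (.cell 0 (.var 1) addrHighOuter))) (.const 0))

/-- The sign of the determinant of the upper right block of a real symmetric matrix, by Gaussian
elimination. -/
def detProgram : Program :=
  .seq halve <| .seq (.setCell 2 (.const 0) (.const 0) (.const 1)) <|
  forLoop 1 (.const 0) (.var 4) <|
    .seq (forLoop 2 (.add (.var 1) (.const 1)) (.var 4) detPivot) <|
    .seq (forLoop 2 (.add (.var 1) (.const 1)) (.var 4) detClear) <|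
    mulSign (.realLt (.const 0) (.cell 0 (.var 1) addrHighOuter))

lemma stable_addrHighOuter : Stable addrHighOuter :=
  stable_add (stable_var (by decide)) (stable_var (by decide))

lemma stable_addrHighInner : Stable addrHighInner :=
  stable_add (stable_var (by decide)) (stable_var (by decide))

variable {k i : ℕ} {r : ℝ} {A : Matrix (Fin n) (Fin n) ℝ} {s : Store}
  {C₀ : Matrix (Fin (n / 2)) (Fin (n / 2)) ℝ}

lemma Holds.eval_addrHighOuter {m : ℕ} {A : Matrix (Fin n) (Fin n) ℂ} (h : Holds s m k i r A) :
    addrHighOuter.eval s = m + k := by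
  simp only [addrHighOuter, AddrExpr.eval, h.outer, h.half]

lemma Holds.eval_addrHighInner {m : ℕ} {A : Matrix (Fin n) (Fin n) ℂ} (h : Holds s m k i r A) :
    addrHighInner.eval s = m + i := by
  simp only [addrHighInner, AddrExpr.eval, h.inner, h.half]

lemma Holds.block_entry {m : ℕ} (h : Holds s m k i r (A.map Complex.ofReal))
    (a b : Fin (n / 2)) : s.cell 0 a (n / 2 + b) = block A a b :=
  h.re (lowIdx a) (highIdx b)

/-- As for the signature: either the pivot is nonzero or column `k` vanishes down to row `i`. -/
lemma exec_detPivot (hk : k < n / 2) (hi : i < n / 2) (hki : k < i)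
    (h : Holds s (n / 2) k i r (A.map Complex.ofReal)) (hI : DetInv C₀ k r (block A))
    (hz : block A ⟨k, hk⟩ ⟨k, hk⟩ ≠ 0 ∨
      ∀ a : Fin (n / 2), k < (a : ℕ) → (a : ℕ) < i → block A a ⟨k, hk⟩ = 0) :
    Exec detPivot s ((n + 1) * 730) fun s' => ∃ A' : Matrix (Fin n) (Fin n) ℝ,
      Holds s' (n / 2) k i r (A'.map Complex.ofReal) ∧ DetInv C₀ k r (block A') ∧
      (block A' ⟨k, hk⟩ ⟨k, hk⟩ ≠ 0 ∨
        ∀ a : Fin (n / 2), k < (a : ℕ) → (a : ℕ) < i + 1 → block A' a ⟨k, hk⟩ = 0) := by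
  set K : Fin (n / 2) := ⟨k, hk⟩ with hK
  set J : Fin (n / 2) := ⟨i, hi⟩ with hJ
  have hKJ : K ≠ J := fun e => hki.ne (Fin.ext_iff.1 e)
  have hcell := h.block_entry K K
  simp only [hK] at hcell
  refine Exec.ite (T₁ := (n + 1) * 700) (fun ht => ?_) (fun ht => ?_) (by
    simp only [Test.cost, RealExpr.cost, AddrExpr.cost, addrHighOuter]; omega)
  · have h0 : block A K K = 0 := by
      simpa [Test.Holds, RealExpr.eval, AddrExpr.eval, h.eval_addrHighOuter, h.outer, hcell]
        using ht
    refine (Holds.congProgram (p := .var 1) (q := .var 2) (P := lowIdx K) (P' := lowIdx J)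
      ((1 : ℝ) : ℂ) h (by simp [RealExpr.eval]) (by simp [RealExpr.eval]) h.outer h.inner
      (fun e => hKJ (lowIdx_inj.1 e)) (stable_var (by decide)) (stable_var (by decide))
      (by simp [AddrExpr.cost]) (by simp [AddrExpr.cost]) (by simp [RealExpr.cost])
      (by simp [RealExpr.cost])).mono le_rfl ?_
    intro s' h'
    rw [cong_map_ofReal] at h'
    refine ⟨_, h', ?_⟩
    rw [block_cong_low]
    refine ⟨hI.row le_rfl hki.le hKJ 1, ?_⟩
    by_cases hJ0 : block A J K = 0
    · right
      intro a ha ha'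
      have haK : a ≠ K := fun e => by rw [e] at ha; simp [hK] at ha
      rw [Matrix.transvection_mul_apply_of_ne _ _ _ _ haK]
      by_cases hai : a = J
      · rw [hai, hJ0]
      · have : (a : ℕ) ≠ i := fun e => hai (Fin.ext e)
        exact (hz.resolve_left (not_not.2 h0)) a ha (by omega)
    · left
      rw [Matrix.transvection_mul_apply_same, h0]
      simpa using hJ0
  · have h0 : block A K K ≠ 0 := by
      simpa [Test.Holds, RealExpr.eval, AddrExpr.eval, h.eval_addrHighOuter, h.outer, hcell]
        using ht
    exact Exec.skip (by omega) ⟨A, h, hI, Or.inl h0⟩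

lemma exec_detClear (hk : k < n / 2) (hi : i < n / 2) (hki : k < i)
    (h : Holds s (n / 2) k i r (A.map Complex.ofReal)) (hI : DetInv C₀ k r (block A))
    (hp : block A ⟨k, hk⟩ ⟨k, hk⟩ ≠ 0)
    (hz : ∀ a : Fin (n / 2), k < (a : ℕ) → (a : ℕ) < i →
      block A a ⟨k, hk⟩ = 0 ∧ block A ⟨k, hk⟩ a = 0) :
    Exec detClear s ((n + 1) * 1400) fun s' => ∃ A' : Matrix (Fin n) (Fin n) ℝ,
      Holds s' (n / 2) k i r (A'.map Complex.ofReal) ∧ DetInv C₀ k r (block A') ∧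
      block A' ⟨k, hk⟩ ⟨k, hk⟩ ≠ 0 ∧
        ∀ a : Fin (n / 2), k < (a : ℕ) → (a : ℕ) < i + 1 →
          block A' a ⟨k, hk⟩ = 0 ∧ block A' ⟨k, hk⟩ a = 0 := by
  set K : Fin (n / 2) := ⟨k, hk⟩ with hK
  set J : Fin (n / 2) := ⟨i, hi⟩ with hJ
  have hKJ : K ≠ J := fun e => hki.ne (Fin.ext_iff.1 e)
  refine Exec.seq (T₁ := (n + 1) * 700) (T₂ := (n + 1) * 700) ?_ (by omega)
  set x : ℝ := -(block A J K / block A K K) with hx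
  have hcell1 := h.block_entry J K
  have hcell2 := h.block_entry K K
  simp only [hJ, hK] at hcell1 hcell2
  refine (Holds.congProgram (p := .var 2) (q := .var 1) (P := lowIdx J) (P' := lowIdx K) (x : ℂ) h
    (by
      simp only [RealExpr.eval, AddrExpr.eval, h.eval_addrHighOuter, h.inner, h.outer, hcell1,
        hcell2, Complex.ofReal_re, hx, hJ, hK])
    (by simp [RealExpr.eval]) h.inner h.outer (fun e => hKJ (lowIdx_inj.1 e).symm)
    (stable_var (by decide)) (stable_var (by decide)) (by simp [AddrExpr.cost])
    (by simp [AddrExpr.cost]) (by simp [RealExpr.cost, AddrExpr.cost, addrHighOuter])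
    (by simp [RealExpr.cost])).mono le_rfl ?_
  intro s1 h1
  rw [cong_map_ofReal] at h1
  have hB := block_cong_low A J K x
  set B := cong (lowIdx J) (lowIdx K) x A
  have hI1 := hI.row (p := J) (q := K) hki.le le_rfl hKJ.symm x
  rw [← hB] at hI1
  have eJ (b : Fin (n / 2)) : block B J b = block A J b + x * block A K b := by
    rw [hB, Matrix.transvection_mul_apply_same]
  have eo (a b : Fin (n / 2)) (ha : a ≠ J) : block B a b = block A a b := by
    rw [hB, Matrix.transvection_mul_apply_of_ne _ _ _ _ ha]
  have eJK : block B J K = 0 := by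
    rw [eJ, hx, neg_mul, div_mul_cancel₀ _ hp, add_neg_cancel]
  set y : ℝ := -(block B K J / block B K K) with hy
  have hcell3 := h1.block_entry K J
  have hcell4 := h1.block_entry K K
  simp only [hJ, hK] at hcell3 hcell4
  refine (Holds.congProgram (p := addrHighInner) (q := addrHighOuter) (P := highIdx J)
    (P' := highIdx K) (y : ℂ) h1
    (by
      simp only [RealExpr.eval, AddrExpr.eval, h1.eval_addrHighOuter, h1.eval_addrHighInner,
        h1.outer, hcell3, hcell4, Complex.ofReal_re, hy, hJ, hK])
    (by simp [RealExpr.eval]) h1.eval_addrHighInner h1.eval_addrHighOuter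
    (fun e => hKJ (highIdx_inj.1 e).symm) stable_addrHighInner stable_addrHighOuter
    (by simp [AddrExpr.cost, addrHighInner]) (by simp [AddrExpr.cost, addrHighOuter])
    (by simp [RealExpr.cost, AddrExpr.cost, addrHighOuter, addrHighInner])
    (by simp [RealExpr.cost])).mono le_rfl ?_
  intro s2 h2
  rw [cong_map_ofReal] at h2
  refine ⟨_, h2, ?_⟩
  rw [block_cong_high]
  have fJ (a : Fin (n / 2)) :
      (block B * transvection K J y) a J = block B a J + y * block B a K := by
    rw [Matrix.mul_transvection_apply_same]
  have fo (a b : Fin (n / 2)) (hb : b ≠ J) :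
      (block B * transvection K J y) a b = block B a b := by
    rw [Matrix.mul_transvection_apply_of_ne _ _ _ _ hb]
  have eKK : block B K K = block A K K := eo K K hKJ
  refine ⟨hI1.col hki.le le_rfl hKJ.symm y, ?_, fun a ha ha' => ?_⟩
  · rw [fo K K hKJ, eKK]
    exact hp
  · by_cases haJ : a = J
    · rw [haJ, fo J K hKJ, eJK, fJ, hy, neg_mul, div_mul_cancel₀ _ (by rwa [eKK])]
      exact ⟨rfl, add_neg_cancel _⟩
    · have : (a : ℕ) ≠ i := fun e => haJ (Fin.ext e)
      rw [fo a K hKJ, fo K a haJ, eo a K haJ, eo K a hKJ]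
      exact hz a ha (by omega)

lemma exec_detProgram {m : ℕ} (h : Holds s m k i r (A.map Complex.ofReal))
    (hd : (block A).det ≠ 0) (hn : Even n) :
    Exec detProgram s ((n + 1) ^ 3 * 2500) fun s' => s'.output = Real.sign (block A).det := by
  have hn2 := hn.two_dvd
  have hn1 : n + 1 ≤ (n + 1) ^ 2 := Nat.le_self_pow two_ne_zero _
  have hn3 : (n + 1) ^ 2 ≤ (n + 1) ^ 3 := Nat.pow_le_pow_right (by omega) (by omega)
  have hsq : (n + 1) * (n + 1) = (n + 1) ^ 2 := (sq _).symm
  have hcu : (n + 1) * (n + 1) ^ 2 = (n + 1) ^ 3 := by ring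
  have hhalf (T : ℕ) : (n / 2 + 1) * T ≤ (n + 1) * T := Nat.mul_le_mul_right _ (by omega)
  refine Exec.seq (T₁ := (n + 1) * 20) (T₂ := (n + 1) ^ 3 * 2480)
    ((exec_halve hn h).mono le_rfl fun s0 h0 => ?_) (by omega)
  refine Exec.seq (T₁ := 10) (T₂ := (n + 1) ^ 3 * 2470) (Exec.setCell
    (by simp [RealExpr.cost, AddrExpr.cost]) ?_) (by omega)
  simp only [RealExpr.eval, AddrExpr.eval, Int.cast_one]
  refine Exec.forLoop (N := n / 2) (T := (n + 1) ^ 2 * 2350) (fun k s' => ∃ i r,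
    ∃ B : Matrix (Fin n) (Fin n) ℝ, Holds s' (n / 2) k i r (B.map Complex.ofReal) ∧
      DetInv (block A) k r (block B)) (Nat.zero_le _) ?_ ?_ ?_ ?_ ?_
  · exact ⟨i, 1, A, (h0.setOut 1).setOuter 0, rfl,
      fun _ _ _ h => (h.elim (Nat.not_lt_zero _) (Nat.not_lt_zero _)).elim, by simp [AddrExpr.eval]⟩
  · rintro k s' ⟨i, r, B, h1, -⟩
    exact ⟨h1.outer, by simp [AddrExpr.eval, h1.half]⟩
  · rintro k s' - hk ⟨i, r, B, h1, h2⟩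
    set K : Fin (n / 2) := ⟨k, hk⟩ with hK
    have hlo {s' : Store} {i r} {B : Matrix (Fin n) (Fin n) ℂ} (h1 : Holds s' (n / 2) k i r B) :
        AddrExpr.eval s' (.add (.var 1) (.const 1)) = k + 1 := by
      simp only [AddrExpr.eval, h1.outer]
    refine Exec.seq (T₁ := (n + 1) ^ 2 * 770) (T₂ := (n + 1) ^ 2 * 1580)
      (Exec.forLoop (N := n / 2) (T := (n + 1) * 730) (fun i s' => ∃ B : Matrix (Fin n) (Fin n) ℝ,
        Holds s' (n / 2) k i r (B.map Complex.ofReal) ∧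
        DetInv (block A) k r (block B) ∧ (block B K K ≠ 0 ∨
          ∀ a : Fin (n / 2), k < (a : ℕ) → (a : ℕ) < i → block B a K = 0))
        (by rw [hlo h1]; omega)
        ⟨B, h1.setInner _, h2, Or.inr fun b hb hb' => by
          rw [hlo h1] at hb'
          omega⟩
        (fun i s' ⟨B, h3, _⟩ => ⟨h3.inner, by simp [AddrExpr.eval, h3.half]⟩)
        (fun i s' hi' hi ⟨B, h3, h4, h5⟩ =>
          (exec_detPivot hk hi (by rwa [hlo h1] at hi') h3 h4 h5).mono le_rfl
            fun s'' ⟨B', h6, h7, h8⟩ => ⟨h6.inner, B', h6.setInner _, h7, h8⟩)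
        (Q := fun s' => Exec _ s' _ _) ?_ (by
          simp only [AddrExpr.cost]
          have := hhalf ((n + 1) * 730 + 1 + 7)
          nlinarith))
      (by omega)
    rintro s1 ⟨B1, h3, h4, h5⟩
    have hp : block B1 K K ≠ 0 := by
      rcases h5 with h5 | h5
      · exact h5
      · intro h0
        refine hd (h4.det.symm.trans (Matrix.det_eq_zero_of_column_eq_zero K fun a => ?_))
        rcases Nat.lt_trichotomy a k with ha | ha | ha
        · exact h4.diag a K (fun e => by rw [e] at ha; exact lt_irrefl _ ha) (Or.inl ha)
        · rw [show a = K from Fin.ext ha, h0]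
        · exact h5 a ha a.2
    refine Exec.seq (T₁ := (n + 1) ^ 2 * 1440) (T₂ := (n + 1) ^ 2 * 100)
      (Exec.forLoop (N := n / 2) (T := (n + 1) * 1400) (fun i s' => ∃ B : Matrix (Fin n) (Fin n) ℝ,
        Holds s' (n / 2) k i r (B.map Complex.ofReal) ∧
        DetInv (block A) k r (block B) ∧ block B K K ≠ 0 ∧
          ∀ a : Fin (n / 2), k < (a : ℕ) → (a : ℕ) < i → block B a K = 0 ∧ block B K a = 0)
        (by rw [hlo h3]; omega)
        ⟨B1, h3.setInner _, h4, hp, fun b hb hb' => by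
          rw [hlo h3] at hb'
          omega⟩
        (fun i s' ⟨B, h3, _⟩ => ⟨h3.inner, by simp [AddrExpr.eval, h3.half]⟩)
        (fun i s' hi' hi ⟨B, h3', h4, h5, h6⟩ =>
          (exec_detClear hk hi (by rwa [hlo h3] at hi') h3' h4 h5 h6).mono le_rfl
            fun s'' ⟨B', h6, h7, h8⟩ => ⟨h6.inner, B', h6.setInner _, h7, h8⟩)
        (Q := fun s' => Exec _ s' _ _) ?_ (by
          simp only [AddrExpr.cost]
          have := hhalf ((n + 1) * 1400 + 1 + 7)
          nlinarith))
      (by omega)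
    rintro s2 ⟨B2, h6, h7, h8, h9⟩
    have hcell := h6.block_entry K K
    simp only [hK] at hcell
    refine (exec_mulSign (x := block B2 K K) h6 ?_ h8 ?_).mono (by omega) fun s3 h10 =>
      ⟨h10.outer, _, _, B2, h10.setOuter _, h7.det, fun a b hab hk' => ?_, ?_⟩
    · simp [Test.Holds, RealExpr.eval, AddrExpr.eval, h6.eval_addrHighOuter, h6.outer, hcell, hK]
    · simp [Test.cost, RealExpr.cost, AddrExpr.cost, addrHighOuter]
    · by_cases h11 : (a : ℕ) < k ∨ (b : ℕ) < k
      · exact h7.diag a b hab h11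
      · rcases (show ((a : ℕ) = k ∧ k < b) ∨ ((b : ℕ) = k ∧ k < a) by
          have : (a : ℕ) ≠ b := fun e => hab (Fin.ext e)
          omega) with ⟨e, h12⟩ | ⟨e, h12⟩
        · rw [show a = K from Fin.ext e]
          exact (h9 b h12 b.2).2
        · rw [show b = K from Fin.ext e]
          exact (h9 a h12 a.2).1
    · rw [prod_sign_succ hk (fun l => block B2 l l), h7.out]
  · rintro s' ⟨i, r, B, h1, h2⟩
    have hB : block B = Matrix.diagonal fun l => block B l l := by
      ext a b
      by_cases hab : a = b
      · simp [hab]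
      · rw [h2.diag a b hab (Or.inl a.2), Matrix.diagonal_apply_ne _ hab]
    have hout : s'.output = r := h1.out
    rw [hout, h2.out, ← h2.det]
    conv_rhs => rw [hB, Matrix.det_diagonal]
    rw [sign_prod]
    simp
  · simp only [AddrExpr.cost]
    have := hhalf ((n + 1) ^ 2 * 2350 + 1 + 7)
    nlinarith

end blockProgram

/-! ### The matrix of an operator in an orthonormal basis -/

section matrixIn
variable {n : ℕ} (b : OrthonormalBasis (Fin n) ℂ (Hilb n)) {H : Matrix (Fin n) (Fin n) ℂ}

lemma matrixIn_apply (H : Matrix (Fin n) (Fin n) ℂ) (j k : Fin n) :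
    matrixIn b H j k = inner ℂ (b j) (toEuclideanLin H (b k)) := rfl

lemma matrixIn_eq_toMatrix (H : Matrix (Fin n) (Fin n) ℂ) :
    matrixIn b H = LinearMap.toMatrix b.toBasis b.toBasis (toEuclideanLin H) := by
  ext j k
  simp [LinearMap.toMatrix_apply, matrixIn_apply, b.repr_apply_apply]

lemma matrixIn_mul (A B : Matrix (Fin n) (Fin n) ℂ) :
    matrixIn b (A * B) = matrixIn b A * matrixIn b B := by
  simp only [matrixIn_eq_toMatrix, ← LinearMap.toMatrix_comp]
  congr 1
  exact LinearMap.ext fun v => toLin_mul A B v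

lemma matrixIn_one : matrixIn b 1 = 1 := by
  ext j k
  rw [matrixIn_apply, toLin_one, orthonormal_iff_ite.1 b.orthonormal, Matrix.one_apply]

lemma matrixIn_conjTranspose (H : Matrix (Fin n) (Fin n) ℂ) :
    matrixIn b Hᴴ = (matrixIn b H)ᴴ := by
  ext j k
  rw [conjTranspose_apply, matrixIn_apply, matrixIn_apply, ← inner_toLin_left, ← inner_conj_symm]
  rfl

lemma isHermitian_matrixIn (hH : H.IsHermitian) : (matrixIn b H).IsHermitian := by
  rw [Matrix.IsHermitian, ← matrixIn_conjTranspose, hH.eq]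

lemma isUnit_matrixIn (hH : IsUnit H) : IsUnit (matrixIn b H) := by
  obtain ⟨B, hB⟩ := hH.exists_left_inv
  exact IsUnit.of_mul_eq_one_right (matrixIn b B) (by rw [← matrixIn_mul, hB, matrixIn_one])

lemma charpoly_matrixIn (H : Matrix (Fin n) (Fin n) ℂ) : (matrixIn b H).charpoly = H.charpoly := by
  rw [matrixIn_eq_toMatrix, LinearMap.charpoly_toMatrix, toEuclideanLin,
    Matrix.toLpLin_eq_toLin, Matrix.charpoly_toLin]

lemma signature_matrixIn (hH : H.IsHermitian) : signature (matrixIn b H) = signature H := by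
  have h := (signature_eq_roots (isHermitian_matrixIn b hH)).trans
    ((congrArg (fun p => (p.roots.map fun z => Real.sign z.re).sum) (charpoly_matrixIn b H)).trans
      (signature_eq_roots hH).symm)
  exact_mod_cast h

lemma continuous_matrixIn : Continuous (matrixIn b) := by
  refine continuous_matrix fun j k => ?_
  refine LinearMap.continuous_of_finiteDimensional (𝕜 := ℂ)
    (((innerₛₗ ℂ (b j)).comp (LinearMap.applyₗ (b k))).comp
      (toEuclideanLin (𝕜 := ℂ) (m := Fin n) (n := Fin n)).toLinearMap)

end matrixIn

/-! ### Existence of adapted bases -/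

section adaptedBasis
variable {n : ℕ}

/-- The subspace of the vectors orthogonal to a finite family. -/
def orthoFamily {k : ℕ} (e : Fin k → Hilb n) : Submodule ℂ (Hilb n) :=
  LinearMap.ker (LinearMap.pi fun i => innerₛₗ ℂ (e i))

lemma mem_orthoFamily {k : ℕ} {e : Fin k → Hilb n} {v : Hilb n} :
    v ∈ orthoFamily e ↔ ∀ i, inner ℂ (e i) v = 0 := by
  simp [orthoFamily, funext_iff]

lemma exists_mem_orthoFamily {k : ℕ} (e : Fin k → Hilb n) (hk : k < n) :
    ∃ v ∈ orthoFamily e, v ≠ 0 :=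
  (Submodule.ne_bot_iff _).1 (LinearMap.ker_ne_bot_of_finrank_lt (by simpa using hk))

/-- An orthonormal basis of vectors with a property can be found one vector at a time. -/
lemma exists_orthonormalBasis (p : Hilb n → Prop)
    (h : ∀ (k : ℕ) (e : Fin k → Hilb n), (∀ i, p (e i)) → k < n →
      ∃ v ∈ orthoFamily e, ‖v‖ = 1 ∧ p v) :
    ∃ b : OrthonormalBasis (Fin n) ℂ (Hilb n), ∀ j, p (b j) := by
  have main (k : ℕ) : k ≤ n → ∃ e : Fin k → Hilb n, Orthonormal ℂ e ∧ ∀ i, p (e i) := by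
    induction k with
    | zero => exact fun _ => ⟨Fin.elim0, ⟨fun i => i.elim0, fun i => i.elim0⟩, fun i => i.elim0⟩
    | succ k ih =>
      intro hk
      obtain ⟨e, he, hp⟩ := ih (by omega)
      obtain ⟨v, hv, hv1, hpv⟩ := h k e hp (by omega)
      rw [mem_orthoFamily] at hv
      have hv' (i : Fin k) : inner ℂ v (e i) = 0 := by rw [← inner_conj_symm, hv, map_zero]
      refine ⟨Fin.cons v e, ?_, fun i => ?_⟩
      · rw [orthonormal_iff_ite] at he ⊢
        intro i j
        refine Fin.cases ?_ (fun i => ?_) i <;> refine Fin.cases ?_ (fun j => ?_) j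
        · simp [inner_self_eq_norm_sq_to_K, hv1]
        · simp [hv', (Fin.succ_ne_zero j).symm]
        · simp [hv]
        · simp [he]
      · exact Fin.cases hpv hp i
  obtain ⟨e, he, hp⟩ := main n le_rfl
  obtain ⟨b, hb⟩ := Orthonormal.exists_orthonormalBasis_extension_of_card_eq (𝕜 := ℂ)
    (E := Hilb n) (by simp) (v := e) (s := Set.univ)
    (he.comp (fun i : (Set.univ : Set (Fin n)) => (i : Fin n)) Subtype.val_injective)
  exact ⟨b, fun j => by rw [hb j trivial]; exact hp j⟩

lemma exists_adapted_D (P : AntiUnitary n) (hP : ∀ v, P (P v) = v) :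
    ∃ b, (AZSymmetry.D P hP).Adapted b := by
  refine exists_orthonormalBasis (fun v => P v = v) fun k e he hk => ?_
  refine exists_real_unit P hP (fun v hv => ?_) (exists_mem_orthoFamily e hk)
  rw [mem_orthoFamily] at hv ⊢
  exact fun i => inner_anti_left P (he i) (hv i)

/-- The chiral symmetry anticommutes with an invertible matrix, hence is traceless; this is the
equality of the numbers of vectors with `S = 1` and `S = -1`. -/
lemma card_filter_eq_half {ε : Fin n → ℝ}
    (hε : ∀ j, ε j = 1 ∨ ε j = -1) {M : Matrix (Fin n) (Fin n) ℂ} (hM : IsUnit M)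
    (h : ∀ j k, (ε j : ℂ) * M j k = -(M j k * ε k)) :
    2 * (Finset.univ.filter fun j => ε j = 1).card = n := by
  set E : Matrix (Fin n) (Fin n) ℂ := Matrix.diagonal fun j => (ε j : ℂ)
  have hEM : E * M = -(M * E) := by
    ext j k
    rw [Matrix.diagonal_mul, Matrix.neg_apply, Matrix.mul_diagonal, h]
  obtain ⟨B, hB⟩ := hM.exists_right_inv
  have htr : E.trace = 0 := by
    have h1 : E.trace = -E.trace := by
      calc E.trace = (E * (M * B)).trace := by rw [hB, mul_one]
        _ = -((M * E) * B).trace := by rw [← mul_assoc, hEM, neg_mul, Matrix.trace_neg]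
        _ = -E.trace := by
          rw [Matrix.trace_mul_comm, ← mul_assoc, mul_eq_one_comm.1 hB, one_mul]
    exact self_eq_neg.1 h1
  have h2 : ∑ j, ε j = 0 := by
    have : ((∑ j, ε j : ℝ) : ℂ) = 0 := by
      rw [← htr, Matrix.trace]
      simp [E]
    exact_mod_cast this
  have h3 (j : Fin n) : ε j = 2 * (if ε j = 1 then 1 else 0) - 1 := by
    rcases hε j with h | h <;> rw [h] <;> norm_num
  rw [Finset.sum_congr rfl fun j _ => h3 j, Finset.sum_sub_distrib, ← Finset.mul_sum,
    Finset.sum_boole] at h2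
  simp only [Finset.sum_const, Finset.card_univ, Fintype.card_fin, nsmul_eq_mul, mul_one] at h2
  have : (2 * ((Finset.univ.filter fun j => ε j = 1).card : ℝ)) = n := by linarith
  exact_mod_cast this

/-- The chiral symmetry in class `BDI` preserves inner products. -/
lemma inner_chiral (T P : AntiUnitary n) (v w : Hilb n) :
    inner ℂ (T (P v)) (T (P w)) = inner ℂ v w := by
  rw [anti_inner, anti_inner]

/-- A `T`-real vector `w` orthogonal to the family yields the next basis vector: `w + S w`,
normalized, or `w` itself if `S w = -w`. The basis is then sorted by the eigenvalue of `S`. -/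
lemma exists_adapted_BDI (T P : AntiUnitary n) (hT : ∀ v, T (T v) = v) (hP : ∀ v, P (P v) = v)
    (hTP : ∀ v, T (P v) = P (T v)) {H : Matrix (Fin n) (Fin n) ℂ}
    (hH : H ∈ (AZSymmetry.BDI T P hT hP hTP).invertibles) :
    ∃ b, (AZSymmetry.BDI T P hT hP hTP).Adapted b := by
  have hS (v : Hilb n) : T (P (T (P v))) = v := by rw [hTP (T (P v)), hT, hP]
  have hTS (v : Hilb n) : T (P (T v)) = T (T (P v)) := by rw [hTP v]
  obtain ⟨b, hb⟩ := exists_orthonormalBasis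
    (fun v => T v = v ∧ (T (P v) = v ∨ T (P v) = -v)) fun k e he hk => by
      have hWT (v : Hilb n) (hv : v ∈ orthoFamily e) : T v ∈ orthoFamily e := by
        rw [mem_orthoFamily] at hv ⊢
        exact fun i => inner_anti_left T (he i).1 (hv i)
      have hWS (v : Hilb n) (hv : v ∈ orthoFamily e) : T (P v) ∈ orthoFamily e := by
        rw [mem_orthoFamily] at hv ⊢
        intro i
        have h := inner_chiral T P (e i) v
        rcases (he i).2 with h2 | h2
        · rwa [h2, hv] at h
        · rwa [h2, inner_neg_left, hv, neg_eq_zero] at h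
      obtain ⟨w, hw, hw1, hTw⟩ := exists_real_unit T hT hWT (exists_mem_orthoFamily e hk)
      by_cases h0 : w + T (P w) = 0
      · exact ⟨w, hw, hw1, hTw, Or.inr (eq_neg_of_add_eq_zero_right h0)⟩
      · have hr (x : Hilb n) (r : ℝ) : T ((r : ℂ) • x) = (r : ℂ) • T x := by
          rw [anti_smul, RCLike.star_def, Complex.conj_ofReal]
        have hr' (x : Hilb n) (r : ℝ) : P ((r : ℂ) • x) = (r : ℂ) • P x := by
          rw [anti_smul, RCLike.star_def, Complex.conj_ofReal]
        refine ⟨((‖w + T (P w)‖⁻¹ : ℝ) : ℂ) • (w + T (P w)),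
          (orthoFamily e).smul_mem _ ((orthoFamily e).add_mem hw (hWS w hw)), ?_, ?_, Or.inl ?_⟩
        · rw [norm_smul, Complex.norm_real, norm_inv, norm_norm,
            inv_mul_cancel₀ (norm_ne_zero_iff.2 h0)]
        · rw [hr, map_add, ← hTS, hTw]
        · rw [hr', hr, map_add, map_add, hS, add_comm]
  set ε : Fin n → ℝ := fun j => if T (P (b j)) = b j then 1 else -1 with hε
  have hε' (j : Fin n) : T (P (b j)) = (ε j : ℂ) • b j := by
    by_cases h : T (P (b j)) = b j
    · simp [hε, h]
    · simp only [hε, if_neg h]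
      rw [(hb j).2.resolve_left h]
      simp
  have hcard := card_filter_eq_half (ε := ε) (fun j => by simp only [hε]; split_ifs <;> simp)
    (isUnit_matrixIn b hH.2.1) fun j k => by
      have h1 (v : Hilb n) : T (P (toEuclideanLin H v)) = -toEuclideanLin H (T (P v)) := by
        rw [hH.2.2.2, map_neg, hH.2.2.1]
      have h2 := inner_chiral T P (b j) (toEuclideanLin H (b k))
      rw [h1, hε', hε', map_smul, inner_neg_right, inner_smul_left, inner_smul_right,
        Complex.conj_ofReal] at h2
      have h3 : (ε j : ℂ) * ε j = 1 := by simp only [hε]; split_ifs <;> simp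
      rw [matrixIn_apply]
      linear_combination (-(ε j : ℂ)) * h2 - (ε k : ℂ) * inner ℂ (b j) (toEuclideanLin H (b k)) * h3
  have hn : Even n := ⟨_, (two_mul _).symm.trans hcard |>.symm⟩
  have hcard' : Fintype.card {j : Fin n // (j : ℕ) < n / 2}
      = Fintype.card {j : Fin n // ε j = 1} := by
    rw [Fintype.card_subtype, Fintype.card_subtype, Fin.card_filter_val_lt]
    omega
  set e := (Fintype.equivOfCardEq hcard').extendSubtype with he
  refine ⟨b.reindex e.symm, hn, fun j => ?_, fun j => ?_⟩
  · rw [OrthonormalBasis.reindex_apply]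
    exact (hb _).1
  · rw [OrthonormalBasis.reindex_apply, Equiv.symm_symm, hε']
    split_ifs with hj
    · rw [(Fintype.equivOfCardEq hcard').extendSubtype_mem j hj]
      simp
    · have h4 := (Fintype.equivOfCardEq hcard').extendSubtype_not_mem j hj
      have h5 : ε (e j) = -1 := by
        simp only [hε, ite_eq_right_iff] at h4 ⊢
        intro h6
        exact (h4 (by rw [if_pos h6])).elim
      rw [h5]
      simp

end adaptedBasis

/-! ### Normal forms in adapted coordinates -/

section normalForm
variable {n : ℕ} {b : OrthonormalBasis (Fin n) ℂ (Hilb n)} {H : Matrix (Fin n) (Fin n) ℂ}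

lemma conj_matrixIn_of_comm {T : AntiUnitary n} (hb : ∀ j, T (b j) = b j) (h : CommutesWith H T)
    (j k : Fin n) : star (matrixIn b H j k) = matrixIn b H j k := by
  have h1 := anti_inner T (b j) (toEuclideanLin H (b k))
  rw [h, hb, hb, ← inner_conj_symm _ (b j)] at h1
  exact h1.symm

lemma conj_matrixIn_of_anticomm {P : AntiUnitary n} (hb : ∀ j, P (b j) = b j)
    (h : AnticommutesWith H P) (j k : Fin n) :
    star (matrixIn b H j k) = -matrixIn b H j k := by
  have h1 := anti_inner P (b j) (toEuclideanLin H (b k))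
  rw [h, hb, hb, ← inner_conj_symm _ (b j), inner_neg_right] at h1
  exact h1.symm

lemma matrixIn_eq_negI {P : AntiUnitary n} (hb : ∀ j, P (b j) = b j)
    (h : AnticommutesWith H P) :
    matrixIn b H = negI (realMatrix (Complex.I • matrixIn b H)) := by
  ext j k
  have h1 := congrArg Complex.re (conj_matrixIn_of_anticomm hb h j k)
  rw [RCLike.star_def, Complex.conj_re, Complex.neg_re] at h1
  apply Complex.ext
  · rw [negI_apply]
    exact self_eq_neg.1 h1
  · simp [negI_apply, realMatrix]

lemma matrixIn_eq_map_ofReal {T : AntiUnitary n} (hb : ∀ j, T (b j) = b j)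
    (h : CommutesWith H T) : matrixIn b H = (realMatrix (matrixIn b H)).map Complex.ofReal := by
  ext j k
  have h1 := conj_matrixIn_of_comm hb h j k
  rw [RCLike.star_def, Complex.conj_eq_iff_re] at h1
  exact h1.symm

lemma negI_injective {A B : Matrix (Fin n) (Fin n) ℝ} (h : negI A = negI B) : A = B := by
  ext a b
  have := congrArg (fun M => Complex.im (M a b)) h
  simpa [negI_apply] using this

lemma negI_eq_smul (A : Matrix (Fin n) (Fin n) ℝ) :
    negI A = (-Complex.I) • A.map Complex.ofReal := by
  ext a b
  apply Complex.ext <;> simp [negI_apply]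

lemma skew_of_isHermitian_negI {A : Matrix (Fin n) (Fin n) ℝ} (h : (negI A).IsHermitian)
    (a b : Fin n) : A a b = -A b a := by
  have := congrArg Complex.im (h.apply a b)
  simp only [negI_apply, RCLike.star_def, Complex.conj_im] at this
  linarith

lemma det_map_ofReal (A : Matrix (Fin n) (Fin n) ℝ) :
    (A.map Complex.ofReal).det = (A.det : ℂ) :=
  (RingHom.map_det Complex.ofRealHom A).symm

lemma det_ne_zero_of_isUnit_map {A : Matrix (Fin n) (Fin n) ℝ}
    (h : IsUnit (A.map Complex.ofReal)) : A.det ≠ 0 := by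
  rw [Matrix.isUnit_iff_isUnit_det, det_map_ofReal, isUnit_iff_ne_zero] at h
  exact_mod_cast h

lemma det_ne_zero_of_isUnit_negI {A : Matrix (Fin n) (Fin n) ℝ} (h : IsUnit (negI A)) :
    A.det ≠ 0 := by
  rw [Matrix.isUnit_iff_isUnit_det, negI_eq_smul, Matrix.det_smul, det_map_ofReal,
    isUnit_iff_ne_zero] at h
  exact_mod_cast right_ne_zero_of_mul h

/-- In odd dimension a skew-symmetric matrix satisfies `det A = det Aᵀ = -det A`. -/
lemma even_of_skew {A : Matrix (Fin n) (Fin n) ℝ} (hA : ∀ a b, A a b = -A b a) (hd : A.det ≠ 0) :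
    Even n := by
  have h1 : Aᵀ = -A := by
    ext a b
    rw [transpose_apply, neg_apply, hA b a]
  have h2 := congrArg Matrix.det h1
  rw [det_transpose, det_neg, Fintype.card_fin] at h2
  rcases Nat.even_or_odd n with h | h
  · exact h
  · rw [h.neg_one_pow, neg_one_mul] at h2
    exact (hd (self_eq_neg.1 h2)).elim

/-- Elimination shows that the Pfaffian of an invertible skew-symmetric matrix has a sign. -/
lemma pfaffian_ne_zero {A : Matrix (Fin n) (Fin n) ℝ} (hA : ∀ a b, A a b = -A b a)
    (hd : A.det ≠ 0) : pfaffian A ≠ 0 := by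
  obtain ⟨_, _, _, _, h1, h2⟩ :=
    exec_pfProgram (holds_inputStore (negI A)) hA hd (even_of_skew hA hd)
  intro h0
  rw [h0, Real.sign_zero] at h1
  rw [h1] at h2
  norm_num at h2

/-- The two halves of the indices. -/
def halfEquiv (hn : Even n) : Fin (n / 2) ⊕ Fin (n / 2) ≃ Fin n :=
  Equiv.ofBijective (Sum.elim lowIdx highIdx) <| by
    refine (Fintype.bijective_iff_injective_and_card _).2 ⟨?_, ?_⟩
    · rintro (a | a) (c | c) h
      · rw [lowIdx_inj.1 h]
      · exact (lowIdx_ne_highIdx a c h).elim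
      · exact (lowIdx_ne_highIdx c a h.symm).elim
      · rw [highIdx_inj.1 h]
    · have := hn.two_dvd
      simp only [Fintype.card_sum, Fintype.card_fin]
      omega

lemma sum_halves (hn : Even n) (f : Fin n → ℝ) :
    ∑ j, f j = ∑ a, f (lowIdx a) + ∑ a, f (highIdx a) := by
  rw [← (halfEquiv hn).sum_comp, Fintype.sum_sum_type]
  rfl

/-- If the diagonal blocks vanish, exchanging the two halves of the columns makes the matrix
block-diagonal. -/
lemma det_block_ne_zero (hn : Even n) {A : Matrix (Fin n) (Fin n) ℝ} (hd : A.det ≠ 0)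
    (h1 : ∀ a c, A (lowIdx a) (lowIdx c) = 0) (h2 : ∀ a c, A (highIdx a) (highIdx c) = 0) :
    (block A).det ≠ 0 := by
  have h : A.submatrix (halfEquiv hn) ((Equiv.sumComm _ _).trans (halfEquiv hn))
      = fromBlocks (block A) 0 0 (A.submatrix highIdx lowIdx) := by
    ext (a | a) (c | c)
    · rfl
    · exact h1 a c
    · exact h2 a c
    · rfl
  have hu : IsUnit A := (Matrix.isUnit_iff_isUnit_det _).2 hd.isUnit
  rw [← isUnit_submatrix_equiv (halfEquiv hn) ((Equiv.sumComm _ _).trans (halfEquiv hn)), h,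
    isUnit_fromBlocks_zero₂₁] at hu
  exact ((Matrix.isUnit_iff_isUnit_det _).1 hu.1).ne_zero

end normalForm

section classD
variable {n : ℕ} {b : OrthonormalBasis (Fin n) ℂ (Hilb n)} {H : Matrix (Fin n) (Fin n) ℂ}
  {P : AntiUnitary n} {hP : ∀ v, P (P v) = v}

lemma skew_of_mem_D (hb : (AZSymmetry.D P hP).Adapted b)
    (hH : H ∈ (AZSymmetry.D P hP).invertibles) (j k : Fin n) :
    realMatrix (Complex.I • matrixIn b H) j k = -realMatrix (Complex.I • matrixIn b H) k j :=
  skew_of_isHermitian_negI (by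
    rw [← matrixIn_eq_negI hb hH.2.2]
    exact isHermitian_matrixIn b hH.1) j k

lemma det_ne_zero_of_mem_D (hb : (AZSymmetry.D P hP).Adapted b)
    (hH : H ∈ (AZSymmetry.D P hP).invertibles) :
    (realMatrix (Complex.I • matrixIn b H)).det ≠ 0 :=
  det_ne_zero_of_isUnit_negI (by
    rw [← matrixIn_eq_negI hb hH.2.2]
    exact isUnit_matrixIn b hH.2.1)

end classD

section classBDI
variable {n : ℕ} {b : OrthonormalBasis (Fin n) ℂ (Hilb n)} {H : Matrix (Fin n) (Fin n) ℂ}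
  {T P : AntiUnitary n} {hT : ∀ v, T (T v) = v} {hP : ∀ v, P (P v) = v}
  {hTP : ∀ v, T (P v) = P (T v)}

lemma chiral_lowIdx (hb : (AZSymmetry.BDI T P hT hP hTP).Adapted b) (a : Fin (n / 2)) :
    T (P (b (lowIdx a))) = b (lowIdx a) := by
  exact (hb.2.2 _).trans (if_pos a.2)

lemma chiral_highIdx (hb : (AZSymmetry.BDI T P hT hP hTP).Adapted b) (a : Fin (n / 2)) :
    T (P (b (highIdx a))) = -b (highIdx a) := by
  exact (hb.2.2 _).trans (if_neg (by simp [highIdx]))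

lemma det_block_ne_zero_of_mem_BDI (hb : (AZSymmetry.BDI T P hT hP hTP).Adapted b)
    (hH : H ∈ (AZSymmetry.BDI T P hT hP hTP).invertibles) :
    (block (realMatrix (matrixIn b H))).det ≠ 0 := by
  have h1 (v : Hilb n) : T (P (toEuclideanLin H v)) = -toEuclideanLin H (T (P v)) := by
    rw [hH.2.2.2, map_neg, hH.2.2.1]
  refine det_block_ne_zero hb.1 (det_ne_zero_of_isUnit_map ?_) (fun a c => ?_) fun a c => ?_
  · rw [← matrixIn_eq_map_ofReal hb.2.1 hH.2.2.1]
    exact isUnit_matrixIn b hH.2.1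
  · have h2 := inner_chiral T P (b (lowIdx a)) (toEuclideanLin H (b (lowIdx c)))
    rw [h1, chiral_lowIdx hb, chiral_lowIdx hb, inner_neg_right] at h2
    rw [realMatrix, Matrix.map_apply, matrixIn_apply, self_eq_neg.1 h2.symm, Complex.zero_re]
  · have h2 := inner_chiral T P (b (highIdx a)) (toEuclideanLin H (b (highIdx c)))
    rw [h1, chiral_highIdx hb, chiral_highIdx hb, map_neg, inner_neg_right, inner_neg_left,
      inner_neg_right, neg_neg] at h2
    rw [realMatrix, Matrix.map_apply, matrixIn_apply, self_eq_neg.1 h2.symm, Complex.zero_re]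

end classBDI

/-! ### Reflections reverse the index -/

section householder
variable {n : ℕ} {b : OrthonormalBasis (Fin n) ℂ (Hilb n)} {H : Matrix (Fin n) (Fin n) ℂ}

/-- The reflection of `ℝᵐ` in the hyperplane orthogonal to the unit vector `x`. -/
def householder {m : ℕ} (x : Fin m → ℝ) : Matrix (Fin m) (Fin m) ℝ := 1 - vecMulVec ((2 : ℝ) • x) x

lemma det_householder {m : ℕ} {x : Fin m → ℝ} (hx : ∑ j, x j ^ 2 = 1) :
    (householder x).det = -1 := by
  have h : householder x = 1 + replicateCol Unit (-((2 : ℝ) • x)) * replicateRow Unit x := by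
    rw [← vecMulVec_eq, neg_vecMulVec, householder, sub_eq_add_neg]
  rw [h, det_one_add_replicateCol_mul_replicateRow, dotProduct_neg, dotProduct_smul, dotProduct]
  simp only [← sq, hx]
  norm_num

lemma householder_transpose {m : ℕ} (x : Fin m → ℝ) : (householder x)ᵀ = householder x := by
  ext i j
  simp only [householder, transpose_apply, Matrix.sub_apply, vecMulVec_apply, Pi.smul_apply,
    smul_eq_mul, Matrix.one_apply, eq_comm (a := i)]
  ring

/-- The coordinates of a real vector. -/
def coords (b : OrthonormalBasis (Fin n) ℂ (Hilb n)) (u : Hilb n) (j : Fin n) : ℝ :=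
  (inner ℂ (b j) u).re

variable {T : AntiUnitary n} {u : Hilb n}

lemma inner_eq_coords (hb : ∀ j, T (b j) = b j) (hu : T u = u) (j : Fin n) :
    inner ℂ (b j) u = (coords b u j : ℂ) := by
  have h := anti_inner T (b j) u
  rw [hb, hu, ← inner_conj_symm u] at h
  exact (Complex.conj_eq_iff_re.1 h.symm).symm

lemma sum_coords_sq (hb : ∀ j, T (b j) = b j) (hu : T u = u) (hu1 : ‖u‖ = 1) :
    ∑ j, coords b u j ^ 2 = 1 := by
  have h := b.sum_sq_norm_inner_right u
  rw [hu1, one_pow] at h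
  rw [← h]
  refine Finset.sum_congr rfl fun j _ => ?_
  rw [inner_eq_coords hb hu, Complex.norm_real, Real.norm_eq_abs, sq_abs]

lemma matrixIn_reflect (hb : ∀ j, T (b j) = b j) (hu : T u = u) :
    matrixIn b (reflect u) = (householder (coords b u)).map Complex.ofReal := by
  ext j k
  rw [matrixIn_apply, toLin_reflect, inner_sub_right, ← Complex.coe_smul, inner_smul_right,
    inner_smul_right, inner_eq_coords hb hu, ← inner_conj_symm u, inner_eq_coords hb hu,
    orthonormal_iff_ite.1 b.orthonormal]
  simp only [householder, Matrix.map_apply, Matrix.sub_apply, Matrix.one_apply, vecMulVec_apply,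
    Pi.smul_apply, smul_eq_mul, Complex.conj_ofReal]
  split_ifs <;> push_cast <;> ring

lemma map_ofReal_mul (A B : Matrix (Fin n) (Fin n) ℝ) :
    (A * B).map Complex.ofReal = A.map Complex.ofReal * B.map Complex.ofReal :=
  Matrix.map_mul (f := Complex.ofRealHom)

/-- In adapted coordinates the reflection is real orthogonal of determinant `-1`. -/
lemma sign_pfaffian_reflect {P : AntiUnitary n} {hP : ∀ v, P (P v) = v}
    (hb : (AZSymmetry.D P hP).Adapted b) (hH : H ∈ (AZSymmetry.D P hP).invertibles)
    (hK : reflect u * H * reflect u ∈ (AZSymmetry.D P hP).invertibles) (hu : P u = u)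
    (hu1 : ‖u‖ = 1) :
    Real.sign (pfaffian (realMatrix (Complex.I • matrixIn b (reflect u * H * reflect u))))
      = -Real.sign (pfaffian (realMatrix (Complex.I • matrixIn b H))) := by
  have h1 := matrixIn_eq_negI hb hK.2.2
  have h2 := matrixIn_eq_negI hb hH.2.2
  set K := realMatrix (Complex.I • matrixIn b (reflect u * H * reflect u))
  set A := realMatrix (Complex.I • matrixIn b H)
  set R := householder (coords b u)
  have h3 : K = R * A * Rᵀ := by
    apply negI_injective
    rw [← h1, matrixIn_mul, matrixIn_mul, matrixIn_reflect hb hu, h2, negI_eq_smul, negI_eq_smul,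
      householder_transpose, map_ofReal_mul, map_ofReal_mul, mul_smul_comm, smul_mul_assoc]
  rw [h3, pfaffian_congruence, det_householder (sum_coords_sq hb hu hu1), neg_one_mul,
    Real.sign_neg]

/-- The reflection acts on the first half of the coordinates only, where it has determinant `-1`. -/
lemma sign_det_block_reflect {T P : AntiUnitary n} {hT : ∀ v, T (T v) = v}
    {hP : ∀ v, P (P v) = v} {hTP : ∀ v, T (P v) = P (T v)}
    (hb : (AZSymmetry.BDI T P hT hP hTP).Adapted b)
    (hH : H ∈ (AZSymmetry.BDI T P hT hP hTP).invertibles)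
    (hK : reflect u * H * reflect u ∈ (AZSymmetry.BDI T P hT hP hTP).invertibles) (huT : T u = u)
    (huP : P u = u) (hu1 : ‖u‖ = 1) :
    Real.sign (block (realMatrix (matrixIn b (reflect u * H * reflect u)))).det
      = -Real.sign (block (realMatrix (matrixIn b H))).det := by
  have h1 := matrixIn_eq_map_ofReal hb.2.1 hK.2.2.1
  have h2 := matrixIn_eq_map_ofReal hb.2.1 hH.2.2.1
  set K := realMatrix (matrixIn b (reflect u * H * reflect u))
  set A := realMatrix (matrixIn b H)
  set x := coords b u with hx
  have h3 : K = householder x * A * householder x := by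
    apply Matrix.map_injective Complex.ofReal_injective
    beta_reduce
    rw [map_ofReal_mul, map_ofReal_mul]
    exact h1.symm.trans (by rw [matrixIn_mul, matrixIn_mul, matrixIn_reflect hb.2.1 huT]; rw [h2])
  -- `T ∘ P` fixes `u`, so that `u` lies in the span of the first half of the basis.
  have hhigh (a : Fin (n / 2)) : x (highIdx a) = 0 := by
    have h4 := inner_chiral T P (b (highIdx a)) u
    rw [chiral_highIdx hb, huP, huT, inner_neg_left] at h4
    rw [hx, coords, self_eq_neg.1 h4.symm, Complex.zero_re]
  have h5 : block K = householder (fun a => x (lowIdx a)) * block A := by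
    ext a c
    have e1 (j : Fin n) : (householder x * A * householder x) j (highIdx c)
        = (householder x * A) j (highIdx c) := by
      rw [householder, mul_sub, mul_one, Matrix.sub_apply, Matrix.mul_vecMulVec, vecMulVec_apply,
        hhigh, mul_zero, sub_zero]
    have e2 (m : ℕ) (y : Fin m → ℝ) (B : Matrix (Fin m) (Fin m) ℝ) (i j : Fin m) :
        (householder y * B) i j = B i j - 2 * y i * ∑ k, y k * B k j := by
      rw [householder, sub_mul, one_mul, Matrix.sub_apply, Matrix.vecMulVec_mul, vecMulVec_apply]
      rfl
    rw [block, Matrix.submatrix_apply, h3, e1, e2, e2, sum_halves hb.1]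
    simp [hhigh, block]
  have h6 : ∑ a, x (lowIdx a) ^ 2 = 1 := by
    have h7 : ∑ j, x j ^ 2 = 1 := sum_coords_sq hb.2.1 huT hu1
    rw [sum_halves hb.1] at h7
    simpa [hhigh] using h7
  rw [h5, det_mul, det_householder h6, neg_one_mul, Real.sign_neg]

end householder

/-! ### The range of the index -/

section range
variable {n : ℕ} {F H : Matrix (Fin n) (Fin n) ℂ}

/-- The signature is `n` minus twice the number of negative eigenvalues. -/
lemma exists_signature_eq (hH : H.IsHermitian) (hu : IsUnit H) :
    ∃ k : ℤ, (signature H : ℝ) = n + 2 * k := by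
  have h0 (j : Fin n) : hH.eigenvalues j ≠ 0 := by
    rw [Matrix.isUnit_iff_isUnit_det, hH.det_eq_prod_eigenvalues, isUnit_iff_ne_zero,
      Finset.prod_ne_zero_iff] at hu
    exact Complex.ofReal_ne_zero.1 (hu j (Finset.mem_univ j))
  have h1 (j : Fin n) : Real.sign (hH.eigenvalues j)
      = 1 + 2 * ((if hH.eigenvalues j < 0 then -1 else 0 : ℤ) : ℝ) := by
    rcases (h0 j).lt_or_gt with h | h
    · rw [Real.sign_of_neg h, if_pos h]
      norm_num
    · rw [Real.sign_of_pos h, if_neg h.not_gt]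
      norm_num
  refine ⟨∑ j, if hH.eigenvalues j < 0 then -1 else 0, ?_⟩
  rw [signature_eq_sum hH, Finset.sum_congr rfl fun j _ => h1 j, Finset.sum_add_distrib,
    ← Finset.mul_sum]
  simp

lemma trace_of_involution (hF : F.IsHermitian) (hF2 : F * F = 1) : F.trace = (signature F : ℝ) := by
  have hsa : IsSelfAdjoint F := hF
  have h : sgn F = F := by
    rw [sgn]
    conv_rhs => rw [← cfc_id ℝ F]
    refine cfc_congr fun x hx => ?_
    have h1 := spectrum.pow_mem_pow F 2 hx
    rw [sq F, hF2] at h1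
    have h2 : x ^ 2 = 1 := by
      by_contra h3
      refine h1 ?_
      rw [spectrum.mem_resolventSet_iff, ← map_one (algebraMap ℝ (Matrix (Fin n) (Fin n) ℂ)),
        ← map_sub]
      exact (sub_ne_zero.2 h3).isUnit.map _
    rcases sq_eq_sq_iff_eq_or_eq_neg.1 (h2.trans (one_pow 2).symm) with h4 | h4 <;>
    simp [h4, Real.sign_neg]
  rw [← trace_sgn hF, h]

/-- The `-1`-eigenspace of an involution commuting with `T`, where `T² = -1`, is a union of Kramers
pairs `v`, `T v`; reversing the sign of `F` on one pair adds `4` to the trace. -/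
lemma exists_trace_eq_AII {T : AntiUnitary n} {hT : ∀ v, T (T v) = -v}
    (hF : F ∈ (AZSymmetry.AII T hT).invertibles) (hF2 : F * F = 1) :
    ∃ k : ℤ, F.trace = n + 4 * k := by
  induction hd : Module.finrank ℂ (LinearMap.ker (toEuclideanLin (F + 1)))
    using Nat.strong_induction_on generalizing F with
  | _ d ih =>
  by_cases h : ∃ v ∈ LinearMap.ker (toEuclideanLin (F + 1)), v ≠ 0
  · obtain ⟨v, hv, hv1⟩ := exists_unit h
    rw [LinearMap.mem_ker, toLin_add, toLin_one] at hv
    have hFv : toEuclideanLin F v = -v := eq_neg_of_add_eq_zero_left hv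
    have hFT : toEuclideanLin F (T v) = -T v := by rw [← hF.2.2 v, hFv, map_neg]
    have hvT := inner_anti_self T hT v
    have hTv : inner ℂ (T v) v = 0 := by rw [← inner_conj_symm, hvT, map_zero]
    have hvv : inner ℂ v v = 1 := by rw [inner_self_eq_norm_sq_to_K, hv1]; simp
    have hTT : inner ℂ (T v) (T v) = 1 := by rw [anti_inner, hvv]
    set Q := outer v v + outer (T v) (T v) with hQ
    have hQH : Qᴴ = Q := by rw [hQ, conjTranspose_add, conjTranspose_outer, conjTranspose_outer]
    have hQ2 : Q * Q = Q := by
      simp only [hQ, add_mul, mul_add, outer_mul_outer, hvv, hTT, hvT, hTv, one_smul, zero_smul,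
        add_zero, zero_add]
    have hFQ : F * Q = -Q := by
      rw [hQ, mul_add, mul_outer, mul_outer, hFv, hFT, outer_neg_left, outer_neg_left,
        neg_add]
    have hQF : Q * F = -Q := by
      have := congrArg conjTranspose hFQ
      rwa [conjTranspose_mul, conjTranspose_neg, hF.1.eq, hQH] at this
    set F' := F + (2 : ℝ) • Q with hF'
    have hF'2 : F' * F' = 1 := by
      rw [hF']
      simp only [add_mul, mul_add, smul_mul_assoc, mul_smul_comm, hF2, hFQ, hQF, hQ2]
      module
    have hTQ (w : Hilb n) : T (toEuclideanLin Q w) = toEuclideanLin Q (T w) := by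
      have h1 : inner ℂ v (T w) = -star (inner ℂ (T v) w) := by
        have := anti_inner T v (T w)
        rw [hT, inner_neg_right] at this
        have h2 := inner_conj_symm (𝕜 := ℂ) v (T w)
        rw [← h2, ← this, map_neg]
        rfl
      have h3 : inner ℂ (T v) (T w) = star (inner ℂ v w) := by
        rw [anti_inner]
        exact (inner_conj_symm w v).symm
      rw [hQ, toLin_add, toLin_add, toLin_outer, toLin_outer, toLin_outer, toLin_outer, map_add,
        anti_smul, anti_smul, hT, h1, h3]
      module
    have hF'm : F' ∈ (AZSymmetry.AII T hT).invertibles := by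
      refine ⟨?_, isUnit_of_sq_eq_one hF'2, fun w => ?_⟩
      · rw [Matrix.IsHermitian, hF', conjTranspose_add, conjTranspose_smul, hQH, hF.1.eq]
        simp
      · have hr (x : Hilb n) (r : ℝ) : T (r • x) = r • T x := (antiOp T).map_smul r x
        rw [hF', toLin_add, toLin_add, toLin_smul_left, toLin_smul_left, map_add, hr, hTQ,
          hF.2.2]
    have hlt : LinearMap.ker (toEuclideanLin (F' + 1)) <
        LinearMap.ker (toEuclideanLin (F + 1)) := by
      have key (w : Hilb n) (hw : toEuclideanLin (F' + 1) w = 0) :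
          toEuclideanLin (F + 1) w = 0 ∧ toEuclideanLin Q w = 0 := by
        have h1 : toEuclideanLin Q w = 0 := by
          have h2 : Q * (F' + 1) = (2 : ℝ) • Q := by
            rw [hF', mul_add, mul_add, hQF, mul_smul_comm, hQ2, mul_one]
            module
          have h3 := toLin_mul Q (F' + 1) w
          rw [hw, map_zero, h2, toLin_smul_left] at h3
          exact (smul_eq_zero.1 h3).resolve_left two_ne_zero
        refine ⟨?_, h1⟩
        rw [hF', toLin_add, toLin_add, toLin_smul_left, h1, smul_zero, add_zero] at hw
        rw [toLin_add, hw]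
      refine lt_of_le_of_ne (fun w hw => (key w hw).1) fun he => ?_
      have hvm : v ∈ LinearMap.ker (toEuclideanLin (F' + 1)) := by
        rw [he, LinearMap.mem_ker, toLin_add, toLin_one, hv]
      have h1 := (key v hvm).2
      rw [hQ, toLin_add, toLin_outer, toLin_outer, hvv, hTv, one_smul, zero_smul, add_zero] at h1
      rw [h1, norm_zero] at hv1
      exact zero_ne_one hv1
    obtain ⟨k, hk⟩ := ih _ (hd ▸ Submodule.finrank_lt_finrank_of_lt hlt) hF'm hF'2 rfl
    have htr (a : Hilb n) : (outer a a).trace = inner ℂ a a := by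
      rw [outer, trace_vecMulVec, EuclideanSpace.inner_eq_star_dotProduct]
    have htQ : Q.trace = 2 := by
      rw [hQ, trace_add, htr, htr, hvv, hTT]
      norm_num
    refine ⟨k - 1, ?_⟩
    rw [hF', trace_add, trace_smul, htQ, Complex.real_smul] at hk
    push_cast at hk ⊢
    linear_combination hk
  · push Not at h
    have hu : IsUnit (F + 1) := isUnit_of_injective fun v hv => h v hv
    have h1 : (F + 1) * (F - 1) = 0 := by
      rw [add_mul, mul_sub, hF2]
      simp
    have h2 : F = 1 := sub_eq_zero.1 (hu.mul_right_eq_zero.1 h1)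
    refine ⟨0, ?_⟩
    rw [h2, trace_one]
    simp

lemma exists_signature_eq_AII {T : AntiUnitary n} {hT : ∀ v, T (T v) = -v}
    (hH : H ∈ (AZSymmetry.AII T hT).invertibles) : ∃ k : ℤ, (signature H : ℝ) = n + 4 * k := by
  have h1 : sgn H ∈ (AZSymmetry.AII T hT).invertibles := by
    rw [AZSymmetry.invertibles_eq] at hH ⊢
    exact sgn_mem (AZSymmetry.constraints_sign _) hH
  obtain ⟨k, hk⟩ := exists_trace_eq_AII h1 (sgn_mul_sgn hH.1 hH.2.1)
  refine ⟨k, ?_⟩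
  rw [trace_sgn hH.1] at hk
  exact_mod_cast hk

end range

/-! ### The index classifies the components -/

section classification
variable {n : ℕ} {b : OrthonormalBasis (Fin n) ℂ (Hilb n)} {F G H : Matrix (Fin n) (Fin n) ℂ}

lemma sign_eq_of_joinedIn {S : Set (Matrix (Fin n) (Fin n) ℂ)} {f : Matrix (Fin n) (Fin n) ℂ → ℝ}
    (hf : Continuous f) (h0 : ∀ H ∈ S, f H ≠ 0) (h : JoinedIn S F G) :
    Real.sign (f F) = Real.sign (f G) := by
  obtain ⟨γ, hγ⟩ := h
  have hcont : Continuous fun t => f (γ t) := hf.comp γ.continuous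
  have hno : (0 : ℝ) ∉ Set.range fun t => f (γ t) := by
    rintro ⟨t, ht⟩
    exact h0 _ (hγ t) ht
  have h1 := h0 _ (hγ 0)
  have h2 := h0 _ (hγ 1)
  rw [γ.source] at h1
  rw [γ.target] at h2
  rcases h1.lt_or_gt with h3 | h3 <;> rcases h2.lt_or_gt with h4 | h4
  · rw [Real.sign_of_neg h3, Real.sign_of_neg h4]
  · exact (hno (mem_range_of_exists_le_of_exists_ge hcont ⟨0, by simpa using h3.le⟩
      ⟨1, by simpa using h4.le⟩)).elim
  · exact (hno (mem_range_of_exists_le_of_exists_ge hcont ⟨1, by simpa using h4.le⟩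
      ⟨0, by simpa using h3.le⟩)).elim
  · rw [Real.sign_of_pos h3, Real.sign_of_pos h4]

lemma continuous_pfaffian : Continuous (pfaffian (n := n)) := by
  unfold pfaffian
  split_ifs
  · refine continuous_const.mul (continuous_finsetSum _ fun σ _ => continuous_const.mul
      (continuous_finsetProd _ fun i _ => ?_))
    exact continuous_id.matrix_elem _ _
  · exact continuous_const

lemma continuous_realMatrix {m k : ℕ} : Continuous (realMatrix (m := m) (n := k)) :=
  continuous_id.matrix_map Complex.continuous_re

lemma index_eq_of_joinedIn {c : AZClass} (σ : AZSymmetry n c) (hb : σ.Adapted b)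
    (h : JoinedIn σ.invertibles F G) : index c (matrixIn b F) = index c (matrixIn b G) := by
  have hsig : signature (matrixIn b F) = signature (matrixIn b G) := by
    rw [signature_matrixIn b h.source_mem.1, signature_matrixIn b h.target_mem.1]
    exact signature_eq_of_joinedIn (fun B hB => ⟨hB.1, hB.2.1⟩) h
  cases σ with
  | A => simp only [index, hsig]
  | AI => simp only [index, hsig]
  | AII => simp only [index, hsig]
  | D P hP =>
    refine sign_eq_of_joinedIn (f := fun H => pfaffian (realMatrix (Complex.I • matrixIn b H)))
      (continuous_pfaffian.comp (continuous_realMatrix.comp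
        ((continuous_const_smul Complex.I).comp (continuous_matrixIn b)))) (fun H hH => ?_) h
    exact pfaffian_ne_zero (skew_of_mem_D hb hH) (det_ne_zero_of_mem_D hb hH)
  | BDI T P hT hP hTP =>
    refine sign_eq_of_joinedIn (f := fun H => (block (realMatrix (matrixIn b H))).det)
      (Continuous.matrix_det ((continuous_realMatrix.comp (continuous_matrixIn b)).matrix_submatrix
        _ _)) (fun H hH => ?_) h
    exact det_block_ne_zero_of_mem_BDI hb hH
  | _ => rfl

lemma index_mem_indexRange {c : AZClass} (σ : AZSymmetry n c) (hb : σ.Adapted b)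
    (hH : H ∈ σ.invertibles) : index c (matrixIn b H) ∈ indexRange c n := by
  have hpm (x : ℝ) (hx : x ≠ 0) : Real.sign x ∈ ({1, -1} : Set ℝ) :=
    (Real.sign_apply_eq_of_ne_zero x hx).symm
  have hsig := signature_matrixIn b hH.1
  obtain ⟨k, hk⟩ := exists_signature_eq hH.1 hH.2.1
  cases σ with
  | A => exact ⟨k, by simp only [index, hsig, hk]; ring⟩
  | AI => exact ⟨k, by simp only [index, hsig, hk]; ring⟩
  | AII =>
    obtain ⟨k, hk⟩ := exists_signature_eq_AII hH
    exact ⟨k, by simp only [index, hsig, hk]; ring⟩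
  | D P hP => exact hpm _ (pfaffian_ne_zero (skew_of_mem_D hb hH) (det_ne_zero_of_mem_D hb hH))
  | BDI T P hT hP hTP => exact hpm _ (det_block_ne_zero_of_mem_BDI hb hH)
  | _ => rfl

/-- In the classes `BDI` and `D`, the case without a rotation is excluded: it would join `G` to a
reflection of `F`, which has the opposite index. -/
lemma joinedIn_of_index_eq {c : AZClass} (σ : AZSymmetry n c) (hb : σ.Adapted b)
    (hF : F ∈ σ.invertibles) (hG : G ∈ σ.invertibles)
    (h : index c (matrixIn b F) = index c (matrixIn b G)) : JoinedIn σ.invertibles F G := by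
  have hι (F G) (hFG : JoinedIn (compatInvertibles σ.constraints) F G) :
      index c (matrixIn b F) = index c (matrixIn b G) := by
    rw [← σ.invertibles_eq] at hFG
    exact index_eq_of_joinedIn σ hb hFG
  rw [σ.invertibles_eq] at hF hG ⊢
  refine joinedIn_of_hasRotation σ.constraints_sign (fun H => index c (matrixIn b H)) hι
    (fun F hF G hG hF2 hG2 h hv => ?_) hF hG h
  have htr {d : ℝ} (hd : d ≠ 0)
      (h : (signature (matrixIn b F) : ℝ) / d = signature (matrixIn b G) / d) :
      F.trace = G.trace := by
    rw [signature_matrixIn b hF.1, signature_matrixIn b hG.1, div_left_inj' hd] at h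
    rw [trace_of_involution hF.1 hF2, trace_of_involution hG.1 hG2, h]
  have hsign {x : ℝ} (hx : x ≠ 0) (h : Real.sign x = -Real.sign x) : False :=
    hx (Real.sign_eq_zero_iff.1 (self_eq_neg.1 h))
  cases σ with
  | A => exact hasRotation_A hF hG hF2 hG2 (htr two_ne_zero h) hv
  | AI T hT => exact hasRotation_AI hF hG hF2 hG2 (htr two_ne_zero h) hv
  | AII T hT => exact hasRotation_AII hF hG hF2 hG2 (htr four_ne_zero h) hv
  | AIII S hS => exact hasRotation_AIII hF hG hF2 hG2 hv
  | C P hP => exact hasRotation_C hF hG hF2 hG2 hv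
  | CI T P hT hP hTP => exact hasRotation_CI hF hG hF2 hG2 hv
  | DIII T P hT hP hTP => exact hasRotation_DIII hF hG hF2 hG2 hv
  | CII T P hT hP hTP => exact hasRotation_CII hF hG hF2 hG2 hv
  | D P hP =>
    rcases hasRotation_D hF hG hF2 hG2 hv with h1 | ⟨u, hu1, hu, hj⟩
    · exact h1
    · have h2 := hι _ _ hj
      have hK := hj.source_mem
      rw [← AZSymmetry.invertibles_eq] at hF hK
      have h3 := sign_pfaffian_reflect hb hF hK hu hu1
      exact (hsign (pfaffian_ne_zero (skew_of_mem_D hb hF) (det_ne_zero_of_mem_D hb hF))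
        ((h.trans h2.symm).trans h3)).elim
  | BDI T P hT hP hTP =>
    rcases hasRotation_BDI hF hG hF2 hG2 hv with h1 | ⟨u, hu1, huT, huP, hj⟩
    · exact h1
    · have h2 := hι _ _ hj
      have hK := hj.source_mem
      rw [← AZSymmetry.invertibles_eq] at hF hK
      have h3 := sign_det_block_reflect hb hF hK huT huP hu1
      exact (hsign (det_block_ne_zero_of_mem_BDI hb hF) ((h.trans h2.symm).trans h3)).elim

end classification

/-! ### The index is computable in cubic time -/

section computability
variable {n : ℕ} {b : OrthonormalBasis (Fin n) ℂ (Hilb n)} {H : Matrix (Fin n) (Fin n) ℂ}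

/-- The program that computes the index of a class. -/
def indexProgram : AZClass → Program
  | .A => sigProgram 2
  | .AI => sigProgram 2
  | .AII => sigProgram 4
  | .D => pfProgram
  | .BDI => detProgram
  | _ => .skip

lemma exec_indexProgram {c : AZClass} (σ : AZSymmetry n c) (hb : σ.Adapted b)
    (hH : H ∈ σ.invertibles) :
    Exec (indexProgram c) (inputStore (matrixIn b H)) ((n + 1) ^ 3 * 2500) fun s =>
      s.output = index c (matrixIn b H) := by
  have hin := holds_inputStore (matrixIn b H)
  have hh := isHermitian_matrixIn b hH.1
  have hu := isUnit_matrixIn b hH.2.1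
  have hle (k : ℕ) (hk : k ≤ 2500) : (n + 1) ^ 3 * k ≤ (n + 1) ^ 3 * 2500 :=
    Nat.mul_le_mul_left _ hk
  have hpos : 1 ≤ (n + 1) ^ 3 := Nat.one_le_pow _ _ (by omega)
  cases σ with
  | A =>
    exact (exec_sigProgram hin hh hu 2).mono (hle _ (by norm_num)) fun s h =>
      h.trans (by simp [index])
  | AI T hT =>
    exact (exec_sigProgram hin hh hu 2).mono (hle _ (by norm_num)) fun s h =>
      h.trans (by simp [index])
  | AII T hT =>
    exact (exec_sigProgram hin hh hu 4).mono (hle _ (by norm_num)) fun s h =>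
      h.trans (by simp [index])
  | D P hP =>
    have hin' := (congrArg (Holds (inputStore (matrixIn b H)) 0 0 0 0)
      (matrixIn_eq_negI hb hH.2.2)).mp hin
    exact (exec_pfProgram hin' (skew_of_mem_D hb hH) (det_ne_zero_of_mem_D hb hH)
      (even_of_skew (skew_of_mem_D hb hH) (det_ne_zero_of_mem_D hb hH))).mono le_rfl
        fun s h => h.1
  | BDI T P hT hP hTP =>
    have hin' := (congrArg (Holds (inputStore (matrixIn b H)) 0 0 0 0)
      (matrixIn_eq_map_ofReal hb.2.1 hH.2.2.1)).mp hin
    exact exec_detProgram hin' (det_block_ne_zero_of_mem_BDI hb hH) hb.1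
  | _ => exact Exec.skip (by omega) (by simp [Store.output, inputStore, index])

end computability
end AZ
end

theorem mainTheorem2 (c : AZ.AZClass) :
    (∀ (n : ℕ) (σ : AZ.AZSymmetry n c), σ.invertibles.Nonempty →
      ∃ b : OrthonormalBasis (Fin n) ℂ (AZ.Hilb n), σ.Adapted b) ∧
    (∀ (n : ℕ) (σ : AZ.AZSymmetry n c) (b : OrthonormalBasis (Fin n) ℂ (AZ.Hilb n)),
      σ.Adapted b →
        (∀ H ∈ σ.invertibles, AZ.index c (AZ.matrixIn b H) ∈ AZ.indexRange c n) ∧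
        ∀ H₀ ∈ σ.invertibles, ∀ H₁ ∈ σ.invertibles,
          (JoinedIn σ.invertibles H₀ H₁ ↔
            AZ.index c (AZ.matrixIn b H₀) = AZ.index c (AZ.matrixIn b H₁))) ∧
    (∃ (p : AZ.Program) (K : ℕ), ∀ (n : ℕ) (σ : AZ.AZSymmetry n c)
      (b : OrthonormalBasis (Fin n) ℂ (AZ.Hilb n)), σ.Adapted b → ∀ H ∈ σ.invertibles,
        ∃ (t : ℕ) (s : AZ.Store),
          AZ.Runs p (AZ.inputStore (AZ.matrixIn b H)) t s ∧
          t ≤ K * (n ^ 3 + 1) ∧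
          s.output = AZ.index c (AZ.matrixIn b H)) := by
  refine ⟨fun n σ hne => ?_, fun n σ b hb => ⟨fun H hH => AZ.index_mem_indexRange σ hb hH,
    fun H₀ h₀ H₁ h₁ => ⟨AZ.index_eq_of_joinedIn σ hb, AZ.joinedIn_of_index_eq σ hb h₀ h₁⟩⟩,
    AZ.indexProgram c, 10000, fun n σ b hb H hH => ?_⟩
  · obtain ⟨H, hH⟩ := hne
    cases σ with
    | D P hP => exact AZ.exists_adapted_D P hP
    | BDI T P hT hP hTP => exact AZ.exists_adapted_BDI T P hT hP hTP hH
    | _ => exact ⟨EuclideanSpace.basisFun (Fin n) ℂ, trivial⟩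
  · obtain ⟨t, s, h1, h2, h3⟩ := AZ.exec_indexProgram σ hb hH
    refine ⟨t, s, h1, h2.trans ?_, h3⟩
    -- `4 (n³ + 1) - (n + 1)³ = 3 (n + 1) (n - 1)²`
    have h4 : (n + 1) ^ 3 ≤ 4 * (n ^ 3 + 1) := by
      zify
      nlinarith [mul_nonneg (show (0 : ℤ) ≤ n + 1 by positivity) (sq_nonneg ((n : ℤ) - 1))]
    omega
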